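/- **Setting.** Terms of $\Lambda_{\mathcal B}$ are $M ::= x \mid 0 \mid 1 \mid \lambda x.M \mid MM \mid \mathtt{if}\ M\ \mathtt{then}\ M\ \mathtt{else}\ M$, up to renaming of bound variables; $0$ stands for "true" (yes) and $1$ for "false" (no). Reduction is the contextual closure of $(\lambda x.M)N\to M[N/x]$, $\mathtt{if}\ 0\ \mathtt{then}\ M\ \mathtt{else}\ N\to M$, $\mathtt{if}\ 1\ \mathtt{then}\ M\ \mathtt{else}\ N\to N$, and $=$ below between terms is the equivalence it generates. Types of $\mathrm{STA}_{\mathbf B}$ are $A::=\mathbf B\mid\alpha\mid\sigma\multimap A\mid\forall\alpha.A$ (linear types) and $\sigma::=A\mid{!}\sigma$. The typing rules, with contexts that are finite sets of assumptions on distinct variables, are: $x:A\vdash x:A$; $\vdash 0:\mathbf B$; $\vdash 1:\mathbf B$; weakening by $x:A$ with $A$ linear; from $\Gamma,x:\sigma\vdash M:A$ infer $\Gamma\vdash\lambda x.M:\sigma\multimap A$; from $\Gamma\vdash M:\sigma\multimap A$ and $\Delta\vdash N:\sigma$ with disjoint domains infer $\Gamma,\Delta\vdash MN:A$; from $\Gamma,x_1:\sigma,\dots,x_n:\sigma\vdash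 M:\tau$ infer $\Gamma,x:{!}\sigma\vdash M[x/x_1,\dots,x/x_n]:\tau$; from $\Gamma\vdash M:\sigma$ infer ${!}\Gamma\vdash M:{!}\sigma$; the usual introduction and elimination of $\forall$, with instantiation by linear types; and from $\Gamma\vdash M:\mathbf B$, $\Gamma\vdash N_0:A$, $\Gamma\vdash N_1:A$ infer $\Gamma\vdash\mathtt{if}\ M\ \mathtt{then}\ N_0\ \mathtt{else}\ N_1:A$ (same $\Gamma$ in the three premises). A program is a term $M$ with $\vdash M:\mathbf B$. Programs are evaluated by a big-step call-by-name machine, which proves statements $\mathcal C,\mathcal A\models M\Downarrow b$, where $\mathcal A$ is a sequence of assignments $x:=N$ and $\mathcal C::=\circ\mid(\mathtt{if}\ \mathcal C\ \mathtt{then}\ M\ \mathtt{else}\ N)V_1\cdots V_n$ is a context, by the rules: $\mathcal C,\mathcal A\models b\Downarrow b$; $\mathcal C,\mathcal A\models(\lambda x.M)N\vec V\Downarrow b$ if $\mathcal C,\mathcal A@\{x':=N\}\models M[x'/x]\vec V\Downarrow b$ with $x'$ fresh; $\mathcal C,\mathcal A\models x\vec V\Downarrow b$ if $(x:=N)\in\mathcal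 A$ and $\mathcal C,\mathcal A\models N\vec V\Downarrow b$; and, for $i\in\{0,1\}$, $\mathcal C,\mathcal A\models(\mathtt{if}\ M\ \mathtt{then}\ N_0\ \mathtt{else}\ N_1)\vec V\Downarrow b$ if $\mathcal C[(\mathtt{if}\ \circ\ \mathtt{then}\ N_0\ \mathtt{else}\ N_1)\vec V],\mathcal A\models M\Downarrow i$ and $\mathcal C,\mathcal A\models N_i\vec V\Downarrow b$. Write $\models M\Downarrow b$ when $\mathcal C=\circ$ and $\mathcal A$ is empty. A string $s=b_0\cdots b_n\in\{0,1\}^*$ is encoded by $\underline s=\lambda c.\lambda z.c\,b_0(\cdots(c\,b_n\,z)\cdots)$, a number by its Church numeral $\underline n$. Put $\mathbf N_i=\forall\alpha.{!}^i(\alpha\multimap\alpha)\multimap\alpha\multimap\alpha$, $\mathbf N=\mathbf N_1$, $\mathbf S=\forall\alpha.{!}(\mathbf B\multimap\alpha\multimap\alpha)\multimap\alpha\multimap\alpha$, $\mathbf B^2=\forall\alpha.(\mathbf B\multimap\mathbf B\multimap\alpha)\multimap\alpha$, $\langle M,N\rangle=\lambda x.xMN$, $\pi_1(M)=M(\lambda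 x.\lambda y.x)$, $\pi_2(M)=M(\lambda x.\lambda y.y)$. A function $\mathcal D:\{0,1\}^*\to\{0,1\}$ is *$\mathbf B$-programmable* if there is a term $F$ such that, for all $s$, $F\underline s$ is a program and, for all $b$, $\mathcal D(s)=b\iff\models F\underline s\Downarrow b$; such an $F$ is called a witness. Alternating Turing machines (ATMs) have one two-way infinite tape, finitely many states and tape symbols, a transition relation of degree two given by two functions $\delta_1,\delta_2$, and states of four kinds, coded as accepting $\langle1,0\rangle$, rejecting $\langle1,1\rangle$, universal $\langle0,1\rangle$, existential $\langle0,0\rangle$. $\mathcal M$ *decides $\mathcal D$ in time $p$* if, for every $s$, every computation path from the initial configuration on $s$ reaches an accepting or rejecting state within $p(|s|)$ steps, and $\mathcal D(s)=0$ (yes) iff that configuration leads to acceptance in the usual alternating sense. **Statement.** Let $p$ be a polynomial with natural coefficients, of degree $d$ (with $d=0$ if $p=0$), and let $\mathcal D:\{0,1\}^*\to\{0,1\}$ be decided in time $p$ by an ATM $\mathcal M$. Then $\mathcal D$ is $\mathbf B$-programmable in $\mathrm{STA}_{\mathbf B}$. More precisely, there are a linear type $C$ and closed terms $\mathtt P,\mathtt{Kind},\mathtt{Tr}^1,\mathtt{Tr}^2,\mathtt{Init}$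 such that: 1. $\vdash\mathtt P:{!}^{d}\mathbf N\multimap\mathbf N_{2d+1}$ and $\mathtt P\,\underline n=\underline{p(n)}$ for all $n$; 2. $\vdash\mathtt{Kind}:C\multimap\mathbf B^2$, $\vdash\mathtt{Tr}^j:C\multimap C$ for $j=1,2$, and $\vdash\mathtt{Init}:{!}^{\max(d,1)}\mathbf S\multimap C$; 3. these terms implement $\mathcal M$: there is a relation $R_k(c,t)$ between numbers $k$, configurations $c$ and terms $t$ ("$t$ encodes $c$ with enough tape cells for $k$ further steps") such that $R_{p(|s|)}(c_s,\mathtt{Init}\,\underline s)$ for every $s$ with initial configuration $c_s$; $R_k(c,t)$ implies that $\vdash t:C$ and that $\mathtt{Kind}\,t=$ the code of the kind of the state of $c$; and $R_{k+1}(c,t)$ implies $R_k(c^j,\mathtt{Tr}^j t)$ for $j=1,2$, where $c^j$ is the successor of $c$ by $\delta_j$; 4. the term $$\mathtt{eval}_{\mathcal M}=\lambda s.\,\mathtt{Ext}\bigl((\mathtt P\ (\mathtt{len}\ s)\ \mathtt{Step}_{\mathcal M}\ \mathtt{Base})(\mathtt{Init}\ s)\bigr)$$ satisfies $\vdash\mathtt{eval}_{\mathcal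 M}:{!}^{t}\mathbf S\multimap\mathbf B$ with $t=\max(d,1)+1$, and it is a witness that $\mathcal D$ is $\mathbf B$-programmable, that is, $\mathtt{eval}_{\mathcal M}\,\underline s$ is a program and $\mathcal D(s)=b\iff\models\mathtt{eval}_{\mathcal M}\,\underline s\Downarrow b$. Here $\mathtt{len}=\lambda c.\lambda s.c(\lambda x.\lambda y.sy)$, $\mathtt{Ext}=\lambda x.x(\lambda l.\lambda r.r)$, $\mathtt{Base}=\lambda c.\mathtt{Kind}\,c$, $\mathtt{Step}_{\mathcal M}=\lambda h.\lambda c.\alpha(\mathtt{Kind}\,c,h(\mathtt{Tr}^1c),h(\mathtt{Tr}^2c))$, and $\alpha(M_0,M_1,M_2)$ is the term $$\mathtt{if}\ \pi_1(M_0)\ \mathtt{then}\ \bigl(\mathtt{if}\ \pi_2(M_0)\ \mathtt{then}\ \langle0,\pi_2(M_1)\ \mathtt{or}\ \pi_2(M_2)\rangle\ \mathtt{else}\ \langle0,\pi_2(M_1)\ \mathtt{and}\ \pi_2(M_2)\rangle\bigr)\ \mathtt{else}\ \langle1,\pi_2(M_0)\rangle,$$ with $M\ \mathtt{and}\ N=\mathtt{if}\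 M\ \mathtt{then}\ (\mathtt{if}\ N\ \mathtt{then}\ 0\ \mathtt{else}\ 1)\ \mathtt{else}\ 1$ and $M\ \mathtt{or}\ N=\mathtt{if}\ M\ \mathtt{then}\ 0\ \mathtt{else}\ (\mathtt{if}\ N\ \mathtt{then}\ 0\ \mathtt{else}\ 1)$. -/

import Mathlib

namespace STAB

/-! ### Terms

Terms are taken up to renaming of bound variables, in locally nameless form: free variables are
names (natural numbers), bound variables are de Bruijn indices. The boolean constant `0` of the
calculus, which denotes truth, is `.bool true`; the constant `1`, which denotes falsity, is
`.bool false`. -/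

inductive Term : Type
  | bvar (i : ℕ)
  | fvar (x : ℕ)
  | bool (b : Bool)
  | abs (M : Term)
  | app (M N : Term)
  | cond (M N₀ N₁ : Term)

namespace Term

/-- Free variables. -/
def fv : Term → Finset ℕ
  | bvar _ => ∅
  | fvar x => {x}
  | bool _ => ∅
  | abs M => M.fv
  | app M N => M.fv ∪ N.fv
  | cond M N₀ N₁ => M.fv ∪ N₀.fv ∪ N₁.fv

/-- Replace the bound variable `k` by the term `N`. -/
def instAt (k : ℕ) (N : Term) : Term → Term
  | bvar i => if i = k then N else bvar i
  | fvar x => fvar x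
  | bool b => bool b
  | abs M => abs (instAt (k + 1) N M)
  | app M M' => app (instAt k N M) (instAt k N M')
  | cond M M₀ M₁ => cond (instAt k N M) (instAt k N M₀) (instAt k N M₁)

/-- If `abs M` is `λx.P`, then `M.inst N` is `P[N/x]`. -/
def inst (M N : Term) : Term := instAt 0 N M

/-- Turn the free variable `x` into the bound variable `k`. -/
def closeAt (k x : ℕ) : Term → Term
  | bvar i => bvar i
  | fvar y => if y = x then bvar k else fvar y
  | bool b => bool b
  | abs M => abs (closeAt (k + 1) x M)
  | app M M' => app (closeAt k x M) (closeAt k x M')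
  | cond M M₀ M₁ => cond (closeAt k x M) (closeAt k x M₀) (closeAt k x M₁)

/-- The abstraction `λx.M` over the named variable `x`. -/
def lam (x : ℕ) (M : Term) : Term := abs (closeAt 0 x M)

/-- `M[x/x₁, …, x/xₙ]`, where `xs` lists `x₁, …, xₙ`. -/
def merge (xs : List ℕ) (x : ℕ) : Term → Term
  | bvar i => bvar i
  | fvar y => if y ∈ xs then fvar x else fvar y
  | bool b => bool b
  | abs M => abs (merge xs x M)
  | app M M' => app (merge xs x M) (merge xs x M')
  | cond M M₀ M₁ => cond (merge xs x M) (merge xs x M₀) (merge xs x M₁)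

/-- All bound indices are smaller than their binding depth plus `k`. -/
def LCAt : ℕ → Term → Prop
  | k, bvar i => i < k
  | _, fvar _ => True
  | _, bool _ => True
  | k, abs M => LCAt (k + 1) M
  | k, app M N => LCAt k M ∧ LCAt k N
  | k, cond M N₀ N₁ => LCAt k M ∧ LCAt k N₀ ∧ LCAt k N₁

/-- The expression has no dangling bound variable, that is, it is a term of the calculus. -/
def LC (M : Term) : Prop := LCAt 0 M

/-- `M V₁ ⋯ Vₘ`. -/
def apps (M : Term) (Vs : List Term) : Term := Vs.foldl app M

end Term

open Term

/-- One-step reduction: the contextual closure of `(λx.M)N → M[N/x]`, `if 0 then M else N → M`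
and `if 1 then M else N → N`. -/
inductive Red : Term → Term → Prop
  | beta {M N : Term} : LC (app (abs M) N) → Red (app (abs M) N) (M.inst N)
  | condTrue {M N : Term} : Red (cond (.bool true) M N) M
  | condFalse {M N : Term} : Red (cond (.bool false) M N) N
  | lam {M M' : Term} (x : ℕ) : Red M M' → Red (lam x M) (lam x M')
  | appL {M M' N : Term} : Red M M' → Red (app M N) (app M' N)
  | appR {M N N' : Term} : Red N N' → Red (app M N) (app M N')
  | cond₁ {M M' N P : Term} : Red M M' → Red (cond M N P) (cond M' N P)
  | cond₂ {M N N' P : Term} : Red N N' → Red (cond M N P) (cond M N' P)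
  | cond₃ {M N P P' : Term} : Red P P' → Red (cond M N P) (cond M N P')

/-- Convertibility: the equivalence relation generated by reduction. -/
def Conv : Term → Term → Prop := Relation.EqvGen Red

/-! ### Types -/

/-- Linear types `A ::= B | α | σ ⊸ A | ∀α.A`, with de Bruijn indices for type variables. Every
type `σ ::= A | !σ` is `!ᵏA` for a unique `k` and a unique linear type `A`; the constructor
`arr k A C` is the linear type `!ᵏA ⊸ C`. -/
inductive LTy : Type
  | bool
  | var (i : ℕ)
  | arr (k : ℕ) (A C : LTy)
  | all (A : LTy)

/-- Types: `⟨k, A⟩` is `!ᵏA`. -/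
structure Ty : Type where
  bangs : ℕ
  body : LTy

namespace LTy

/-- Increase by one the type variables with index at least `c`. -/
def shift (c : ℕ) : LTy → LTy
  | bool => bool
  | var i => if i < c then var i else var (i + 1)
  | arr k A C => arr k (shift c A) (shift c C)
  | all A => all (shift (c + 1) A)

/-- Replace the type variable `j` by `S` and decrease by one the variables above `j`. -/
def subst (j : ℕ) (S : LTy) : LTy → LTy
  | bool => bool
  | var i => if i < j then var i else if i = j then S else var (i - 1)
  | arr k A C => arr k (subst j S A) (subst j S C)
  | all A => all (subst (j + 1) (shift 0 S) A)

/-- If `all B` is `∀α.C`, then `B.inst A` is `C[A/α]`. -/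
def inst (B A : LTy) : LTy := subst 0 A B

end LTy

/-- A linear type, as a type. -/
def LTy.toTy (A : LTy) : Ty := ⟨0, A⟩

/-- `!σ`. -/
def Ty.bang (σ : Ty) : Ty := ⟨σ.bangs + 1, σ.body⟩

/-- `!ⁿσ`. -/
def Ty.bangN (n : ℕ) (σ : Ty) : Ty := ⟨σ.bangs + n, σ.body⟩

/-- `σ ⊸ A`. -/
def lolli (σ : Ty) (A : LTy) : LTy := .arr σ.bangs σ.body A

def Ty.shift (σ : Ty) : Ty := ⟨σ.bangs, σ.body.shift 0⟩

/-- Contexts: finite sets of assumptions on distinct variables, as lists. The order is irrelevant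
by the rule `perm` below, and every derivable judgment has distinct variables in its context. -/
abbrev Ctx : Type := List (ℕ × Ty)

def Ctx.dom (Γ : Ctx) : List ℕ := Γ.map Prod.fst

/-- Apply a function to all types of a context. -/
def Ctx.mapTy (f : Ty → Ty) (Γ : Ctx) : Ctx := Γ.map fun a => (a.1, f a.2)

/-- The judgment `Γ ⊢ M : σ` of the soft type assignment system with booleans. -/
inductive Typed : Ctx → Term → Ty → Prop
  | perm {Γ Δ : Ctx} {M : Term} {σ : Ty} : Γ.Perm Δ → Typed Γ M σ → Typed Δ M σ
  | ax (x : ℕ) (A : LTy) : Typed [(x, A.toTy)] (fvar x) A.toTy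
  | boolI (b : Bool) : Typed [] (.bool b) LTy.bool.toTy
  | weak {Γ : Ctx} {M : Term} {σ : Ty} (x : ℕ) (A : LTy) :
      x ∉ Γ.dom → Typed Γ M σ → Typed ((x, A.toTy) :: Γ) M σ
  | lolliI {Γ : Ctx} {x : ℕ} {σ : Ty} {M : Term} {A : LTy} :
      Typed ((x, σ) :: Γ) M A.toTy → Typed Γ (lam x M) (lolli σ A).toTy
  | lolliE {Γ Δ : Ctx} {M N : Term} {σ : Ty} {A : LTy} :
      Γ.dom.Disjoint Δ.dom → Typed Γ M (lolli σ A).toTy → Typed Δ N σ →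
      Typed (Γ ++ Δ) (app M N) A.toTy
  | mult {Γ : Ctx} {M : Term} {σ τ : Ty} (xs : List ℕ) (x : ℕ) :
      x ∉ Γ.dom → Typed (xs.map (fun y => (y, σ)) ++ Γ) M τ →
      Typed ((x, σ.bang) :: Γ) (M.merge xs x) τ
  | sp {Γ : Ctx} {M : Term} {σ : Ty} : Typed Γ M σ → Typed (Γ.mapTy Ty.bang) M σ.bang
  | allI {Γ : Ctx} {M : Term} {A : LTy} :
      Typed (Γ.mapTy Ty.shift) M A.toTy → Typed Γ M A.all.toTy
  | allE {Γ : Ctx} {M : Term} {B : LTy} (A : LTy) :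
      Typed Γ M B.all.toTy → Typed Γ M (B.inst A).toTy
  | boolE {Γ : Ctx} {M N₀ N₁ : Term} {A : LTy} :
      Typed Γ M LTy.bool.toTy → Typed Γ N₀ A.toTy → Typed Γ N₁ A.toTy →
      Typed Γ (cond M N₀ N₁) A.toTy

/-- Programs: closed terms of type `B`. -/
def IsProgram (M : Term) : Prop := Typed [] M LTy.bool.toTy

/-! ### The evaluation machine -/

/-- B-contexts `C ::= ∘ | (if C then M else N) V₁ ⋯ Vₙ`. -/
inductive BCtx : Type
  | hole
  | cond (C : BCtx) (M N : Term) (Vs : List Term)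

/-- `C.fill C'` is `C[C']`. -/
def BCtx.fill : BCtx → BCtx → BCtx
  | .hole, C' => C'
  | .cond C M N Vs, C' => .cond (C.fill C') M N Vs

/-- The variable `x` is free in one of the terms of the list. -/
def FreeInSome (x : ℕ) (Vs : List Term) : Prop := ∃ V ∈ Vs, x ∈ V.fv

/-- The variable `x` is free in the B-context. -/
def BCtx.HasFree (x : ℕ) : BCtx → Prop
  | .hole => False
  | .cond C M N Vs => C.HasFree x ∨ x ∈ M.fv ∨ x ∈ N.fv ∨ FreeInSome x Vs

/-- m-contexts: sequences of assignments `x := M`. -/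
abbrev MCtx : Type := List (ℕ × Term)

/-- The variable `x` occurs in the m-context. -/
def MCtx.Occurs (x : ℕ) (𝒜 : MCtx) : Prop := ∃ a ∈ 𝒜, x = a.1 ∨ x ∈ a.2.fv

/-- `Eval C 𝒜 M b` is the statement `C, 𝒜 ⊨ M ⇓ b` of the evaluation machine. -/
inductive Eval : BCtx → MCtx → Term → Bool → Prop
  | ax (C : BCtx) (𝒜 : MCtx) (b : Bool) : Eval C 𝒜 (.bool b) b
  | beta {C : BCtx} {𝒜 : MCtx} {M N : Term} {Vs : List Term} {b : Bool} (x : ℕ) :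
      ¬ C.HasFree x → ¬ MCtx.Occurs x 𝒜 → ¬ FreeInSome x (M :: N :: Vs) →
      Eval C (𝒜 ++ [(x, N)]) ((M.inst (fvar x)).apps Vs) b →
      Eval C 𝒜 ((app (abs M) N).apps Vs) b
  | head {C : BCtx} {𝒜 : MCtx} {x : ℕ} {N : Term} {Vs : List Term} {b : Bool} :
      (x, N) ∈ 𝒜 → Eval C 𝒜 (N.apps Vs) b → Eval C 𝒜 ((fvar x).apps Vs) b
  | condTrue {C : BCtx} {𝒜 : MCtx} {M N₀ N₁ : Term} {Vs : List Term} {b : Bool} :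
      Eval (C.fill (.cond .hole N₀ N₁ Vs)) 𝒜 M true → Eval C 𝒜 (N₀.apps Vs) b →
      Eval C 𝒜 ((cond M N₀ N₁).apps Vs) b
  | condFalse {C : BCtx} {𝒜 : MCtx} {M N₀ N₁ : Term} {Vs : List Term} {b : Bool} :
      Eval (C.fill (.cond .hole N₀ N₁ Vs)) 𝒜 M false → Eval C 𝒜 (N₁.apps Vs) b →
      Eval C 𝒜 ((cond M N₀ N₁).apps Vs) b

/-- `⊨ M ⇓ b`. -/
def EvaluatesTo (M : Term) (b : Bool) : Prop := Eval .hole [] M b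

/-! ### Data -/

/-- The Church numeral `λs.λz.sⁿ(z)`. -/
def num (n : ℕ) : Term := lam 0 (lam 1 ((app (fvar 0))^[n] (fvar 1)))

/-- The string `λc.λz.c b₀(⋯(c bₙ z)⋯)`. -/
def str (w : List Bool) : Term :=
  lam 0 (lam 1 (w.foldr (fun b t => app (app (fvar 0) (.bool b)) t) (fvar 1)))

/-- The pair `⟨M, N⟩ = λx.xMN`, for terms `M`, `N`. -/
def pair (M N : Term) : Term := abs (app (app (bvar 0) M) N)

/-- The first projection `M(λx.λy.x)`. -/
def fst (M : Term) : Term := app M (lam 0 (lam 1 (fvar 0)))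

/-- The second projection `M(λx.λy.y)`. -/
def snd (M : Term) : Term := app M (lam 0 (lam 1 (fvar 1)))

def andTm (M N : Term) : Term := cond M (cond N (.bool true) (.bool false)) (.bool false)

def orTm (M N : Term) : Term := cond M (.bool true) (cond N (.bool true) (.bool false))

/-- `len = λc.λs.c(λx.λy.sy)`. -/
def len : Term :=
  lam 0 (lam 1 (app (fvar 0) (lam 2 (lam 3 (app (fvar 1) (fvar 3))))))

/-- `N_i = ∀α.!ⁱ(α ⊸ α) ⊸ α ⊸ α`. -/
def natTy (i : ℕ) : LTy := .all (.arr i (.arr 0 (.var 0) (.var 0)) (.arr 0 (.var 0) (.var 0)))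

/-- `S_i = ∀α.!ⁱ(B ⊸ α ⊸ α) ⊸ α ⊸ α`. -/
def strTy (i : ℕ) : LTy :=
  .all (.arr i (.arr 0 .bool (.arr 0 (.var 0) (.var 0))) (.arr 0 (.var 0) (.var 0)))

/-- `B² = B ⊗ B = ∀α.(B ⊸ B ⊸ α) ⊸ α`. -/
def bool2Ty : LTy := .all (.arr 0 (.arr 0 .bool (.arr 0 .bool (.var 0))) (.var 0))

/-- The term `F` witnesses that `f` is B-programmable, the input `i` being encoded by `enc i`. -/
def Programs {I : Type*} (enc : I → Term) (F : Term) (f : I → Bool) : Prop :=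
  ∀ i, IsProgram (app F (enc i)) ∧ ∀ b, f i = b ↔ EvaluatesTo (app F (enc i)) b

/-- The boolean function `f` is B-programmable. -/
def BProgrammable {I : Type*} (enc : I → Term) (f : I → Bool) : Prop :=
  ∃ F : Term, Programs enc F f

/-! ### Alternating Turing machines -/

/-- The four kinds of states. -/
inductive Kind : Type
  | accepting
  | rejecting
  | universal
  | existential

/-- The pair of booleans encoding a kind: `⟨1,0⟩`, `⟨1,1⟩`, `⟨0,1⟩`, `⟨0,0⟩`. -/
def Kind.code : Kind → Term
  | .accepting => pair (.bool false) (.bool true)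
  | .rejecting => pair (.bool false) (.bool false)
  | .universal => pair (.bool true) (.bool false)
  | .existential => pair (.bool true) (.bool true)

/-- Alternating Turing machines with one tape, infinite in both directions, with states `Q`, tape
alphabet `Γ` and a transition relation of degree two, given by its two components. The blank is
`default : Γ` and `letter` tells how the input letters are written on the tape. The values of
`δ` at accepting and rejecting states play no role. -/
structure ATM (Q Γ : Type*) where
  kind : Q → Kind
  start : Q
  letter : Bool → Γ
  δ : Fin 2 → Q → Γ → Q × Γ × Turing.Dir

namespace ATM

variable {Q Γ : Type*} [Inhabited Γ]

structure Config (Q Γ : Type*) [Inhabited Γ] where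
  state : Q
  tape : Turing.Tape Γ

/-- The initial configuration on the input `w`: the head scans the first letter of `w`. -/
def init (M : ATM Q Γ) (w : List Bool) : Config Q Γ :=
  ⟨M.start, Turing.Tape.mk₁ (w.map M.letter)⟩

/-- The successor of a configuration by the component `j` of the transition relation. -/
def next (M : ATM Q Γ) (j : Fin 2) (c : Config Q Γ) : Config Q Γ :=
  let r := M.δ j c.state c.tape.head
  ⟨r.1, (c.tape.write r.2.1).move r.2.2⟩

/-- The configuration leads to acceptance. -/
inductive Accepts (M : ATM Q Γ) : Config Q Γ → Prop
  | accepting {c : Config Q Γ} : M.kind c.state = .accepting → Accepts M c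
  | existential {c : Config Q Γ} (j : Fin 2) :
      M.kind c.state = .existential → Accepts M (M.next j c) → Accepts M c
  | universal {c : Config Q Γ} :
      M.kind c.state = .universal → (∀ j, Accepts M (M.next j c)) → Accepts M c

/-- All computation paths from the configuration reach an accepting or rejecting state after at
most the given number of steps. -/
inductive HaltsIn (M : ATM Q Γ) : ℕ → Config Q Γ → Prop
  | final {n : ℕ} {c : Config Q Γ} :
      M.kind c.state = .accepting ∨ M.kind c.state = .rejecting → HaltsIn M n c
  | step {n : ℕ} {c : Config Q Γ} : (∀ j, HaltsIn M n (M.next j c)) → HaltsIn M (n + 1) c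

/-- `M` decides `D` within time `T`, where `true` is the positive answer. -/
def DecidesInTime (M : ATM Q Γ) (D : List Bool → Bool) (T : ℕ → ℕ) : Prop :=
  ∀ w, M.HaltsIn (T w.length) (M.init w) ∧ (D w = true ↔ M.Accepts (M.init w))

end ATM

/-! ### The evaluation term -/

/-- `α(M₀,M₁,M₂)`: the value of a configuration of kind `M₀` whose successors have values `M₁` and
`M₂`. The answer is the second component of a value. -/
def alphaTm (M₀ M₁ M₂ : Term) : Term :=
  cond (fst M₀)
    (cond (snd M₀)
      (pair (.bool true) (orTm (snd M₁) (snd M₂)))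
      (pair (.bool true) (andTm (snd M₁) (snd M₂))))
    (pair (.bool false) (snd M₀))

/-- `Ext = λx.let x be l, r in r`. -/
def extTm : Term := lam 0 (app (fvar 0) (lam 1 (lam 2 (fvar 2))))

/-- `Base = λc.Kind c`. -/
def baseTm (kind : Term) : Term := lam 0 (app kind (fvar 0))

/-- `Step = λh.λc.α(Kind c, h(Tr¹ c), h(Tr² c))`. -/
def stepTm (kind : Term) (tr : Fin 2 → Term) : Term :=
  lam 0 (lam 1 (alphaTm (app kind (fvar 1))
    (app (fvar 0) (app (tr 0) (fvar 1))) (app (fvar 0) (app (tr 1) (fvar 1)))))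

/-- `λs.Ext((P (len s) Step Base)(Init s))`. -/
def evalTm (P kind : Term) (tr : Fin 2 → Term) (init : Term) : Term :=
  lam 0 (app extTm (app
    (app (app (app P (app len (fvar 0))) (stepTm kind tr)) (baseTm kind))
    (app init (fvar 0))))

/-- The closed term `P` has type `!^d N ⊸ N_{2d+1}`, where `d` is the degree of `p`, and computes
`p` on Church numerals. -/
def DefinesPoly (P : Term) (p : Polynomial ℕ) : Prop :=
  Typed [] P (lolli (Ty.bangN p.natDegree (natTy 1).toTy) (natTy (2 * p.natDegree + 1))).toTy ∧
    ∀ n, Conv (app P (num n)) (num (p.eval n))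

/-- The closed terms `kind`, `tr 0`, `tr 1`, `init` implement the machine `M` on configurations
encoded by terms of the linear type `C`, for computations of at most `T |w|` steps on the input
`w`. Here `R k c t` says that the term `t` encodes the configuration `c` with enough tape cells for
`k` further steps. -/
def Implements {Q Γ : Type*} [Inhabited Γ] (M : ATM Q Γ) (T : ℕ → ℕ) (e : ℕ) (C : LTy)
    (kind : Term) (tr : Fin 2 → Term) (init : Term) : Prop :=
  Typed [] kind (lolli C.toTy bool2Ty).toTy ∧
  (∀ j, Typed [] (tr j) (lolli C.toTy C).toTy) ∧
  Typed [] init (lolli (Ty.bangN e (strTy 1).toTy) C).toTy ∧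
  ∃ R : ℕ → ATM.Config Q Γ → Term → Prop,
    (∀ w, R (T w.length) (M.init w) (app init (str w))) ∧
    (∀ k c t, R k c t → Typed [] t C.toTy) ∧
    (∀ k c t, R k c t → Conv (app kind t) (M.kind c.state).code) ∧
    (∀ k c t j, R (k + 1) c t → R k (M.next j c) (app (tr j) t))

end STAB

/-! ### Terms, a graph model, and adequacy of the evaluation machine for conversion. -/

namespace STAB
open Term

/-! ### Elementary facts on terms -/

namespace Term

/-! The numeral for `p(|s|)` iterates `Step` on `Base`. The resulting function sends an encoded
configuration to a pair whose second component is its alternating value. By induction on `k`, the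
`k`-fold iterate is correct on every configuration that halts within `k` steps
(`conv_iterate_stepTm`): a final state answers through its kind alone, and other states combine the
values of their two successors.

Three points carry the proof.

Typing of alternation. `Step` mentions its recursive argument and its configuration in several
places, yet types them linearly, because the rule for `if` uses one context for the guard and both
branches (`styped_stepTm`). Hence `Step` is an endomorphism of `C ⊸ B²`, which a numeral may
iterate, provided `Tr` has type `C ⊸ C` with the same `C` on both sides. Configurations are
therefore pairs of half tapes abstracted over a cell constructor `f` and a continuation. A
transition reads a cell by instantiating the abstract tape type with a type of lists split into head
and tail (`popTy`); each cell's `f` is kept unapplied in the split list and is used once when the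
cell is put back, so nothing is duplicated (`conv_pop`, `styped_trTm`). Bangs are spent only on
building polynomially many blanks and on the clock (`styped_chain`, `styped_initTm`,
`typed_evalTm`).

From conversion to the machine. Correctness of the terms is a matter of conversion, whereas the
claim is about a call-by-name machine with assignments. The bridge is a graph model built from
intersection types. Denotations are invariant under conversion (`Conv.den_eq`); a value returned by
the machine lies in the denotation (`Eval.mem_den`); and a realizability argument shows that a
boolean in the denotation of a closed term is returned (`realizes_of_mem_den`). So a closed term
convertible to a boolean evaluates to that boolean and to no other (`evaluatesTo_iff_of_conv`).

Bookkeeping of contexts. `STyped` allows a name to occur several times in a context, each occurrence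
being one linear use. A term is typed by adding up the contexts of its parts, and the copies are
contracted at the end. -/

theorem LCAt.mono {M : Term} : ∀ {k l : ℕ}, LCAt k M → k ≤ l → LCAt l M := by
  induction M with
  | bvar i => intro k l h hl; exact lt_of_lt_of_le h hl
  | fvar x => intros; trivial
  | bool b => intros; trivial
  | abs M ih => intro k l h hl; exact ih (k := k + 1) (l := l + 1) h (by omega)
  | app M N ih₁ ih₂ => intro k l h hl; exact ⟨ih₁ h.1 hl, ih₂ h.2 hl⟩
  | cond M N P ih₁ ih₂ ih₃ =>
    intro k l h hl; exact ⟨ih₁ h.1 hl, ih₂ h.2.1 hl, ih₃ h.2.2 hl⟩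

theorem LC.lcAt {M : Term} (h : LC M) (k : ℕ) : LCAt k M := LCAt.mono h (Nat.zero_le k)

theorem instAt_of_lcAt {N M : Term} : ∀ {k l : ℕ}, LCAt l M → l ≤ k → instAt k N M = M := by
  induction M with
  | bvar i => intro k l h hl; have : i < l := h; simp [instAt]; omega
  | fvar x => intros; rfl
  | bool b => intros; rfl
  | abs M ih => intro k l h hl; simp [instAt, ih (k := k + 1) (l := l + 1) h (by omega)]
  | app M N ih₁ ih₂ => intro k l h hl; simp [instAt, ih₁ h.1 hl, ih₂ h.2 hl]
  | cond M N P ih₁ ih₂ ih₃ =>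
    intro k l h hl; simp [instAt, ih₁ h.1 hl, ih₂ h.2.1 hl, ih₃ h.2.2 hl]

theorem LC.instAt_eq {M : Term} (h : LC M) (k : ℕ) (N : Term) : instAt k N M = M :=
  instAt_of_lcAt h (Nat.zero_le k)

theorem lcAt_instAt {N M : Term} (hN : LC N) :
    ∀ {k : ℕ}, LCAt (k + 1) M → LCAt k (instAt k N M) := by
  induction M with
  | bvar i =>
    intro k h
    have : i < k + 1 := h
    by_cases hi : i = k
    · simp [instAt, hi, hN.lcAt]
    · simp only [instAt, hi, if_false, LCAt]; omega
  | fvar x => intros; trivial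
  | bool b => intros; trivial
  | abs M ih => intro k h; exact ih (k := k + 1) h
  | app M N ih₁ ih₂ => intro k h; exact ⟨ih₁ h.1, ih₂ h.2⟩
  | cond M N P ih₁ ih₂ ih₃ => intro k h; exact ⟨ih₁ h.1, ih₂ h.2.1, ih₃ h.2.2⟩

theorem lc_inst {N M : Term} (hN : LC N) (h : LCAt 1 M) : LC (M.inst N) := lcAt_instAt hN h

theorem lcAt_closeAt {x : ℕ} {M : Term} :
    ∀ {k : ℕ}, LCAt k M → LCAt (k + 1) (closeAt k x M) := by
  induction M with
  | bvar i => intro k h; exact Nat.lt_succ_of_lt h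
  | fvar y =>
    intro k h
    by_cases hy : y = x <;> simp [closeAt, hy, LCAt]
  | bool b => intros; trivial
  | abs M ih => intro k h; exact ih (k := k + 1) h
  | app M N ih₁ ih₂ => intro k h; exact ⟨ih₁ h.1, ih₂ h.2⟩
  | cond M N P ih₁ ih₂ ih₃ => intro k h; exact ⟨ih₁ h.1, ih₂ h.2.1, ih₃ h.2.2⟩

theorem closeAt_instAt {x : ℕ} {M : Term} :
    ∀ {k : ℕ}, x ∉ M.fv → closeAt k x (instAt k (fvar x) M) = M := by
  induction M with
  | bvar i => intro k h; by_cases hi : i = k <;> simp [instAt, closeAt, hi]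
  | fvar y => intro k h; simp [fv] at h; simp [instAt, closeAt]; tauto
  | bool b => intros; rfl
  | abs M ih => intro k h; simp [instAt, closeAt, ih h]
  | app M N ih₁ ih₂ => intro k h; simp [fv] at h; simp [instAt, closeAt, ih₁ h.1, ih₂ h.2]
  | cond M N P ih₁ ih₂ ih₃ =>
    intro k h; simp [fv] at h; simp [instAt, closeAt, ih₁ h.1, ih₂ h.2.1, ih₃ h.2.2]

theorem lam_inst {x : ℕ} {M : Term} (h : x ∉ M.fv) : lam x (M.inst (fvar x)) = abs M := by
  simp [lam, inst, closeAt_instAt h]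

theorem closeAt_of_notMem {x : ℕ} {M : Term} : ∀ {k : ℕ}, x ∉ M.fv → closeAt k x M = M := by
  induction M with
  | bvar i => intros; rfl
  | fvar y => intro k h; simp [fv] at h; simp [closeAt]; tauto
  | bool b => intros; rfl
  | abs M ih => intro k h; simp [closeAt, ih h]
  | app M N ih₁ ih₂ => intro k h; simp [fv] at h; simp [closeAt, ih₁ h.1, ih₂ h.2]
  | cond M N P ih₁ ih₂ ih₃ =>
    intro k h; simp [fv] at h; simp [closeAt, ih₁ h.1, ih₂ h.2.1, ih₃ h.2.2]

theorem fv_closeAt {x : ℕ} {M : Term} : ∀ {k : ℕ}, (closeAt k x M).fv = M.fv.erase x := by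
  induction M with
  | bvar i => intros; simp [closeAt, fv]
  | fvar y =>
    intro k
    by_cases hy : y = x
    · simp [closeAt, hy, fv]
    · simp [closeAt, hy, fv, Finset.erase_eq_of_notMem, Ne.symm hy]
  | bool b => intros; simp [closeAt, fv]
  | abs M ih => intro k; simp [closeAt, fv, ih]
  | app M N ih₁ ih₂ => intro k; simp [closeAt, fv, ih₁, ih₂, Finset.erase_union_distrib]
  | cond M N P ih₁ ih₂ ih₃ =>
    intro k; simp [closeAt, fv, ih₁, ih₂, ih₃, Finset.erase_union_distrib]

theorem fv_instAt_subset {N M : Term} : ∀ {k : ℕ}, (instAt k N M).fv ⊆ M.fv ∪ N.fv := by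
  induction M with
  | bvar i => intro k; by_cases hi : i = k <;> simp [instAt, hi, fv]
  | fvar y => intro k; simp [instAt, fv]
  | bool b => intro k; simp [instAt, fv]
  | abs M ih => intro k; simpa [instAt, fv] using ih
  | app M M' ih₁ ih₂ =>
    intro k x hx
    simp only [instAt, fv, Finset.mem_union] at hx ⊢
    have h₁ := @ih₁ k x; have h₂ := @ih₂ k x
    simp only [Finset.mem_union] at h₁ h₂
    tauto
  | cond M M' P ih₁ ih₂ ih₃ =>
    intro k x hx
    simp only [instAt, fv, Finset.mem_union] at hx ⊢
    have h₁ := @ih₁ k x; have h₂ := @ih₂ k x; have h₃ := @ih₃ k x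
    simp only [Finset.mem_union] at h₁ h₂ h₃
    tauto

theorem apps_concat (M N : Term) (Vs : List Term) : M.apps (Vs ++ [N]) = app (M.apps Vs) N := by
  simp [apps]

theorem apps_cons (M N : Term) (Vs : List Term) : M.apps (N :: Vs) = (app M N).apps Vs := rfl

@[simp] theorem apps_nil (M : Term) : M.apps [] = M := rfl

theorem lcAt_apps {k : ℕ} {Vs : List Term} :
    ∀ {M : Term}, LCAt k (M.apps Vs) ↔ LCAt k M ∧ ∀ V ∈ Vs, LCAt k V := by
  induction Vs with
  | nil => simp
  | cons N Vs ih => intro M; rw [apps_cons, ih]; simp [LCAt, and_assoc]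

theorem fv_apps {x : ℕ} {Vs : List Term} :
    ∀ {M : Term}, x ∈ (M.apps Vs).fv ↔ x ∈ M.fv ∨ ∃ V ∈ Vs, x ∈ V.fv := by
  induction Vs with
  | nil => simp
  | cons N Vs ih => intro M; rw [apps_cons, ih]; simp [fv, or_assoc]

/-- Number of constructors. -/
def size : Term → ℕ
  | bvar _ => 1
  | fvar _ => 1
  | bool _ => 1
  | abs M => M.size + 1
  | app M N => M.size + N.size + 1
  | cond M N₀ N₁ => M.size + N₀.size + N₁.size + 1

theorem size_instAt_fvar {x : ℕ} {M : Term} : ∀ {k : ℕ}, (instAt k (fvar x) M).size = M.size := by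
  induction M with
  | bvar i => intro k; by_cases hi : i = k <;> simp [instAt, hi, size]
  | fvar y => intro k; rfl
  | bool b => intro k; rfl
  | abs M ih => intro k; simp [instAt, size, ih]
  | app M N ih₁ ih₂ => intro k; simp [instAt, size, ih₁, ih₂]
  | cond M N P ih₁ ih₂ ih₃ => intro k; simp [instAt, size, ih₁, ih₂, ih₃]

end Term

/-! ### A graph model -/

/-- Intersection types: `arr n a τ` is `a₁ ∩ ⋯ ∩ aₙ → τ`. -/
inductive ITy : Type
  | bool (b : Bool)
  | arr (n : ℕ) (a : Fin n → ITy) (τ : ITy)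

/-- Assign `a` to the innermost bound variable. -/
def envCons (a : Set ITy) (η : ℕ → Set ITy) : ℕ → Set ITy
  | 0 => a
  | n + 1 => η n

theorem envCons_update (a s : Set ITy) (η : ℕ → Set ITy) (k : ℕ) :
    envCons a (Function.update η k s) = Function.update (envCons a η) (k + 1) s := by
  funext n
  cases n with
  | zero => simp [envCons, Function.update]
  | succ n => simp [envCons, Function.update]

/-- Application in the graph model. -/
def appSet (s t : Set ITy) : Set ITy := {τ | ∃ n a, ITy.arr n a τ ∈ s ∧ Set.range a ⊆ t}

theorem appSet_mono {s s' t t' : Set ITy} (hs : s ⊆ s') (ht : t ⊆ t') :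
    appSet s t ⊆ appSet s' t' := by
  rintro τ ⟨n, a, h, h'⟩
  exact ⟨n, a, hs h, h'.trans ht⟩

theorem foldl_appSet_mono {l : List (Set ITy)} : ∀ {s s' : Set ITy}, s ⊆ s' →
    l.foldl appSet s ⊆ l.foldl appSet s' := by
  induction l with
  | nil => exact fun h => h
  | cons t l ih => exact fun h => ih (appSet_mono h subset_rfl)

/-- The denotation of a term, `ρ` interpreting the free and `η` the bound variables. -/
def den (ρ : ℕ → Set ITy) : (ℕ → Set ITy) → Term → Set ITy
  | η, .bvar i => η i
  | _, .fvar x => ρ x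
  | _, .bool b => {.bool b}
  | η, .abs M => {σ | ∃ n a τ, σ = .arr n a τ ∧ τ ∈ den ρ (envCons (Set.range a) η) M}
  | η, .app M N => appSet (den ρ η M) (den ρ η N)
  | η, .cond M N₀ N₁ =>
    {τ | (.bool true ∈ den ρ η M ∧ τ ∈ den ρ η N₀) ∨ (.bool false ∈ den ρ η M ∧ τ ∈ den ρ η N₁)}

theorem mem_den_abs {ρ η : ℕ → Set ITy} {M : Term} {n : ℕ} {a : Fin n → ITy} {τ : ITy} :
    ITy.arr n a τ ∈ den ρ η (.abs M) ↔ τ ∈ den ρ (envCons (Set.range a) η) M := by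
  constructor
  · rintro ⟨n', a', τ', h, h'⟩
    cases h
    exact h'
  · exact fun h => ⟨n, a, τ, rfl, h⟩

/-- Only the free names and the bound indices below `k` can be consulted, so environments agreeing
there are interchangeable. In particular the denotation of a locally closed term ignores `η`. -/
theorem den_congr {M : Term} : ∀ {k : ℕ} {ρ ρ' η η' : ℕ → Set ITy}, LCAt k M →
    (∀ x ∈ M.fv, ρ x = ρ' x) → (∀ i < k, η i = η' i) → den ρ η M = den ρ' η' M := by
  induction M with
  | bvar i => intro k ρ ρ' η η' h _ hη; exact hη i h
  | fvar x => intro k ρ ρ' η η' h hρ _; exact hρ x (by simp [fv])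
  | bool b => intros; rfl
  | abs M ih =>
    intro k ρ ρ' η η' h hρ hη
    have : ∀ a, den ρ (envCons a η) M = den ρ' (envCons a η') M := fun a =>
      ih (k := k + 1) h hρ fun i hi => by
        cases i with
        | zero => rfl
        | succ i => exact hη i (by omega)
    simp only [den, this]
  | app M N ih₁ ih₂ =>
    intro k ρ ρ' η η' h hρ hη
    simp only [den, ih₁ h.1 (fun x hx => hρ x (by simp [fv, hx])) hη,
      ih₂ h.2 (fun x hx => hρ x (by simp [fv, hx])) hη]
  | cond M N P ih₁ ih₂ ih₃ =>
    intro k ρ ρ' η η' h hρ hη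
    simp only [den, ih₁ h.1 (fun x hx => hρ x (by simp [fv, hx])) hη,
      ih₂ h.2.1 (fun x hx => hρ x (by simp [fv, hx])) hη,
      ih₃ h.2.2 (fun x hx => hρ x (by simp [fv, hx])) hη]

theorem den_mono {ρ : ℕ → Set ITy} {M : Term} : ∀ {η η' : ℕ → Set ITy}, (∀ i, η i ⊆ η' i) →
    den ρ η M ⊆ den ρ η' M := by
  induction M with
  | bvar i => intro η η' h; exact h i
  | fvar x => intro η η' h; exact subset_rfl
  | bool b => intro η η' h; exact subset_rfl
  | abs M ih =>
    rintro η η' h σ ⟨n, a, τ, rfl, hτ⟩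
    refine ⟨n, a, τ, rfl, ih (fun i => ?_) hτ⟩
    cases i with
    | zero => exact subset_rfl
    | succ i => exact h i
  | app M N ih₁ ih₂ => intro η η' h; exact appSet_mono (ih₁ h) (ih₂ h)
  | cond M N P ih₁ ih₂ ih₃ =>
    rintro η η' h τ (⟨h₁, h₂⟩ | ⟨h₁, h₂⟩)
    · exact .inl ⟨ih₁ h h₁, ih₂ h h₂⟩
    · exact .inr ⟨ih₁ h h₁, ih₃ h h₂⟩

theorem update_subset_update {η : ℕ → Set ITy} {k : ℕ} {s t : Set ITy} (h : s ⊆ t) (i : ℕ) :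
    Function.update η k s i ⊆ Function.update η k t i := by
  by_cases hi : i = k
  · subst hi; simpa using h
  · simp [hi]

/-- A derivation of one intersection type consults a variable finitely often. In the application
case the argument family is finite, so finitely many finite sets are united. Continuity is what
makes denotations stable under beta expansion. -/
theorem den_continuous {ρ : ℕ → Set ITy} {M : Term} : ∀ {η : ℕ → Set ITy} {k : ℕ} {s : Set ITy}
    {τ : ITy}, τ ∈ den ρ (Function.update η k s) M →
    ∃ F ⊆ s, F.Finite ∧ τ ∈ den ρ (Function.update η k F) M := by
  induction M with
  | bvar i =>
    intro η k s τ h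
    by_cases hi : i = k
    · subst hi
      exact ⟨{τ}, by simpa [den] using h, Set.finite_singleton _, by simp [den]⟩
    · exact ⟨∅, Set.empty_subset _, Set.finite_empty, by simpa [den, hi] using h⟩
  | fvar x => intro η k s τ h; exact ⟨∅, Set.empty_subset _, Set.finite_empty, h⟩
  | bool b => intro η k s τ h; exact ⟨∅, Set.empty_subset _, Set.finite_empty, h⟩
  | abs M ih =>
    rintro η k s σ ⟨n, a, τ, rfl, hτ⟩
    rw [envCons_update] at hτ
    obtain ⟨F, hF, hfin, h⟩ := ih hτ
    exact ⟨F, hF, hfin, n, a, τ, rfl, by rwa [envCons_update]⟩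
  | app M N ih₁ ih₂ =>
    rintro η k s τ ⟨n, a, h₁, h₂⟩
    obtain ⟨F, hF, hfin, h⟩ := ih₁ h₁
    have h₃ : ∀ i, ∃ F ⊆ s, F.Finite ∧ a i ∈ den ρ (Function.update η k F) N :=
      fun i => ih₂ (h₂ ⟨i, rfl⟩)
    choose G hG hGfin hGa using h₃
    refine ⟨F ∪ ⋃ i, G i, Set.union_subset hF (Set.iUnion_subset hG),
      hfin.union (Set.finite_iUnion hGfin), n, a, ?_, ?_⟩
    · exact den_mono (update_subset_update Set.subset_union_left) h
    · rintro _ ⟨i, rfl⟩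
      exact den_mono (update_subset_update
        ((Set.subset_iUnion G i).trans Set.subset_union_right)) (hGa i)
  | cond M N P ih₁ ih₂ ih₃ =>
    rintro η k s τ (⟨h₁, h₂⟩ | ⟨h₁, h₂⟩)
    · obtain ⟨F, hF, hfin, h⟩ := ih₁ h₁
      obtain ⟨F', hF', hfin', h'⟩ := ih₂ h₂
      exact ⟨F ∪ F', Set.union_subset hF hF', hfin.union hfin', .inl
        ⟨den_mono (update_subset_update Set.subset_union_left) h,
          den_mono (update_subset_update Set.subset_union_right) h'⟩⟩
    · obtain ⟨F, hF, hfin, h⟩ := ih₁ h₁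
      obtain ⟨F', hF', hfin', h'⟩ := ih₃ h₂
      exact ⟨F ∪ F', Set.union_subset hF hF', hfin.union hfin', .inr
        ⟨den_mono (update_subset_update Set.subset_union_left) h,
          den_mono (update_subset_update Set.subset_union_right) h'⟩⟩

theorem den_instAt {ρ : ℕ → Set ITy} {N M : Term} (hN : LC N) : ∀ {η : ℕ → Set ITy} {k : ℕ},
    den ρ η (instAt k N M) = den ρ (Function.update η k (den ρ η N)) M := by
  have hN' : ∀ η η', den ρ η N = den ρ η' N := fun η η' =>
    den_congr hN (fun _ _ => rfl) (by simp)
  induction M with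
  | bvar i => intro η k; by_cases hi : i = k <;> simp [instAt, den, hi]
  | fvar x => intro η k; rfl
  | bool b => intro η k; rfl
  | abs M ih =>
    intro η k
    have : ∀ a, den ρ (envCons a η) (instAt (k + 1) N M) =
        den ρ (envCons a (Function.update η k (den ρ η N))) M := fun a => by
      rw [ih, envCons_update, hN' (envCons a η) η]
    simp only [instAt, den, this]
  | app M N ih₁ ih₂ => intro η k; simp only [instAt, den, ih₁, ih₂]
  | cond M N P ih₁ ih₂ ih₃ => intro η k; simp only [instAt, den, ih₁, ih₂, ih₃]

/-- Binding a name amounts to letting it take the value of the index. No freshness is required,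
which suits the rule `Red.lam` for reduction under a named abstraction. -/
theorem den_closeAt {x : ℕ} {M : Term} : ∀ {ρ η : ℕ → Set ITy} {k : ℕ},
    den ρ η (closeAt k x M) = den (Function.update ρ x (η k)) η M := by
  induction M with
  | bvar i => intros; rfl
  | fvar y => intro ρ η k; by_cases hy : y = x <;> simp [closeAt, den, hy]
  | bool b => intros; rfl
  | abs M ih => intro ρ η k; simp only [closeAt, den, ih, envCons]
  | app M N ih₁ ih₂ => intro ρ η k; simp only [closeAt, den, ih₁, ih₂]
  | cond M N P ih₁ ih₂ ih₃ => intro ρ η k; simp only [closeAt, den, ih₁, ih₂, ih₃]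

/-- One inclusion is monotonicity, since the finite argument set lies inside the denotation of `N`.
The other is continuity: a finite part of that denotation suffices, and it can be listed as the
argument family of an arrow. -/
theorem den_beta {ρ η : ℕ → Set ITy} {M N : Term} (hM : LCAt 1 M) (hN : LC N) :
    den ρ η (app (abs M) N) = den ρ η (M.inst N) := by
  have key : ∀ s, den ρ (envCons s η) M = den ρ (Function.update η 0 s) M := fun s =>
    den_congr hM (fun _ _ => rfl) fun i hi => by
      obtain rfl : i = 0 := by omega
      simp [envCons]
  ext τ
  rw [inst, den_instAt hN]
  constructor
  · rintro ⟨n, a, h₁, h₂⟩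
    rw [mem_den_abs, key] at h₁
    exact den_mono (update_subset_update h₂) h₁
  · intro h
    obtain ⟨F, hF, hfin, h⟩ := den_continuous h
    obtain ⟨n, a, -, rfl⟩ := hfin.fin_param
    exact ⟨n, a, by rwa [mem_den_abs, key], hF⟩

theorem Red.den_eq {M M' : Term} (h : Red M M') : ∀ ρ η, den ρ η M = den ρ η M' := by
  induction h with
  | beta h => intro ρ η; exact den_beta h.1 h.2
  | condTrue => intro ρ η; simp [den]
  | condFalse => intro ρ η; simp [den]
  | lam x _ ih => intro ρ η; simp only [Term.lam, den, den_closeAt, ih]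
  | appL _ ih => intro ρ η; simp only [den, ih]
  | appR _ ih => intro ρ η; simp only [den, ih]
  | cond₁ _ ih => intro ρ η; simp only [den, ih]
  | cond₂ _ ih => intro ρ η; simp only [den, ih]
  | cond₃ _ ih => intro ρ η; simp only [den, ih]

theorem Conv.den_eq {M M' : Term} (h : Conv M M') (ρ η : ℕ → Set ITy) :
    den ρ η M = den ρ η M' := by
  induction h with
  | rel _ _ h => exact h.den_eq ρ η
  | refl => rfl
  | symm _ _ _ ih => exact ih.symm
  | trans _ _ _ _ _ ih₁ ih₂ => exact ih₁.trans ih₂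

theorem den_apps {ρ η : ℕ → Set ITy} {Vs : List Term} : ∀ {M : Term},
    den ρ η (M.apps Vs) = (Vs.map (den ρ η)).foldl appSet (den ρ η M) := by
  induction Vs with
  | nil => intro M; rfl
  | cons N Vs ih => intro M; rw [apps_cons, ih]; rfl

/-! ### Soundness of the machine for the graph model -/

/-- The invariant is that `ρ` solves every equation recorded in `𝒜`. Unfolding a variable then
preserves the denotation, beta adds one equation for a fresh name, and a conditional contains the
branch that is taken. -/
theorem Eval.mem_den {C : BCtx} {𝒜 : MCtx} {M : Term} {b : Bool} (h : Eval C 𝒜 M b) :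
    ∀ {ρ η : ℕ → Set ITy}, LC M → (∀ a ∈ 𝒜, LC a.2 ∧ ρ a.1 = den ρ η a.2) →
      ITy.bool b ∈ den ρ η M := by
  induction h with
  | ax C 𝒜 b => intros; exact rfl
  | @beta C 𝒜 M N Vs b x _ hA hV _ ih =>
    intro ρ η hlc hρ
    obtain ⟨⟨hM, hN⟩, hVs⟩ := lcAt_apps.1 hlc
    have hx : x ∉ M.fv ∧ x ∉ N.fv ∧ ∀ V ∈ Vs, x ∉ V.fv := by
      simpa [FreeInSome] using hV
    -- The new name denotes its argument; freshness leaves the earlier equations, the body and the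
    -- spine untouched.
    set ρ' := Function.update ρ x (den ρ η N) with hρ'
    have hden : ∀ {k T}, LCAt k T → x ∉ T.fv → den ρ' η T = den ρ η T := fun hT hxT =>
      den_congr hT (fun y hy => by
        have : y ≠ x := by rintro rfl; exact hxT hy
        simp [hρ', this]) (fun _ _ => rfl)
    have h := @ih ρ' η (lcAt_apps.2 ⟨lc_inst (by trivial) hM, hVs⟩) (by
      intro a ha
      rcases List.mem_append.1 ha with ha | ha
      · have hxa : x ≠ a.1 ∧ x ∉ a.2.fv := by
          constructor <;> intro h <;> exact hA ⟨a, ha, by tauto⟩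
        obtain ⟨h₁, h₂⟩ := hρ a ha
        refine ⟨h₁, ?_⟩
        rw [hden h₁ hxa.2, ← h₂]
        simp [hρ', Ne.symm hxa.1]
      · obtain rfl : a = (x, N) := by simpa using ha
        exact ⟨hN, by rw [hden hN hx.2.1]; simp [hρ']⟩)
    have hVs' : Vs.map (den ρ' η) = Vs.map (den ρ η) :=
      List.map_congr_left fun V hV => hden (hVs V hV) (hx.2.2 V hV)
    have : den ρ' η (M.inst (fvar x)) = den ρ η (app (abs M) N) := by
      rw [den_beta hM hN, inst, inst, den_instAt hN, den_instAt (by trivial)]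
      simp only [den, hρ', Function.update_self]
      exact den_congr hM (fun y hy => by
        have : y ≠ x := by rintro rfl; exact hx.1 hy
        simp [this]) (fun _ _ => rfl)
    rw [den_apps, this, hVs'] at h
    rwa [den_apps]
  | @head C 𝒜 x N Vs b hx _ ih =>
    intro ρ η hlc hρ
    obtain ⟨hN, h⟩ := hρ _ hx
    have := @ih ρ η (lcAt_apps.2 ⟨hN, (lcAt_apps.1 hlc).2⟩) hρ
    rw [den_apps] at this ⊢
    rw [← h] at this
    exact this
  | @condTrue C 𝒜 M N₀ N₁ Vs b _ _ ih₁ ih₂ =>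
    intro ρ η hlc hρ
    obtain ⟨hM, hVs⟩ := lcAt_apps.1 hlc
    have h₁ := ih₁ hM.1 hρ
    have h₂ := ih₂ (lcAt_apps.2 ⟨hM.2.1, hVs⟩) hρ
    rw [den_apps] at h₂ ⊢
    have hsub : den ρ η N₀ ⊆ den ρ η (cond M N₀ N₁) := fun τ hτ => .inl ⟨h₁, hτ⟩
    exact foldl_appSet_mono hsub h₂
  | @condFalse C 𝒜 M N₀ N₁ Vs b _ _ ih₁ ih₂ =>
    intro ρ η hlc hρ
    obtain ⟨hM, hVs⟩ := lcAt_apps.1 hlc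
    have h₁ := ih₁ hM.1 hρ
    have h₂ := ih₂ (lcAt_apps.2 ⟨hM.2.2, hVs⟩) hρ
    rw [den_apps] at h₂ ⊢
    have hsub : den ρ η N₁ ⊆ den ρ η (cond M N₀ N₁) := fun τ hτ => .inr ⟨h₁, hτ⟩
    exact foldl_appSet_mono hsub h₂

/-! ### Adequacy of the machine for the graph model -/

theorem BCtx.finite_hasFree (C : BCtx) : {x | C.HasFree x}.Finite := by
  induction C with
  | hole => simp [BCtx.HasFree]
  | cond C M N Vs ih =>
    have h : {x | FreeInSome x Vs}.Finite := by
      have : {x | FreeInSome x Vs} = ⋃ V ∈ {V | V ∈ Vs}, (V.fv : Set ℕ) := by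
        ext x; simp [FreeInSome]
      rw [this]
      exact Vs.finite_toSet.biUnion fun V _ => V.fv.finite_toSet
    exact ih.union (M.fv.finite_toSet.union (N.fv.finite_toSet.union h))

theorem exists_fresh (C : BCtx) (𝒜 : MCtx) (Vs : List Term) :
    ∃ x, ¬ C.HasFree x ∧ ¬ MCtx.Occurs x 𝒜 ∧ ¬ FreeInSome x Vs := by
  have hV : {x | FreeInSome x Vs}.Finite := by
    have : {x | FreeInSome x Vs} = ⋃ V ∈ {V | V ∈ Vs}, (V.fv : Set ℕ) := by
      ext x; simp [FreeInSome]
    rw [this]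
    exact Vs.finite_toSet.biUnion fun V _ => V.fv.finite_toSet
  have hA : {x | MCtx.Occurs x 𝒜}.Finite := by
    have : {x | MCtx.Occurs x 𝒜} = ⋃ a ∈ {a | a ∈ 𝒜}, ({a.1} ∪ a.2.fv : Set ℕ) := by
      ext x; simp [MCtx.Occurs]
    rw [this]
    exact (List.finite_toSet 𝒜).biUnion fun a _ =>
      (Set.finite_singleton _).union a.2.fv.finite_toSet
  obtain ⟨x, hx⟩ := ((C.finite_hasFree.union hA).union hV).exists_notMem
  simp only [Set.mem_union, Set.mem_ofPred_eq, not_or] at hx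
  exact ⟨x, hx.1.1, hx.1.2, hx.2⟩

/-- `Realizes τ 𝒜 M`: the machine state `𝒜 ⊨ M`, and all its extensions, behave as `τ` says. -/
def Realizes : ITy → MCtx → Term → Prop
  | .bool b, 𝒜, M => ∀ (ℬ : MCtx) (C : BCtx), Eval C (𝒜 ++ ℬ) M b
  | .arr n a τ, 𝒜, M => ∀ (ℬ : MCtx) (N : Term), (∀ i : Fin n, Realizes (a i) (𝒜 ++ ℬ) N) →
      Realizes τ (𝒜 ++ ℬ) (app M N)

/-- Extensions are already quantified over in the definition, so only associativity of concatenation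
is needed. -/
theorem Realizes.mono {τ : ITy} {𝒜 : MCtx} {M : Term} (h : Realizes τ 𝒜 M) (ℬ : MCtx) :
    Realizes τ (𝒜 ++ ℬ) M := by
  cases τ with
  | bool b => intro 𝒞 C; rw [List.append_assoc]; exact h _ C
  | arr n a τ => intro 𝒞 N; rw [List.append_assoc]; exact h _ N

/-- With `Realizes.beta` and `Realizes.cond`, this says that realizability is closed under running a
machine rule backwards. All three carry a spine `Vs`, since at an arrow type the new argument is
appended to it before the induction hypothesis applies. -/
theorem Realizes.head {τ : ITy} : ∀ {𝒜 : MCtx} {x : ℕ} {N : Term} {Vs : List Term},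
    (x, N) ∈ 𝒜 → Realizes τ 𝒜 (N.apps Vs) → Realizes τ 𝒜 ((fvar x).apps Vs) := by
  induction τ with
  | bool b => intro 𝒜 x N Vs hx h ℬ C; exact .head (List.mem_append_left _ hx) (h ℬ C)
  | arr n a τ _ ih =>
    intro 𝒜 x N Vs hx h ℬ V hV
    have := h ℬ V hV
    rw [← apps_concat] at this ⊢
    exact ih (List.mem_append_left _ hx) this

theorem Realizes.beta {τ : ITy} : ∀ {𝒜 : MCtx} {M N : Term} {Vs : List Term},
    (∀ (ℬ : MCtx) (x : ℕ), x ∉ M.fv →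
      Realizes τ (𝒜 ++ ℬ ++ [(x, N)]) ((M.inst (fvar x)).apps Vs)) →
    Realizes τ 𝒜 ((app (abs M) N).apps Vs) := by
  induction τ with
  | bool b =>
    intro 𝒜 M N Vs h ℬ C
    -- Only here is the B-context known, so only here can a name satisfying the side conditions of
    -- the machine rule be chosen; this is why the hypothesis covers all names fresh for `M`.
    obtain ⟨x, h₁, h₂, h₃⟩ := exists_fresh C (𝒜 ++ ℬ) (M :: N :: Vs)
    have := h ℬ x (fun hx => h₃ ⟨M, by simp, hx⟩) [] C
    rw [List.append_nil] at this
    exact .beta x h₁ h₂ h₃ this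
  | arr n a τ _ ih =>
    intro 𝒜 M N Vs h ℬ V hV
    rw [← apps_concat]
    refine ih fun 𝒞 x hx => ?_
    have := h (ℬ ++ 𝒞) x hx [] V fun i => by
      simpa using (hV i).mono (𝒞 ++ [(x, N)])
    rw [apps_concat]
    simpa using this

theorem Realizes.cond {τ : ITy} : ∀ {𝒜 : MCtx} {M N₀ N₁ : Term} {Vs : List Term} {b : Bool},
    Realizes (.bool b) 𝒜 M → Realizes τ 𝒜 ((bif b then N₀ else N₁).apps Vs) →
    Realizes τ 𝒜 ((Term.cond M N₀ N₁).apps Vs) := by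
  induction τ with
  | bool b' =>
    intro 𝒜 M N₀ N₁ Vs b hM h ℬ C
    cases b
    · exact .condFalse (hM ℬ _) (h ℬ C)
    · exact .condTrue (hM ℬ _) (h ℬ C)
  | arr n a τ _ ih =>
    intro 𝒜 M N₀ N₁ Vs b hM h ℬ V hV
    have := h ℬ V hV
    rw [← apps_concat] at this ⊢
    exact ih (hM.mono ℬ) this

/-- The fundamental lemma of the realizability interpretation. The induction is on size because the
machine opens a body with a name, which gives a term of the same size as the body but not a subterm.
-/
theorem realizes_of_mem_den (n : ℕ) : ∀ {M : Term} {ρ η : ℕ → Set ITy} {𝒜 : MCtx} {τ : ITy},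
    M.size ≤ n → LC M → (∀ x ∈ M.fv, ∀ σ ∈ ρ x, Realizes σ 𝒜 (fvar x)) → τ ∈ den ρ η M →
    Realizes τ 𝒜 M := by
  induction n with
  | zero => intro M; cases M <;> simp [size]
  | succ n ih =>
    intro M ρ η 𝒜 τ hn hM hρ hτ
    cases M with
    | bvar i => exact absurd hM (Nat.not_lt_zero i)
    | fvar x => exact hρ x (by simp [fv]) τ hτ
    | bool b =>
      obtain rfl : τ = .bool b := hτ
      exact fun ℬ C => .ax C _ b
    | app M N =>
      simp only [size] at hn
      obtain ⟨m, a, h₁, h₂⟩ := hτ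
      have h₃ := ih (by omega) hM.1 (fun x hx => hρ x (by simp [fv, hx])) h₁
      have := h₃ [] N fun i => (ih (by omega) hM.2 (fun x hx => hρ x (by simp [fv, hx]))
        (h₂ ⟨i, rfl⟩)).mono []
      simpa using this
    | cond M N₀ N₁ =>
      simp only [size] at hn
      rcases hτ with ⟨h₁, h₂⟩ | ⟨h₁, h₂⟩
      · exact Realizes.cond (Vs := []) (b := true)
          (ih (by omega) hM.1 (fun x hx => hρ x (by simp [fv, hx])) h₁)
          (ih (M := N₀) (by omega) hM.2.1 (fun x hx => hρ x (by simp [fv, hx])) h₂)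
      · exact Realizes.cond (Vs := []) (b := false)
          (ih (by omega) hM.1 (fun x hx => hρ x (by simp [fv, hx])) h₁)
          (ih (M := N₁) (by omega) hM.2.2 (fun x hx => hρ x (by simp [fv, hx])) h₂)
    | abs M =>
      simp only [size] at hn
      obtain ⟨m, a, τ, rfl, hτ⟩ := hτ
      intro ℬ N hN
      refine Realizes.beta (Vs := []) fun 𝒞 x hx => ?_
      -- The name `x` denotes exactly the finite set of types that the argument `N` realizes;
      -- `Realizes.head` transfers them from `N` to `x`.
      refine ih (ρ := Function.update ρ x (Set.range a)) (η := η)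
        (by rw [apps_nil, inst, size_instAt_fvar]; omega)
        (lc_inst (by trivial) hM) ?_ ?_
      · intro y hy σ hσ
        by_cases hyx : y = x
        · subst hyx
          obtain ⟨i, rfl⟩ : σ ∈ Set.range a := by simpa using hσ
          refine Realizes.head (N := N) (Vs := []) (by simp) ?_
          simpa using (hN i).mono (𝒞 ++ [(y, N)])
        · have hy' := fv_instAt_subset hy
          simp only [fv, Finset.mem_union, Finset.mem_singleton, hyx, or_false] at hy'
          have := (hρ y hy' σ (by simpa [hyx] using hσ)).mono (ℬ ++ 𝒞 ++ [(x, N)])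
          simpa using this
      · rw [apps_nil, inst, den_instAt (by trivial)]
        simp only [den, Function.update_self]
        rwa [den_congr (M := M) hM (ρ' := ρ) (η' := envCons (Set.range a) η)]
        · intro y hy
          have : y ≠ x := by rintro rfl; exact hx hy
          simp [this]
        · intro i hi
          obtain rfl : i = 0 := by omega
          simp [envCons]

/-- A closed term convertible to a boolean is evaluated by the machine to this boolean only. -/
theorem evaluatesTo_iff_of_conv {M : Term} {b b' : Bool} (hlc : LC M) (hfv : M.fv = ∅)
    (h : Conv M (.bool b)) : EvaluatesTo M b' ↔ b = b' := by
  have hden := h.den_eq (fun _ => ∅) (fun _ => ∅)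
  constructor
  · intro he
    have := Eval.mem_den he (ρ := fun _ => ∅) (η := fun _ => ∅) hlc (by simp)
    rw [hden] at this
    have : ITy.bool b' = .bool b := this
    cases this
    rfl
  · rintro rfl
    have : ITy.bool b ∈ den (fun _ => ∅) (fun _ => ∅) M := by rw [hden]; rfl
    have := realizes_of_mem_den M.size (𝒜 := []) le_rfl hlc (by simp [hfv]) this
    exact this [] .hole

end STAB

/-! ### Conversion calculus and encodings of finite data. -/

namespace STAB
open Term

attribute [simp] Term.instAt Term.fv

namespace Term

@[simp] theorem lc_iff {M : Term} : LC M ↔ LCAt 0 M := ⟨id, id⟩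
@[simp] theorem lcAt_bvar {k i : ℕ} : LCAt k (bvar i) ↔ i < k := ⟨id, id⟩
@[simp] theorem lcAt_fvar {k x : ℕ} : LCAt k (fvar x) := trivial
@[simp] theorem lcAt_bool {k : ℕ} {b : Bool} : LCAt k (bool b) := trivial
@[simp] theorem lcAt_abs {k : ℕ} {M : Term} : LCAt k (abs M) ↔ LCAt (k + 1) M := ⟨id, id⟩
@[simp] theorem lcAt_app {k : ℕ} {M N : Term} : LCAt k (app M N) ↔ LCAt k M ∧ LCAt k N :=
  ⟨id, id⟩
@[simp] theorem lcAt_cond {k : ℕ} {M N P : Term} :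
    LCAt k (cond M N P) ↔ LCAt k M ∧ LCAt k N ∧ LCAt k P := ⟨id, id⟩

end Term

/-! ### Convertibility -/

theorem Conv.refl (M : Term) : Conv M M := Relation.EqvGen.refl M

theorem Conv.symm {M N : Term} (h : Conv M N) : Conv N M := Relation.EqvGen.symm _ _ h

theorem Conv.trans {M N P : Term} (h : Conv M N) (h' : Conv N P) : Conv M P :=
  Relation.EqvGen.trans _ _ _ h h'

theorem Conv.of_eq {M N : Term} (h : M = N) : Conv M N := h ▸ .refl M

theorem Conv.congr_of_red {f : Term → Term} (hf : ∀ {M N}, Red M N → Red (f M) (f N)) {M N : Term}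
    (h : Conv M N) : Conv (f M) (f N) := by
  induction h with
  | rel _ _ h => exact .rel _ _ (hf h)
  | refl => exact .refl _
  | symm _ _ _ ih => exact ih.symm
  | trans _ _ _ _ _ ih₁ ih₂ => exact ih₁.trans ih₂

theorem Conv.appL {M M' N : Term} (h : Conv M M') : Conv (app M N) (app M' N) :=
  h.congr_of_red (f := fun M => app M N) .appL

theorem Conv.appR {M N N' : Term} (h : Conv N N') : Conv (app M N) (app M N') :=
  h.congr_of_red .appR

theorem Conv.app {M M' N N' : Term} (h : Conv M M') (h' : Conv N N') :
    Conv (app M N) (app M' N') := h.appL.trans h'.appR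

theorem Conv.cond {M M' N N' P P' : Term} (h₁ : Conv M M') (h₂ : Conv N N') (h₃ : Conv P P') :
    Conv (cond M N P) (cond M' N' P') :=
  ((h₁.congr_of_red (f := fun M => Term.cond M N P) .cond₁).trans
    (h₂.congr_of_red (f := fun N => Term.cond M' N P) .cond₂)).trans
    (h₃.congr_of_red .cond₃)

theorem Conv.condTrue {M N : Term} : Conv (.cond (.bool true) M N) M := .rel _ _ .condTrue

theorem Conv.condFalse {M N : Term} : Conv (.cond (.bool false) M N) N := .rel _ _ .condFalse

/-- Opening both bodies with one fresh name reduces conversion under a nameless binder to the rule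
for named abstractions. -/
theorem Conv.abs (x : ℕ) {M M' : Term} (hM : x ∉ M.fv) (hM' : x ∉ M'.fv)
    (h : Conv (M.inst (fvar x)) (M'.inst (fvar x))) : Conv (abs M) (abs M') := by
  rw [← lam_inst hM, ← lam_inst hM']
  exact h.congr_of_red (.lam x)

theorem Conv.apps {M M' : Term} (h : Conv M M') (Vs : List Term) :
    Conv (M.apps Vs) (M'.apps Vs) := by
  induction Vs generalizing M M' with
  | nil => exact h
  | cons V Vs ih => exact ih h.appL

theorem Conv.beta {M N : Term} (hM : LCAt 1 M) (hN : LCAt 0 N) :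
    Conv (.app (.abs M) N) (instAt 0 N M) := .rel _ _ (.beta ⟨hM, hN⟩)

theorem Conv.beta₂ {M N₁ N₂ : Term} (hM : LCAt 2 M) (h₁ : LCAt 0 N₁) (h₂ : LCAt 0 N₂) :
    Conv (.app (.app (.abs (.abs M)) N₁) N₂) (instAt 0 N₂ (instAt 1 N₁ M)) :=
  (Conv.beta (M := .abs M) hM h₁).appL.trans (.beta (lcAt_instAt h₁ hM) h₂)

theorem Conv.beta₃ {M N₁ N₂ N₃ : Term} (hM : LCAt 3 M) (h₁ : LCAt 0 N₁) (h₂ : LCAt 0 N₂)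
    (h₃ : LCAt 0 N₃) :
    Conv (.app (.app (.app (.abs (.abs (.abs M))) N₁) N₂) N₃)
      (instAt 0 N₃ (instAt 1 N₂ (instAt 2 N₁ M))) :=
  (Conv.beta₂ (M := .abs M) hM h₁ h₂).appL.trans
    (.beta (lcAt_instAt h₂ (lcAt_instAt h₁ hM)) h₃)

theorem Conv.beta₆ {M N₁ N₂ N₃ N₄ N₅ N₆ : Term} (hM : LCAt 6 M) (h₁ : LCAt 0 N₁) (h₂ : LCAt 0 N₂)
    (h₃ : LCAt 0 N₃) (h₄ : LCAt 0 N₄) (h₅ : LCAt 0 N₅) (h₆ : LCAt 0 N₆) :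
    Conv (.app (.app (.app (.app (.app (.app (.abs (.abs (.abs (.abs (.abs (.abs M))))))
      N₁) N₂) N₃) N₄) N₅) N₆)
      (instAt 0 N₆ (instAt 1 N₅ (instAt 2 N₄ (instAt 3 N₃ (instAt 4 N₂ (instAt 5 N₁ M)))))) :=
  (Conv.beta₃ (M := .abs (.abs (.abs M))) hM h₁ h₂ h₃).appL.appL.appL.trans
    (.beta₃ (lcAt_instAt h₃ (lcAt_instAt h₂ (lcAt_instAt h₁ hM))) h₄ h₅ h₆)

/-! ### Finite types -/

/-- `λx₁.⋯λxₙ.M`. -/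
def constTm (n : ℕ) (M : Term) : Term := abs^[n] M

theorem constTm_succ (n : ℕ) (M : Term) : constTm (n + 1) M = abs (constTm n M) :=
  Function.iterate_succ_apply' _ _ _

@[simp] theorem instAt_constTm {N : Term} (n : ℕ) (M : Term) : ∀ k : ℕ,
    instAt k N (constTm n M) = constTm n (instAt (k + n) N M) := by
  induction n with
  | zero => intro k; rfl
  | succ n ih => intro k; simp [constTm_succ, ih, Nat.add_right_comm k 1 n, ← add_assoc]

@[simp] theorem lcAt_constTm (n : ℕ) (M : Term) : ∀ k : ℕ,
    LCAt k (constTm n M) ↔ LCAt (k + n) M := by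
  induction n with
  | zero => intro k; rfl
  | succ n ih => intro k; simp [constTm_succ, ih, Nat.add_right_comm k 1 n, ← add_assoc]

@[simp] theorem fv_constTm (n : ℕ) (M : Term) : (constTm n M).fv = M.fv := by
  induction n with
  | zero => rfl
  | succ n ih => simp [constTm_succ, ih]

theorem conv_constTm {M : Term} (hM : LC M) (Vs : List Term) (hVs : ∀ V ∈ Vs, LC V) :
    Conv ((constTm Vs.length M).apps Vs) M := by
  induction Vs with
  | nil => exact .refl _
  | cons V Vs ih =>
    rw [apps_cons, List.length_cons, constTm_succ]
    refine ((Conv.beta ?_ (hVs V (by simp))).apps Vs).trans ?_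
    · simpa using hM.lcAt _
    · rw [instAt_constTm, hM.instAt_eq]
      exact ih fun V hV => hVs V (by simp [hV])

/-- `λx₀.⋯λxₙ₋₁.xᵢ`. -/
def sel : ℕ → ℕ → Term
  | 0, _ => .bool true
  | n + 1, 0 => abs (constTm n (bvar n))
  | n + 1, i + 1 => abs (sel n i)

theorem lc_sel : ∀ n i : ℕ, LC (sel n i)
  | 0, _ => trivial
  | n + 1, 0 => by simp [sel]
  | n + 1, i + 1 => by simpa [sel] using (lc_sel n i).lcAt 1

@[simp] theorem lcAt_sel (k n i : ℕ) : LCAt k (sel n i) := (lc_sel n i).lcAt k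

@[simp] theorem instAt_sel (k n i : ℕ) (N : Term) : instAt k N (sel n i) = sel n i :=
  (lc_sel n i).instAt_eq k N

@[simp] theorem fv_sel : ∀ n i : ℕ, (sel n i).fv = ∅
  | 0, _ => rfl
  | n + 1, 0 => by simp [sel]
  | n + 1, i + 1 => by simp [sel, fv_sel n i]

theorem conv_sel {Vs : List Term} : ∀ {i : ℕ} (hi : i < Vs.length), (∀ V ∈ Vs, LC V) →
    Conv ((sel Vs.length i).apps Vs) Vs[i] := by
  induction Vs with
  | nil => intro i hi; simp at hi
  | cons V Vs ih =>
    intro i hi hVs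
    have hV := hVs V (by simp)
    rw [apps_cons, List.length_cons]
    cases i with
    | zero =>
      refine ((Conv.beta (by simp) hV).apps Vs).trans ?_
      simpa using conv_constTm hV Vs fun V hV => hVs V (by simp [hV])
    | succ i =>
      refine ((Conv.beta (by simp) hV).apps Vs).trans ?_
      simpa using ih (i := i) (by simpa using hi) fun V hV => hVs V (by simp [hV])

section Finite
variable {X : Type*} [Finite X]

/-- The code of an element of a finite type. -/
noncomputable def enc (x : X) : Term := sel (Nat.card X) (Finite.equivFin X x)

/-- Case distinction over a finite type. -/
noncomputable def caseTm (v : Term) (N : X → Term) : Term :=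
  v.apps (List.ofFn fun i => N ((Finite.equivFin X).symm i))

@[simp] theorem lcAt_enc (k : ℕ) (x : X) : LCAt k (enc x) := lcAt_sel _ _ _

@[simp] theorem instAt_enc (k : ℕ) (x : X) (N : Term) : instAt k N (enc x) = enc x :=
  instAt_sel _ _ _ _

@[simp] theorem fv_enc (x : X) : (enc x).fv = ∅ := fv_sel _ _

@[simp] theorem lcAt_caseTm {k : ℕ} {v : Term} {N : X → Term} :
    LCAt k (caseTm v N) ↔ LCAt k v ∧ ∀ x, LCAt k (N x) := by
  simp only [caseTm, lcAt_apps, List.mem_ofFn, forall_exists_index, forall_apply_eq_imp_iff]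
  rw [(Finite.equivFin X).symm.forall_congr_left]
  simp

theorem instAt_apps (k : ℕ) (N : Term) (Vs : List Term) : ∀ M : Term,
    instAt k N (M.apps Vs) = (instAt k N M).apps (Vs.map (instAt k N)) := by
  induction Vs with
  | nil => intro M; rfl
  | cons V Vs ih => intro M; rw [apps_cons, ih]; rfl

@[simp] theorem instAt_caseTm {k : ℕ} {v P : Term} {N : X → Term} :
    instAt k P (caseTm v N) = caseTm (instAt k P v) fun x => instAt k P (N x) := by
  simp only [caseTm, instAt_apps, List.map_ofFn]
  rfl

theorem fv_caseTm {v : Term} {N : X → Term} (hN : ∀ x, (N x).fv = ∅) :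
    (caseTm v N).fv = v.fv := by
  ext y
  simp [caseTm, fv_apps, hN]

theorem conv_caseTm (x : X) {N : X → Term} (hN : ∀ x, LC (N x)) :
    Conv (caseTm (enc x) N) (N x) := by
  have h := conv_sel (Vs := List.ofFn fun i => N ((Finite.equivFin X).symm i))
    (i := Finite.equivFin X x) (by simp) (by
      simp only [List.mem_ofFn, forall_exists_index, forall_apply_eq_imp_iff]
      exact fun i => hN _)
  simpa [caseTm, enc] using h

end Finite

/-! ### Lists of cells -/

/-- `f l₀ (f l₁ (⋯ u))`. -/
noncomputable def cells {X : Type*} [Finite X] (f : Term) (L : List X) (u : Term) : Term :=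
  L.foldr (fun l t => app (app f (enc l)) t) u

section Cells
variable {X : Type*} [Finite X]

@[simp] theorem cells_nil (f u : Term) : cells f ([] : List X) u = u := rfl

theorem cells_cons (f u : Term) (l : X) (L : List X) :
    cells f (l :: L) u = app (app f (enc l)) (cells f L u) := rfl

@[simp] theorem instAt_cells {k : ℕ} {N f u : Term} {L : List X} :
    instAt k N (cells f L u) = cells (instAt k N f) L (instAt k N u) := by
  induction L with
  | nil => rfl
  | cons l L ih => simp [cells_cons, ih]

@[simp] theorem lcAt_cells {k : ℕ} {f u : Term} {L : List X} (hf : LCAt k f) (hu : LCAt k u) :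
    LCAt k (cells f L u) := by
  induction L with
  | nil => exact hu
  | cons l L ih => simp [cells_cons, ih, hf]

@[simp] theorem notMem_fv_cells {x : ℕ} {f u : Term} {L : List X} (hf : x ∉ f.fv) (hu : x ∉ u.fv) :
    x ∉ (cells f L u).fv := by
  induction L with
  | nil => exact hu
  | cons l L ih => simp [cells_cons, ih, hf]

theorem cells_replicate (f u : Term) (n : ℕ) (g : X) :
    cells f (List.replicate n g) u = (app (app f (enc g)))^[n] u := by
  induction n with
  | zero => rfl
  | succ n ih => rw [List.replicate_succ, cells_cons, ih, Function.iterate_succ_apply']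

theorem cells_append (f u : Term) (L R : List X) :
    cells f (L ++ R) u = cells f L (cells f R u) := List.foldr_append

theorem Conv.cells {f u u' : Term} (L : List X) (h : Conv u u') :
    Conv (cells f L u) (cells f L u') := by
  induction L with
  | nil => exact h
  | cons l L ih => exact .appR ih

/-! ### Splitting a list into head and tail without duplicating its constructor. -/

/-- `λp.p T F b`. -/
def popVal (T F b : Term) : Term := abs (app (app (app (bvar 0) T) F) b)

/-- `λb.λd.λp.d(λT.λF.λb'.p (λz.F b' (T z)) f b)`. -/
def popStep (f : Term) : Term :=
  abs (abs (abs (app (bvar 1) (abs (abs (abs (app (app (app (bvar 3)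
    (abs (app (app (bvar 2) (bvar 1)) (app (bvar 3) (bvar 0))))) f) (bvar 5))))))))

/-- The result of popping from the empty list. -/
def popNil (b : Term) : Term := popVal (abs (bvar 0)) (abs (abs (bvar 0))) b

/-- This is the predecessor trick. A split list keeps its head `l` and the constructor `f` apart
from the tail; `popStep` puts the previous head back onto the tail with the stored constructor and
holds its own cell in reserve. At the end of the list the stored constructor is the dummy `λb.λz.z`,
which erases the default symbol. -/
theorem conv_pop {f : Term} (hf : LC f) (d l : X) (L : List X) :
    Conv (app (abs (cells (popStep f) (l :: L) (bvar 0))) (popNil (enc d)))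
      (popVal (abs (cells f L (bvar 0))) f (enc l)) := by
  have hf' : ∀ k, LCAt k f := hf.lcAt
  have hi : ∀ k N, instAt k N f = f := hf.instAt_eq
  refine (Conv.beta (lcAt_cells (by simp [popStep, hf']) (by simp))
    (by simp [popNil, popVal])).trans ?_
  have h0 : instAt 0 (popNil (enc d)) (popStep f) = popStep f := by simp [popStep, hi]
  rw [instAt_cells, h0]
  simp only [instAt, if_true]
  obtain ⟨x, hx⟩ := f.fv.exists_notMem
  obtain ⟨y, hy⟩ := (insert x f.fv).exists_notMem
  have hxy : y ≠ x := fun h => hy (by simp [h])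
  have hy : y ∉ f.fv := fun h => hy (by simp [h])
  induction L generalizing l with
  | nil =>
    rw [cells_cons]
    refine (Conv.beta₂ (by simp [hf']) (by simp) (by simp [popNil, popVal])).trans ?_
    refine .abs x (by simp [popNil, popVal, hx, hi]) (by simp [hx]) ?_
    simp only [inst, instAt, popNil, popVal, hi]
    simp
    refine (Conv.beta (by simp) (by simp [hf'])).trans ?_
    simp
    refine (Conv.beta₃ (by simp [hf']) (by simp) (by simp) (by simp)).trans ?_
    simp [hi]
    refine Conv.appL (Conv.appL (Conv.appR ?_))
    refine .abs y (by simp) (by simp) ?_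
    simp [inst]
    refine (Conv.beta₂ (by simp) (by simp) (by simp)).trans ?_
    simp
    exact (Conv.beta (by simp) (by simp))
  | cons l' L ih =>
    rw [cells_cons]
    -- The tail `l' :: L` is already split; the remaining step reattaches `l'` and holds `l` in
    -- reserve.
    refine (Conv.appR (ih l')).trans ?_
    have hc : ∀ k, LCAt (k + 1) (cells f L (bvar 0)) := fun k => lcAt_cells (hf' _) (by simp)
    refine (Conv.beta₂ (by simp [hf']) (by simp) (by simp [popVal, hf', hc])).trans ?_
    refine .abs x (by simp [popVal, hx, hi, notMem_fv_cells])
      (by simp [hx, notMem_fv_cells]) ?_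
    simp only [inst, instAt, popVal, hi]
    simp [hi]
    refine (Conv.beta (by simp [hf']) (by simp [hf'])).trans ?_
    simp [hi]
    refine (Conv.beta₃ (by simp [hf']) (by simp [hf']) (by simp [hf']) (by simp)).trans ?_
    simp [hi]
    refine Conv.appL (Conv.appL (Conv.appR ?_))
    refine .abs y (by simp [hy, notMem_fv_cells]) (by simp [cells_cons, hy, notMem_fv_cells]) ?_
    simp [inst, hi, cells_cons]
    refine Conv.appR ?_
    refine (Conv.beta (hc 0) (by simp)).trans ?_
    simp [hi]
    exact .refl _

end Cells
end STAB

namespace STAB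
open Term

/-! ### Renaming of variables and typing with repeated names -/

namespace Term

/-- Rename free variables. -/
def rename (r : ℕ → ℕ) : Term → Term
  | bvar i => bvar i
  | fvar x => fvar (r x)
  | bool b => bool b
  | abs M => abs (rename r M)
  | app M N => app (rename r M) (rename r N)
  | cond M N₀ N₁ => cond (rename r M) (rename r N₀) (rename r N₁)

theorem rename_congr {r r' : ℕ → ℕ} {M : Term} (h : ∀ x ∈ M.fv, r x = r' x) :
    M.rename r = M.rename r' := by
  induction M with
  | bvar i => rfl
  | fvar x => simp [rename, h x (by simp)]
  | bool b => rfl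
  | abs M ih => simp [rename, ih h]
  | app M N ih₁ ih₂ =>
    simp [rename, ih₁ fun x hx => h x (by simp [hx]), ih₂ fun x hx => h x (by simp [hx])]
  | cond M N P ih₁ ih₂ ih₃ =>
    simp [rename, ih₁ fun x hx => h x (by simp [hx]), ih₂ fun x hx => h x (by simp [hx]),
      ih₃ fun x hx => h x (by simp [hx])]

theorem rename_rename {r r' : ℕ → ℕ} {M : Term} :
    (M.rename r).rename r' = M.rename (r' ∘ r) := by
  induction M <;> simp_all [rename]

theorem rename_id {M : Term} : M.rename id = M := by
  induction M <;> simp_all [rename]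

theorem fv_rename {r : ℕ → ℕ} {M : Term} : (M.rename r).fv = M.fv.image r := by
  induction M <;> simp_all [rename, Finset.image_union]

theorem rename_closeAt {r : ℕ → ℕ} {x : ℕ} {M : Term} :
    ∀ {k : ℕ}, (∀ y ∈ M.fv, r y = r x → y = x) →
      (closeAt k x M).rename r = closeAt k (r x) (M.rename r) := by
  induction M with
  | bvar i => intros; rfl
  | fvar y =>
    intro k h
    by_cases hy : y = x
    · simp [closeAt, rename, hy]
    · have : r y ≠ r x := fun h' => hy (h y (by simp) h')
      simp [closeAt, rename, hy, this]
  | bool b => intros; rfl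
  | abs M ih => intro k h; simp [closeAt, rename, ih h]
  | app M N ih₁ ih₂ =>
    intro k h
    simp [closeAt, rename, ih₁ fun x hx => h x (by simp [hx]), ih₂ fun x hx => h x (by simp [hx])]
  | cond M N P ih₁ ih₂ ih₃ =>
    intro k h
    simp [closeAt, rename, ih₁ fun x hx => h x (by simp [hx]), ih₂ fun x hx => h x (by simp [hx]),
      ih₃ fun x hx => h x (by simp [hx])]

theorem merge_eq_rename {xs : List ℕ} {x : ℕ} {M : Term} :
    M.merge xs x = M.rename fun y => if y ∈ xs then x else y := by
  induction M with
  | fvar y => by_cases hy : y ∈ xs <;> simp [merge, rename, hy]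
  | _ => simp_all [merge, rename]

theorem lcAt_rename {r : ℕ → ℕ} {M : Term} : ∀ {k : ℕ}, LCAt k (M.rename r) ↔ LCAt k M := by
  induction M <;> simp_all [rename]

end Term

theorem Typed.lc {Γ : Ctx} {M : Term} {σ : Ty} (h : Typed Γ M σ) : LC M := by
  induction h with
  | perm _ _ ih => exact ih
  | ax => trivial
  | boolI => trivial
  | weak _ _ _ _ ih => exact ih
  | lolliI _ ih => exact lcAt_closeAt ih
  | lolliE _ _ _ ih₁ ih₂ => exact ⟨ih₁, ih₂⟩
  | mult xs x _ _ ih => rw [merge_eq_rename]; exact lcAt_rename.2 ih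
  | sp _ ih => exact ih
  | allI _ ih => exact ih
  | allE _ _ ih => exact ih
  | boolE _ _ _ ih₁ ih₂ ih₃ => exact ⟨ih₁, ih₂, ih₃⟩

theorem Ctx.dom_mapTy (f : Ty → Ty) (Γ : Ctx) : (Γ.mapTy f).dom = Γ.dom := by
  simp [Ctx.dom, Ctx.mapTy]

theorem Ctx.dom_perm {Γ Δ : Ctx} (h : Γ.Perm Δ) : Γ.dom.Perm Δ.dom := h.map _

theorem Typed.fv_subset {Γ : Ctx} {M : Term} {σ : Ty} (h : Typed Γ M σ) :
    ∀ x ∈ M.fv, x ∈ Γ.dom := by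
  induction h with
  | perm hp _ ih => exact fun x hx => (Ctx.dom_perm hp).mem_iff.1 (ih x hx)
  | ax => simp [Ctx.dom]
  | boolI => simp
  | weak _ _ _ _ ih => exact fun x hx => List.mem_cons_of_mem _ (ih x hx)
  | lolliI _ ih =>
    intro x hx
    simp only [lam, Term.fv, fv_closeAt, Finset.mem_erase] at hx
    have := ih x hx.2
    simpa [Ctx.dom, hx.1] using this
  | lolliE _ _ _ ih₁ ih₂ =>
    intro x hx
    simp only [Term.fv, Finset.mem_union] at hx
    simp only [Ctx.dom, List.map_append, List.mem_append]
    exact hx.imp (ih₁ x) (ih₂ x)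
  | mult xs x _ _ ih =>
    intro y hy
    rw [merge_eq_rename, fv_rename, Finset.mem_image] at hy
    obtain ⟨z, hz, rfl⟩ := hy
    have := ih z hz
    by_cases hzx : z ∈ xs
    · simp [Ctx.dom, hzx]
    · simp only [Ctx.dom, List.map_append, List.map_map, List.mem_append] at this
      simp only [hzx, if_false]
      refine List.mem_cons_of_mem _ (this.resolve_left ?_)
      simpa [Function.comp_def] using hzx
  | sp _ ih => simpa [Ctx.dom_mapTy] using ih
  | allI _ ih => simpa [Ctx.dom_mapTy] using ih
  | allE _ _ ih => exact ih
  | boolE _ _ _ ih₁ ih₂ ih₃ =>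
    intro x hx
    simp only [Term.fv, Finset.mem_union] at hx
    rcases hx with (hx | hx) | hx
    exacts [ih₁ x hx, ih₂ x hx, ih₃ x hx]

/-- Rename the variables of a context. -/
def Ctx.rename (r : ℕ → ℕ) (Γ : Ctx) : Ctx := Γ.map fun a => (r a.1, a.2)

theorem Ctx.dom_rename (r : ℕ → ℕ) (Γ : Ctx) : (Γ.rename r).dom = Γ.dom.map r := by
  simp [Ctx.dom, Ctx.rename]

theorem Ctx.rename_mapTy (r : ℕ → ℕ) (f : Ty → Ty) (Γ : Ctx) :
    (Γ.mapTy f).rename r = (Γ.rename r).mapTy f := by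
  simp [Ctx.mapTy, Ctx.rename]

theorem Ctx.rename_congr {r r' : ℕ → ℕ} {Γ : Ctx} (h : ∀ x ∈ Γ.dom, r x = r' x) :
    Γ.rename r = Γ.rename r' := by
  refine List.map_congr_left fun a ha => ?_
  rw [h a.1 (List.mem_map_of_mem ha)]

theorem Ctx.rename_rename (r r' : ℕ → ℕ) (Γ : Ctx) :
    (Γ.rename r).rename r' = Γ.rename (r' ∘ r) := by
  simp [Ctx.rename]

theorem Typed.rename {r : ℕ → ℕ} (hr : Function.Injective r) {Γ : Ctx} {M : Term} {σ : Ty}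
    (h : Typed Γ M σ) : Typed (Γ.rename r) (M.rename r) σ := by
  induction h with
  | perm hp _ ih => exact .perm (hp.map _) ih
  | ax => exact .ax _ _
  | boolI => exact .boolI _
  | weak x A hx _ ih =>
    refine .weak (r x) A ?_ ih
    change r x ∉ (Ctx.rename r _).dom
    rw [Ctx.dom_rename, List.mem_map_of_injective hr]
    exact hx
  | @lolliI Γ x σ M A _ ih =>
    have : (lam x M).rename r = lam (r x) (M.rename r) := by
      simp only [lam, Term.rename]
      rw [rename_closeAt fun y _ h => hr h]
    rw [this]
    exact .lolliI ih
  | lolliE hd _ _ ih₁ ih₂ =>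
    simp only [Ctx.rename, List.map_append, Term.rename]
    refine .lolliE ?_ ih₁ ih₂
    change (Ctx.rename r _).dom.Disjoint (Ctx.rename r _).dom
    rw [Ctx.dom_rename, Ctx.dom_rename]
    exact List.disjoint_map hr hd
  | @mult Γ M σ τ xs x hx _ ih =>
    have : (M.merge xs x).rename r = (M.rename r).merge (xs.map r) (r x) := by
      rw [merge_eq_rename, merge_eq_rename, rename_rename, rename_rename]
      refine Term.rename_congr fun y _ => ?_
      simp only [Function.comp_apply, List.mem_map_of_injective hr]
      split_ifs <;> rfl
    rw [this]
    refine .mult (xs.map r) (r x) ?_ ?_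
    · change r x ∉ (Ctx.rename r _).dom
      rw [Ctx.dom_rename, List.mem_map_of_injective hr]
      exact hx
    · simpa [Ctx.rename, Function.comp_def] using ih
  | sp _ ih => rw [Ctx.rename_mapTy]; exact .sp ih
  | allI _ ih => rw [Ctx.rename_mapTy] at ih; exact .allI ih
  | allE A _ ih => exact .allE A ih
  | boolE _ _ _ ih₁ ih₂ ih₃ => exact .boolE ih₁ ih₂ ih₃

/-- It lets the renaming lemma for injective maps serve for renamings injective only on the context.
-/
theorem exists_injective_extension {r : ℕ → ℕ} {l : List ℕ} (hl : (l.map r).Nodup) :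
    ∃ r' : ℕ → ℕ, Function.Injective r' ∧ ∀ x ∈ l, r' x = r x := by
  have hinj := List.inj_on_of_nodup_map hl
  -- Names outside `l` are pushed above the sum of the images of `l`, hence past every value taken
  -- on `l`.
  refine ⟨fun n => if n ∈ l then r n else n + ((l.map r).sum + 1), fun a b h => ?_,
    fun x hx => by simp [hx]⟩
  have hle : ∀ x ∈ l, r x ≤ (l.map r).sum := fun x hx =>
    List.le_sum_of_mem (List.mem_map_of_mem hx)
  by_cases ha : a ∈ l <;> by_cases hb : b ∈ l <;> simp only [ha, hb, if_true, if_false] at h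
  · exact hinj ha hb h
  · have := hle a ha; omega
  · have := hle b hb; omega
  · omega

theorem Typed.rename_of_nodup {r : ℕ → ℕ} {Γ : Ctx} {M : Term} {σ : Ty}
    (h : Typed Γ M σ) (hr : (Γ.dom.map r).Nodup) : Typed (Γ.rename r) (M.rename r) σ := by
  obtain ⟨r', hinj, hr'⟩ := exists_injective_extension hr
  rw [← Ctx.rename_congr hr', ← Term.rename_congr fun x hx => hr' x (h.fv_subset x hx)]
  exact h.rename hinj

/-- Typing before contraction: the names in the context may be repeated, each occurrence of an
assumption being used separately. -/
def STyped (G : Multiset (ℕ × Ty)) (M : Term) (σ : Ty) : Prop :=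
  ∃ (Γ : Ctx) (N : Term) (r : ℕ → ℕ), Typed Γ N σ ∧ G = (Γ.rename r : Ctx) ∧ M = N.rename r

theorem Typed.styped {Γ : Ctx} {M : Term} {σ : Ty} (h : Typed Γ M σ) : STyped Γ M σ :=
  ⟨Γ, M, id, h, by simp [Ctx.rename], rename_id.symm⟩

theorem Typed.styped_nil {M : Term} {σ : Ty} (h : Typed [] M σ) : STyped 0 M σ := h.styped

/-- When the target names are distinct, the renaming is injective on the context of the underlying
derivation and can be carried out inside it. -/
theorem STyped.typed {G : Multiset (ℕ × Ty)} {Γ : Ctx} {M : Term} {σ : Ty} (h : STyped G M σ)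
    (hG : G = (Γ : Multiset (ℕ × Ty))) (hΓ : Γ.dom.Nodup) : Typed Γ M σ := by
  obtain ⟨Δ, N, r, hN, rfl, rfl⟩ := h
  have hp : (Δ.rename r).Perm Γ := Multiset.coe_eq_coe.1 hG
  refine .perm hp (hN.rename_of_nodup ?_)
  rw [← Ctx.dom_rename]
  exact (Ctx.dom_perm hp).nodup_iff.2 hΓ

theorem STyped.typed_nil {M : Term} {σ : Ty} (h : STyped 0 M σ) : Typed [] M σ :=
  h.typed rfl (by simp [Ctx.dom])

theorem STyped.lc {G : Multiset (ℕ × Ty)} {M : Term} {σ : Ty} (h : STyped G M σ) : LC M := by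
  obtain ⟨Δ, N, r, hN, rfl, rfl⟩ := h
  exact lcAt_rename.2 hN.lc

theorem STyped.var (x : ℕ) (A : LTy) : STyped {(x, A.toTy)} (fvar x) A.toTy :=
  (Typed.ax x A).styped

theorem STyped.bool (b : Bool) : STyped 0 (.bool b) LTy.bool.toTy := (Typed.boolI b).styped

/-- A variable outside a context, to be mapped by the renaming to a given name. -/
theorem Typed.exists_fresh {Γ : Ctx} {M : Term} {σ : Ty} (h : Typed Γ M σ) (r : ℕ → ℕ) (x : ℕ) :
    ∃ y r', y ∉ Γ.dom ∧ y ∉ M.fv ∧ r' y = x ∧ Γ.rename r' = Γ.rename r ∧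
      M.rename r' = M.rename r := by
  obtain ⟨y, hy⟩ := Γ.dom.toFinset.exists_notMem
  have hy : y ∉ Γ.dom := by simpa using hy
  have hne : ∀ z ∈ Γ.dom, Function.update r y x z = r z := fun z hz => by
    have : z ≠ y := by rintro rfl; exact hy hz
    simp [this]
  exact ⟨y, Function.update r y x, hy, fun hy' => hy (h.fv_subset y hy'), by simp,
    Ctx.rename_congr hne, Term.rename_congr fun z hz => hne z (h.fv_subset z hz)⟩

theorem STyped.weak {G : Multiset (ℕ × Ty)} {M : Term} {σ : Ty} (h : STyped G M σ) (x : ℕ)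
    (A : LTy) : STyped ({(x, A.toTy)} + G) M σ := by
  obtain ⟨Δ, N, r, hN, rfl, rfl⟩ := h
  obtain ⟨y, r', hy, -, hyx, h₁, h₂⟩ := hN.exists_fresh r x
  refine ⟨(y, A.toTy) :: Δ, N, r', .weak y A hy hN, ?_, h₂.symm⟩
  rw [← h₁]
  simp [Ctx.rename, hyx]

theorem STyped.app {G H : Multiset (ℕ × Ty)} {M N : Term} {σ : Ty} {A : LTy}
    (hM : STyped G M (lolli σ A).toTy) (hN : STyped H N σ) :
    STyped (G + H) (.app M N) A.toTy := by
  obtain ⟨Γ, M, r, hM, rfl, rfl⟩ := hM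
  obtain ⟨Δ, N, s, hN, rfl, rfl⟩ := hN
  have hi₀ : Function.Injective fun n => 2 * n := fun a b h => by simpa using h
  have hi₁ : Function.Injective fun n => 2 * n + 1 := fun a b h => by simpa using h
  -- The premises are moved to even and to odd names, which makes their contexts disjoint; `t` maps
  -- both back to the intended names.
  let t : ℕ → ℕ := fun n => if n % 2 = 0 then r (n / 2) else s (n / 2)
  have ht₀ : t ∘ (fun n => 2 * n) = r := by funext n; simp [t]
  have ht₁ : t ∘ (fun n => 2 * n + 1) = s := by
    funext n
    have : (2 * n + 1) / 2 = n := by omega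
    simp [t, this]
  refine ⟨_, _, t, .lolliE ?_ (hM.rename hi₀) (hN.rename hi₁), ?_, ?_⟩
  · rw [Ctx.dom_rename, Ctx.dom_rename]
    intro x hx hx'
    simp only [List.mem_map] at hx hx'
    obtain ⟨a, -, rfl⟩ := hx
    obtain ⟨b, -, hb⟩ := hx'
    omega
  · have : ∀ Γ Δ : Ctx, Ctx.rename t (Γ ++ Δ) = Γ.rename t ++ Δ.rename t := by
      simp [Ctx.rename]
    rw [this, Ctx.rename_rename, Ctx.rename_rename, ht₀, ht₁]
    rfl
  · simp only [Term.rename, rename_rename, ht₀, ht₁]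

/-- The copies of `x` correspond to distinct variables in the underlying derivation, and rule `mult`
merges those into one new variable that the renaming sends to `x`. The case `n = 0` introduces a
banged assumption that is not used. -/
theorem STyped.contract {G : Multiset (ℕ × Ty)} {M : Term} {σ τ : Ty} (x n : ℕ)
    (h : STyped (Multiset.replicate n (x, σ) + G) M τ) : STyped ({(x, σ.bang)} + G) M τ := by
  obtain ⟨Γ, N, r, hN, hG, rfl⟩ := h
  -- split the context into the assumptions to contract and the others
  have hsplit : ∀ (n : ℕ) (Γ : Ctx), Multiset.replicate n (x, σ) + G = (Γ.rename r : Ctx) →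
      ∃ (xs : List ℕ) (Δ : Ctx), Γ.Perm (xs.map (fun y => (y, σ)) ++ Δ) ∧
        G = (Δ.rename r : Ctx) ∧ ∀ y ∈ xs, r y = x := by
    intro n
    induction n with
    | zero => intro Γ h; exact ⟨[], Γ, .refl _, by simpa using h, by simp⟩
    | succ n ih =>
      intro Γ h
      have hmem : (x, σ) ∈ Γ.rename r := by
        rw [← Multiset.mem_coe, ← h]; simp [Multiset.replicate_succ]
      obtain ⟨⟨y, σ'⟩, hy, hyx⟩ := List.mem_map.1 hmem
      simp only [Prod.mk.injEq] at hyx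
      obtain ⟨hyx, rfl⟩ := hyx
      obtain ⟨Γ', hΓ'⟩ := (List.singleton_sublist.2 hy).exists_perm_append
      have h' : Multiset.replicate n (x, σ') + G = (Ctx.rename r Γ' : Ctx) := by
        have h₁ : ((Γ.rename r : Ctx) : Multiset (ℕ × Ty)) =
            (x, σ') ::ₘ ((Ctx.rename r Γ' : Ctx) : Multiset (ℕ × Ty)) := by
          rw [Multiset.cons_coe, Multiset.coe_eq_coe]
          have := hΓ'.map (fun a : ℕ × Ty => (r a.1, a.2))
          simpa [hyx, Ctx.rename] using this
        rw [h₁, Multiset.replicate_succ, Multiset.cons_add] at h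
        exact (Multiset.cons_inj_right _).1 h
      obtain ⟨xs, Δ, hp, hG, hxs⟩ := ih Γ' h'
      exact ⟨y :: xs, Δ, hΓ'.trans (hp.cons _), hG, by simpa [hyx] using hxs⟩
  obtain ⟨xs, Δ, hp, rfl, hxs⟩ := hsplit n Γ hG
  have hN' := Typed.perm hp hN
  obtain ⟨y, r', hy, hyN, hyx, h₁, h₂⟩ := hN'.exists_fresh r x
  simp only [Ctx.rename, List.map_append] at h₁
  have h₁' := List.append_inj h₁ (by simp)
  refine ⟨_, _, r', .mult xs y (fun h => hy ?_) hN', ?_, ?_⟩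
  · simp only [Ctx.dom, List.map_append, List.mem_append]
    exact .inr h
  · simp only [Ctx.rename, List.map_cons, hyx, h₁'.2]
    rfl
  · rw [merge_eq_rename, rename_rename, ← h₂]
    refine Term.rename_congr fun z _ => ?_
    by_cases hz : z ∈ xs
    · have : r' z = r z := by
        have := h₁'.1
        simp only [List.map_map, List.map_inj_left] at this
        simpa using this z hz
      simp [hz, hyx, this, hxs z hz]
    · simp [hz]

/-- Each bang is a contraction of a single occurrence. -/
theorem STyped.derelict {G : Multiset (ℕ × Ty)} {M : Term} {σ τ : Ty} {x : ℕ}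
    (h : STyped ({(x, σ)} + G) M τ) (n : ℕ) : STyped ({(x, σ.bangN n)} + G) M τ := by
  induction n with
  | zero => exact h
  | succ n ih => exact .contract x 1 (by simpa using ih)

theorem STyped.abs {G : Multiset (ℕ × Ty)} {M : Term} {σ : Ty} {A : LTy} (x : ℕ)
    (hG : ∀ a ∈ G, a.1 ≠ x) (hM : x ∉ M.fv) (h : STyped ({(x, σ)} + G) (M.inst (fvar x)) A.toTy) :
    STyped G (.abs M) (lolli σ A).toTy := by
  rw [← lam_inst hM]
  obtain ⟨Γ, N, r, hN, hG', hr⟩ := h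
  rw [hr]
  have hmem : (x, σ) ∈ Γ.rename r := by rw [← Multiset.mem_coe, ← hG']; simp
  obtain ⟨⟨y, σ'⟩, hy, hyx⟩ := List.mem_map.1 hmem
  simp only [Prod.mk.injEq] at hyx
  obtain ⟨hyx, rfl⟩ := hyx
  obtain ⟨Γ', hp⟩ := (List.singleton_sublist.2 hy).exists_perm_append
  have hG'' : G = (Ctx.rename r Γ' : Ctx) := by
    have h₁ : ((Γ.rename r : Ctx) : Multiset (ℕ × Ty)) =
        (x, σ') ::ₘ ((Ctx.rename r Γ' : Ctx) : Multiset (ℕ × Ty)) := by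
      rw [Multiset.cons_coe, Multiset.coe_eq_coe]
      have := hp.map (fun a : ℕ × Ty => (r a.1, a.2))
      simpa [hyx, Ctx.rename] using this
    rw [h₁, Multiset.singleton_add] at hG'
    exact (Multiset.cons_inj_right _).1 hG'
  have hN' := Typed.perm hp hN
  refine ⟨Γ', lam y N, r, .lolliI hN', hG'', ?_⟩
  simp only [lam, Term.rename]
  rw [rename_closeAt, hyx]
  intro z hz hzy
  have hz' := hN'.fv_subset z hz
  rcases List.mem_cons.1 hz' with h | h
  · exact h
  · obtain ⟨a, ha, rfl⟩ := List.mem_map.1 h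
    exact absurd (hzy.trans hyx) (hG (r a.1, a.2) (by
      rw [hG'', Multiset.mem_coe]; exact List.mem_map.2 ⟨a, ha, rfl⟩))

theorem STyped.sp {G : Multiset (ℕ × Ty)} {M : Term} {σ : Ty} (h : STyped G M σ) (n : ℕ) :
    STyped (G.map fun a => (a.1, a.2.bangN n)) M (σ.bangN n) := by
  induction n with
  | zero => simpa [Ty.bangN] using h
  | succ n ih =>
    obtain ⟨Δ, N, r, hN, hG, rfl⟩ := ih
    refine ⟨_, N, r, hN.sp, ?_, rfl⟩
    rw [Ctx.rename_mapTy, Ctx.mapTy, ← Multiset.map_coe, ← hG, Multiset.map_map]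
    rfl

theorem STyped.sp_nil {M : Term} {σ : Ty} (h : STyped 0 M σ) (n : ℕ) : STyped 0 M (σ.bangN n) :=
  h.sp n

theorem STyped.allI {G : Multiset (ℕ × Ty)} {M : Term} {A : LTy}
    (h : STyped (G.map fun a => (a.1, a.2.shift)) M A.toTy) : STyped G M A.all.toTy := by
  obtain ⟨Δ, N, r, hN, hG, rfl⟩ := h
  obtain ⟨Γ, rfl⟩ := Quot.exists_rep G
  have hG : ((Ctx.mapTy Ty.shift Γ : Ctx) : Multiset (ℕ × Ty)) = (Δ.rename r : Ctx) := by
    rw [← hG]; rfl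
  obtain ⟨Γ', hΓ', hΔ⟩ : ∃ Γ' : Ctx, Γ'.Perm Γ ∧ Ctx.mapTy Ty.shift Γ' = Δ.rename r := by
    have := Multiset.coe_eq_coe.1 hG
    have h := (congrFun₂ (List.eq_map_comp_perm fun a : ℕ × Ty => (a.1, a.2.shift))
      (Δ.rename r) Γ).mpr this.symm
    obtain ⟨Γ', h₁, h₂⟩ := h
    exact ⟨Γ', h₂, h₁.symm⟩
  -- pull the types of `Γ'` back to the names of `Δ`
  let E : Ctx := List.zipWith (fun a b => (a.1, b.2)) Δ Γ'
  have hlen : Δ.length = Γ'.length := by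
    have := congrArg List.length hΔ
    simpa [Ctx.mapTy, Ctx.rename] using this.symm
  have hE : ∀ Δ Γ' : Ctx, Ctx.mapTy Ty.shift Γ' = Δ.rename r →
      Ctx.mapTy Ty.shift (List.zipWith (fun a b => (a.1, b.2)) Δ Γ') = Δ ∧
      Ctx.rename r (List.zipWith (fun a b => (a.1, b.2)) Δ Γ') = Γ' := by
    intro Δ
    induction Δ with
    | nil => intro Γ' h; cases Γ' with
      | nil => exact ⟨rfl, rfl⟩
      | cons a l => simp [Ctx.mapTy, Ctx.rename] at h
    | cons a Δ ih =>
      intro Γ' h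
      cases Γ' with
      | nil => simp [Ctx.mapTy, Ctx.rename] at h
      | cons b Γ' =>
        simp only [Ctx.mapTy, Ctx.rename, List.map_cons, List.cons.injEq, Prod.mk.injEq] at h
        have := ih Γ' h.2
        simp only [Ctx.mapTy, Ctx.rename] at this
        simp only [Ctx.mapTy, Ctx.rename, List.zipWith_cons_cons, List.map_cons, this, h.1]
        simp [← h.1.1]
  obtain ⟨hE₁, hE₂⟩ := hE Δ Γ' hΔ
  refine ⟨_, N, r, .allI (by rw [hE₁]; exact hN), ?_, rfl⟩
  rw [hE₂]
  exact (Multiset.coe_eq_coe.2 hΓ').symm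

theorem STyped.allE {G : Multiset (ℕ × Ty)} {M : Term} {B : LTy} (A : LTy)
    (h : STyped G M B.all.toTy) : STyped G M (B.inst A).toTy := by
  obtain ⟨Δ, N, r, hN, hG, rfl⟩ := h
  exact ⟨Δ, N, r, .allE A hN, hG, rfl⟩

/-- The sharing rule for `if` needs all three premises over literally one context. Distinct names
make it possible to return to `Typed` with the same list for each of them. -/
theorem STyped.cond {G : Multiset (ℕ × Ty)} {M N₀ N₁ : Term} {A : LTy}
    (hG : (G.map Prod.fst).Nodup) (hM : STyped G M LTy.bool.toTy) (h₀ : STyped G N₀ A.toTy)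
    (h₁ : STyped G N₁ A.toTy) : STyped G (.cond M N₀ N₁) A.toTy := by
  obtain ⟨Γ, rfl⟩ := Quot.exists_rep G
  have hΓ : (Ctx.dom Γ).Nodup := Multiset.coe_nodup.1 hG
  exact (Typed.boolE (hM.typed rfl hΓ) (h₀.typed rfl hΓ) (h₁.typed rfl hΓ)).styped

theorem STyped.of_eq {G H : Multiset (ℕ × Ty)} {M : Term} {σ : Ty} (h : STyped G M σ)
    (hG : G = H) : STyped H M σ := hG ▸ h

end STAB

/-! ### Types of the data encodings. -/

namespace STAB
open Term

/-! ### Typing in application-friendly form -/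

theorem STyped.app_arr {G H : Multiset (ℕ × Ty)} {M N : Term} {k : ℕ} {A C : LTy}
    (hM : STyped G M ⟨0, .arr k A C⟩) (hN : STyped H N ⟨k, A⟩) :
    STyped (G + H) (.app M N) ⟨0, C⟩ := STyped.app (σ := ⟨k, A⟩) hM hN

theorem STyped.abs_arr {G : Multiset (ℕ × Ty)} {M : Term} {k : ℕ} {A C : LTy} (x : ℕ)
    (hG : ∀ a ∈ G, a.1 ≠ x) (hM : x ∉ M.fv)
    (h : STyped ({(x, ⟨k, A⟩)} + G) (M.inst (fvar x)) ⟨0, C⟩) :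
    STyped G (.abs M) ⟨0, .arr k A C⟩ := STyped.abs (σ := ⟨k, A⟩) x hG hM h

theorem STyped.var_bang (x k : ℕ) (A : LTy) : STyped {(x, ⟨k, A⟩)} (fvar x) ⟨0, A⟩ := by
  have := STyped.derelict (G := 0) (by simpa using STyped.var x A) k
  simpa [Ty.bangN, LTy.toTy] using this

attribute [simp] LTy.shift LTy.subst

namespace LTy

@[simp] theorem subst_shift (S A : LTy) : ∀ j, subst j S (shift j A) = A := by
  induction A generalizing S with
  | bool => intro j; rfl
  | var i =>
    intro j
    by_cases h : i < j
    · simp [h]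
    · have h₁ : ¬ i + 1 < j := by omega
      have h₂ : i + 1 ≠ j := by omega
      simp [h, h₁, h₂]
  | arr k A C ih₁ ih₂ => intro j; simp [ih₁, ih₂]
  | all A ih => intro j; simp [ih]

/-- `A ⊸ ⋯ ⊸ A ⊸ A`, with `n` arguments. -/
def curried (n : ℕ) (A : LTy) : LTy := (arr 0 A)^[n] A

theorem curried_succ (n : ℕ) (A : LTy) : curried (n + 1) A = arr 0 A (curried n A) :=
  Function.iterate_succ_apply' _ _ _

@[simp] theorem shift_curried (c n : ℕ) (A : LTy) :
    shift c (curried n A) = curried n (shift c A) := by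
  induction n with
  | zero => rfl
  | succ n ih => simp [curried_succ, ih]

@[simp] theorem subst_curried (j n : ℕ) (S A : LTy) :
    subst j S (curried n A) = curried n (subst j S A) := by
  induction n with
  | zero => rfl
  | succ n ih => simp [curried_succ, ih]

/-- The type of the codes of the elements of a finite type. -/
noncomputable def enc (X : Type*) [Finite X] : LTy := .all (curried (Nat.card X) (.var 0))

section
variable {X : Type*} [Finite X]

@[simp] theorem shift_enc (c : ℕ) : shift c (enc X) = enc X := by simp [enc]

@[simp] theorem subst_enc (j : ℕ) (S : LTy) : subst j S (enc X) = enc X := by simp [enc]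

end

/-- `α ⊸ α`. -/
abbrev endo (A : LTy) : LTy := .arr 0 A A

end LTy

open LTy (curried curried_succ endo)

/-- All types of the context are invariant under shifting. -/
def ClosedTys (G : Multiset (ℕ × Ty)) : Prop := ∀ a ∈ G, a.2.shift = a.2

theorem STyped.allI_of_closed {G : Multiset (ℕ × Ty)} {M : Term} {A : LTy} (hG : ClosedTys G)
    (h : STyped G M ⟨0, A⟩) : STyped G M ⟨0, .all A⟩ := by
  refine STyped.allI ?_
  rw [Multiset.map_congr (g := id) rfl fun a ha => by simp [hG a ha], Multiset.map_id]
  exact h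

theorem STyped.natE {G : Multiset (ℕ × Ty)} {M : Term} {i : ℕ} (h : STyped G M ⟨0, natTy i⟩)
    (A : LTy) : STyped G M ⟨0, .arr i (endo A) (endo A)⟩ := by
  simpa [LTy.inst, LTy.toTy] using STyped.allE A h

theorem STyped.strE {G : Multiset (ℕ × Ty)} {M : Term} {i : ℕ} (h : STyped G M ⟨0, strTy i⟩)
    (A : LTy) : STyped G M ⟨0, .arr i (.arr 0 .bool (endo A)) (endo A)⟩ := by
  simpa [LTy.inst, LTy.toTy] using STyped.allE A h

theorem STyped.bool2E {G : Multiset (ℕ × Ty)} {M : Term} (h : STyped G M ⟨0, bool2Ty⟩)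
    (A : LTy) : STyped G M ⟨0, .arr 0 (.arr 0 .bool (.arr 0 .bool A)) A⟩ := by
  simpa [LTy.inst, LTy.toTy] using STyped.allE A h

/-! ### Typing of finite types -/

theorem STyped.constTm {G : Multiset (ℕ × Ty)} {M : Term} {A : LTy} (h : STyped G M ⟨0, A⟩)
    (n : ℕ) : STyped G (constTm n M) ⟨0, curried n A⟩ := by
  induction n with
  | zero => exact h
  | succ n ih =>
    rw [constTm_succ, curried_succ]
    obtain ⟨x, hx⟩ := ((G.map Prod.fst).toFinset ∪ M.fv).exists_notMem
    simp only [Finset.mem_union, Multiset.mem_toFinset, Multiset.mem_map, not_or,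
      not_exists, not_and] at hx
    refine .abs_arr x hx.1 (by simpa using hx.2) ?_
    have : (STAB.constTm n M).inst (fvar x) = STAB.constTm n M := ih.lc.instAt_eq _ _
    rw [this]
    exact ih.weak x A

theorem styped_sel (A : LTy) : ∀ {n i : ℕ}, i < n → STyped 0 (sel n i) ⟨0, curried n A⟩
  | n + 1, 0, _ => by
    rw [curried_succ]
    refine .abs_arr 0 (by simp) (by simp) ?_
    have := (STyped.var 0 A).constTm n
    simpa [inst, LTy.toTy] using this
  | n + 1, i + 1, h => by
    rw [curried_succ]
    have := styped_sel A (Nat.lt_of_succ_lt_succ h)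
    refine .abs_arr 0 (by simp) (by simp) ?_
    rw [inst, instAt_sel]
    exact this.weak 0 A

theorem STyped.apps {G : Multiset (ℕ × Ty)} {A : LTy} {Vs : List Term} : ∀ {M : Term},
    STyped G M ⟨0, curried Vs.length A⟩ → (∀ V ∈ Vs, STyped 0 V ⟨0, A⟩) →
    STyped G (M.apps Vs) ⟨0, A⟩ := by
  induction Vs with
  | nil => exact fun h _ => h
  | cons V Vs ih =>
    intro M h hV
    rw [List.length_cons, curried_succ] at h
    have := h.app_arr (hV V (by simp))
    rw [add_zero] at this
    exact ih this fun V h => hV V (by simp [h])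

section
variable {X : Type*} [Finite X]

theorem styped_enc (x : X) : STyped 0 (STAB.enc x) ⟨0, LTy.enc X⟩ :=
  .allI_of_closed (by simp [ClosedTys]) (styped_sel _ (Fin.is_lt _))

/-- The branches are passed as separate linear arguments, so they cannot share a context; requiring
them to be closed avoids the question. -/
theorem STyped.caseTm {G : Multiset (ℕ × Ty)} {v : Term} {N : X → Term} {A : LTy}
    (hv : STyped G v ⟨0, LTy.enc X⟩) (hN : ∀ x, STyped 0 (N x) ⟨0, A⟩) :
    STyped G (caseTm v N) ⟨0, A⟩ := by
  refine .apps ?_ (by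
    simp only [List.mem_ofFn, forall_exists_index, forall_apply_eq_imp_iff]
    exact fun i => hN _)
  simpa [LTy.inst, LTy.toTy] using STyped.allE A hv

end

/-! ### Pairs, strings and numerals -/

theorem num_eq (n : ℕ) : num n = abs (abs ((app (bvar 1))^[n] (bvar 0))) := by
  have : ∀ k : ℕ, closeAt 1 0 (closeAt 0 1 ((app (fvar 0))^[k] (fvar 1))) =
      (app (bvar 1))^[k] (bvar 0) := by
    intro k
    induction k with
    | zero => simp [closeAt]
    | succ k ih => simp only [Function.iterate_succ_apply', closeAt, ih]; simp [closeAt]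
  simp [num, lam, closeAt, this]

/-- `c b₀ (⋯ (c bₙ z))`. -/
def strBody (c z : Term) (w : List Bool) : Term :=
  w.foldr (fun b t => app (app c (.bool b)) t) z

theorem str_eq (w : List Bool) : str w = abs (abs (strBody (bvar 1) (bvar 0) w)) := by
  have : closeAt 1 0 (closeAt 0 1 (strBody (fvar 0) (fvar 1) w)) =
      strBody (bvar 1) (bvar 0) w := by
    induction w with
    | nil => simp [closeAt, strBody]
    | cons b w ih =>
      simp only [strBody, List.foldr_cons, closeAt] at ih ⊢
      simp [closeAt, ih]
  simp only [str, lam, closeAt]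
  exact congrArg (fun M => abs (abs M)) this

@[simp] theorem instAt_strBody {k : ℕ} {N c z : Term} {w : List Bool} :
    instAt k N (strBody c z w) = strBody (instAt k N c) (instAt k N z) w := by
  induction w with
  | nil => rfl
  | cons b w ih => simpa [strBody] using ih

@[simp] theorem lcAt_strBody {k : ℕ} {c z : Term} {w : List Bool} (hc : LCAt k c)
    (hz : LCAt k z) : LCAt k (strBody c z w) := by
  induction w with
  | nil => exact hz
  | cons b w ih => simpa [strBody, hc] using ih

@[simp] theorem notMem_fv_strBody {x : ℕ} {c z : Term} {w : List Bool} (hc : x ∉ c.fv)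
    (hz : x ∉ z.fv) : x ∉ (strBody c z w).fv := by
  induction w with
  | nil => exact hz
  | cons b w ih => simpa [strBody, hc] using ih

theorem lc_str (w : List Bool) : LC (str w) := by simp [str_eq]

theorem styped_str (w : List Bool) : STyped 0 (str w) ⟨0, strTy 1⟩ := by
  rw [str_eq]
  refine .allI_of_closed (by simp [ClosedTys]) ?_
  refine .abs_arr 0 (by simp) (by simp) (.abs_arr 1 (by simp) ?_ ?_)
  · simp
  · have h : ∀ w : List Bool, STyped (Multiset.replicate w.length
        (0, ⟨0, .arr 0 .bool (endo (.var 0))⟩) + {(1, ⟨0, .var 0⟩)})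
        (strBody (fvar 0) (fvar 1) w) ⟨0, .var 0⟩ := by
      intro w
      induction w with
      | nil => simpa [strBody, LTy.toTy] using STyped.var 1 (.var 0)
      | cons b w ih =>
        refine (((STyped.var 0 _).app_arr (STyped.bool b)).app_arr ih).of_eq ?_
        rw [List.length_cons, Multiset.replicate_succ, ← Multiset.singleton_add]
        simp only [LTy.toTy]
        abel
    have := STyped.contract 0 w.length (h w)
    convert this using 1
    · simp only [Ty.bang]; abel
    · simp [inst]

theorem len_eq : len = abs (abs (app (bvar 1) (abs (abs (app (bvar 2) (bvar 0)))))) := rfl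

theorem lc_len : LC len := by simp [len_eq]

theorem styped_len : STyped 0 len ⟨0, .arr 0 (strTy 1) (natTy 1)⟩ := by
  rw [len_eq]
  refine .abs_arr 0 (by simp) (by simp) (.allI_of_closed ?_ (.abs_arr 1 ?_ ?_ ?_))
  · simp [ClosedTys, Ty.shift, strTy]
  · simp
  · simp
  · have h : STyped {(1, ⟨0, endo (.var 0)⟩)} (abs (abs (app (fvar 1) (bvar 0))))
        ⟨0, .arr 0 .bool (endo (.var 0))⟩ := by
      refine .abs_arr 2 (by simp) (by simp) (.abs_arr 3 (by simp) (by simp) ?_)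
      have := ((STyped.var 1 (endo (.var 0))).app_arr (STyped.var 3 (.var 0))).weak 2 .bool
      convert this using 1
      · simp only [LTy.toTy]; abel
      · simp [inst]
    have := (STyped.strE (STyped.var 0 _) (.var 0)).app_arr (h.sp 1)
    convert this using 1
    · simp only [Ty.bangN, LTy.toTy, Multiset.map_singleton]; abel
    · simp [inst]

/-- The passage from input letters to tape cells: if `c` on a letter acts as `c'` on its code,
iterating over the string gives a list of cells. -/
theorem conv_strBody {c c' z : Term} {w : List Bool} {X : Type*} [Finite X] {g : Bool → X}
    (h : ∀ b t, Conv (app (app c (.bool b)) t) (app (app c' (STAB.enc (g b))) t)) :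
    Conv (strBody c z w) (cells c' (w.map g) z) := by
  induction w with
  | nil => exact .refl _
  | cons b w ih => exact (Conv.appR ih).trans (h _ _)

@[simp] theorem instAt_iterate_app {k : ℕ} {N u z : Term} {n : ℕ} :
    instAt k N ((app u)^[n] z) = (app (instAt k N u))^[n] (instAt k N z) := by
  induction n with
  | zero => rfl
  | succ n ih => simp only [Function.iterate_succ_apply', instAt, ih]

@[simp] theorem lcAt_iterate_app {k : ℕ} {u z : Term} {n : ℕ} (hu : LCAt k u) (hz : LCAt k z) :
    LCAt k ((app u)^[n] z) := by
  induction n with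
  | zero => exact hz
  | succ n ih => simp only [Function.iterate_succ_apply', lcAt_app, ih, hu, and_self]

@[simp] theorem notMem_fv_iterate_app {x : ℕ} {u z : Term} {n : ℕ} (hu : x ∉ u.fv)
    (hz : x ∉ z.fv) : x ∉ ((app u)^[n] z).fv := by
  induction n with
  | zero => exact hz
  | succ n ih => simp [Function.iterate_succ_apply', ih, hu]

theorem lc_num (n : ℕ) : LC (num n) := by simp [num_eq]

@[simp] theorem lcAt_num (k n : ℕ) : LCAt k (num n) := (lc_num n).lcAt k
@[simp] theorem instAt_num (k n : ℕ) (N : Term) : instAt k N (num n) = num n :=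
  (lc_num n).instAt_eq _ _
@[simp] theorem lcAt_str (k : ℕ) (w : List Bool) : LCAt k (str w) := (lc_str w).lcAt k
@[simp] theorem instAt_str (k : ℕ) (w : List Bool) (N : Term) : instAt k N (str w) = str w :=
  (lc_str w).instAt_eq _ _
@[simp] theorem lcAt_len (k : ℕ) : LCAt k len := lc_len.lcAt k
@[simp] theorem instAt_len (k : ℕ) (N : Term) : instAt k N len = len := lc_len.instAt_eq _ _
@[simp] theorem fv_len : len.fv = ∅ := by simp [len_eq]

theorem conv_num_app {u z : Term} (n : ℕ) (hu : LC u) (hz : LC z) :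
    Conv (app (app (num n) u) z) ((app u)^[n] z) := by
  rw [num_eq]
  refine (Conv.beta₂ (by simp) hu hz).trans (.of_eq ?_)
  simp [hu.instAt_eq]

theorem conv_str_app {c z : Term} (w : List Bool) (hc : LC c) (hz : LC z) :
    Conv (app (app (str w) c) z) (strBody c z w) := by
  rw [str_eq]
  refine (Conv.beta₂ (by simp) hc hz).trans (.of_eq ?_)
  simp [hc.instAt_eq]

theorem conv_len_str (w : List Bool) : Conv (app len (str w)) (num w.length) := by
  rw [len_eq, num_eq]
  refine (Conv.beta (by simp) (lc_str w)).trans ?_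
  refine .abs 0 (by simp [str_eq]) (by simp) ?_
  simp only [inst, instAt]
  simp
  rw [str_eq]
  refine (Conv.beta (by simp) (by simp)).trans ?_
  simp
  refine .abs 1 (by simp) (by simp) ?_
  simp [inst]
  induction w with
  | nil => exact .refl _
  | cons b w ih =>
    simp only [strBody, List.foldr_cons, List.length_cons, Function.iterate_succ_apply']
    refine (Conv.beta₂ (by simp) (by simp) ?_).trans ?_
    · exact lcAt_strBody (by simp) (by simp)
    · simpa [strBody] using Conv.appR ih

end STAB

/-! ### Polynomial clocks and encoded configurations. -/

namespace STAB
open Term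
open LTy (curried curried_succ endo)

/-! ### Polynomials -/

/-- `ν (ν (⋯ (ν u)))`, with `i` occurrences of `ν`. -/
def monoTm (ν u : Term) (i : ℕ) : Term := (app ν)^[i] u

/-- `νⁱ⁰u (νⁱ¹u (⋯ z))`, for a list of exponents `i₀, i₁, …`. -/
def chain (ν u : Term) (es : List ℕ) (z : Term) : Term :=
  es.foldr (fun i t => app (monoTm ν u i) t) z

theorem chain_cons (ν u z : Term) (i : ℕ) (es : List ℕ) :
    chain ν u (i :: es) z = app (monoTm ν u i) (chain ν u es z) := rfl

@[simp] theorem instAt_chain {k : ℕ} {N ν u z : Term} {es : List ℕ} :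
    instAt k N (chain ν u es z) = chain (instAt k N ν) (instAt k N u) es (instAt k N z) := by
  induction es with
  | nil => rfl
  | cons i es ih => simp [chain_cons, monoTm, ih]

@[simp] theorem lcAt_chain {k : ℕ} {ν u z : Term} {es : List ℕ} (hν : LCAt k ν) (hu : LCAt k u)
    (hz : LCAt k z) : LCAt k (chain ν u es z) := by
  induction es with
  | nil => exact hz
  | cons i es ih => simp [chain_cons, monoTm, ih, hν, hu]

@[simp] theorem notMem_fv_chain {x : ℕ} {ν u z : Term} {es : List ℕ} (hν : x ∉ ν.fv)
    (hu : x ∉ u.fv) (hz : x ∉ z.fv) : x ∉ (chain ν u es z).fv := by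
  induction es with
  | nil => exact hz
  | cons i es ih => simp [chain_cons, monoTm, ih, hν, hu]

theorem conv_iterate_app {u v : Term} {m : ℕ} (hu : LC u)
    (h : ∀ z, LC z → Conv (app v z) ((app u)^[m] z)) {z : Term} (hz : LC z) (n : ℕ) :
    Conv ((app v)^[n] z) ((app u)^[m * n] z) := by
  induction n with
  | zero => exact .refl _
  | succ n ih =>
    rw [Function.iterate_succ_apply', Nat.mul_succ, Nat.add_comm, Function.iterate_add_apply]
    exact (Conv.appR ih).trans (h _ (lcAt_iterate_app hu hz))

/-- Iterating `n` times an `n ^ i`-fold iterate gives an `n ^ (i + 1)`-fold one. -/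
theorem conv_monoTm {ν u : Term} {n : ℕ} (hν : LC ν) (hu : LC u) (h : Conv ν (num n)) (i : ℕ) :
    ∀ z, LC z → Conv (app (monoTm ν u i) z) ((app u)^[n ^ i] z) := by
  induction i with
  | zero => intro z _; exact .refl _
  | succ i ih =>
    intro z hz
    rw [monoTm, Function.iterate_succ_apply']
    exact (Conv.appL (Conv.appL h)).trans
      ((conv_num_app n (lcAt_iterate_app hν hu) hz).trans (conv_iterate_app hu ih hz n))

theorem conv_chain {ν u z : Term} {n : ℕ} (hν : LC ν) (hu : LC u) (hz : LC z)
    (h : Conv ν (num n)) (es : List ℕ) :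
    Conv (chain ν u es z) ((app u)^[(es.map (n ^ ·)).sum] z) := by
  induction es with
  | nil => exact .refl _
  | cons i es ih =>
    rw [List.map_cons, List.sum_cons, Function.iterate_add_apply, chain_cons]
    exact (Conv.appR ih).trans (conv_monoTm hν hu h i _ (lcAt_iterate_app hu hz))

/-- Each numeral takes its argument under one bang. The innermost of `i` nested copies of `ν` thus
lies under `i - 1` bangs and `u` under `i`, whence the bounds on `j` and `l`. The lesser levels are
raised by dereliction so that all copies can be contracted together. -/
theorem styped_monoTm {x y : ℕ} {S Y A : LTy} {ν u : Term}
    (hν : STyped {(x, ⟨0, S⟩)} ν ⟨0, natTy 1⟩) (hu : STyped {(y, ⟨0, Y⟩)} u ⟨0, endo A⟩) (i : ℕ) :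
    ∀ {j l : ℕ}, i ≤ j + 1 → i ≤ l →
      STyped (Multiset.replicate i (x, ⟨j, S⟩) + {(y, ⟨l, Y⟩)}) (monoTm ν u i) ⟨0, endo A⟩ := by
  induction i with
  | zero =>
    intro j l _ _
    have := STyped.derelict (G := 0) (by simpa using hu) l
    simpa [Ty.bangN, monoTm] using this
  | succ i ih =>
    intro j l hj hl
    have h₁ := STyped.derelict (G := 0) (by simpa using hν) j
    have h₂ := (ih (j := j - 1) (l := l - 1) (by omega) (by omega)).sp 1
    rw [monoTm, Function.iterate_succ_apply']
    have h₃ := (h₁.natE A).app_arr (N := monoTm ν u i) (by simpa [Ty.bangN] using h₂)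
    refine h₃.of_eq ?_
    -- The truncated `l - 1` is genuine as `l` is positive. For `j` this may fail when `i = 0`, but
    -- then no inner copy of `ν` exists.
    have hl' : l - 1 + 1 = l := by omega
    rcases Nat.eq_zero_or_pos i with rfl | hi
    · simp [Ty.bangN, hl']
    · have hj' : j - 1 + 1 = j := by omega
      simp only [Ty.bangN, zero_add, add_zero,
        hl', hj', Multiset.replicate_succ, ← Multiset.singleton_add]
      abel

theorem styped_chain {x y : ℕ} {S Y A : LTy} {ν u z : Term} {H : Multiset (ℕ × Ty)} {j l : ℕ}
    (hν : STyped {(x, ⟨0, S⟩)} ν ⟨0, natTy 1⟩) (hu : STyped {(y, ⟨0, Y⟩)} u ⟨0, endo A⟩)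
    (hz : STyped H z ⟨0, A⟩) {es : List ℕ} (hes : ∀ i ∈ es, i ≤ j + 1 ∧ i ≤ l) :
    STyped (Multiset.replicate es.sum (x, ⟨j, S⟩) + Multiset.replicate es.length (y, ⟨l, Y⟩) + H)
      (chain ν u es z) ⟨0, A⟩ := by
  induction es with
  | nil => simpa [chain] using hz
  | cons i es ih =>
    have hi := hes i (by simp)
    refine ((styped_monoTm hν hu i hi.1 hi.2).app_arr
      (ih fun i h => hes i (by simp [h]))).of_eq ?_
    rw [List.sum_cons, List.length_cons, Multiset.replicate_add, Multiset.replicate_succ,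
      ← Multiset.singleton_add]
    abel

/-- The term computing a polynomial given by its list of exponents. -/
def polyTm (es : List ℕ) : Term := abs (abs (abs (chain (bvar 2) (bvar 1) es (bvar 0))))

theorem styped_polyTm {es : List ℕ} {d : ℕ} (hes : ∀ i ∈ es, i ≤ d) :
    STyped 0 (polyTm es) ⟨0, .arr d (natTy 1) (natTy (2 * d + 1))⟩ := by
  refine .abs_arr 0 (by simp) ?_ (.allI_of_closed ?_
    (.abs_arr 1 ?_ ?_ (.abs_arr 2 ?_ ?_ ?_)))
  · simp
  · simp [ClosedTys, Ty.shift, natTy]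
  · simp
  · simp
  · simp
  · simp
  -- Contracting the copies costs one more bang, turning `d - 1` and `2 * d` into the levels `d` and
  -- `2 * d + 1` of the required type.
  have h := styped_chain (j := d - 1) (l := 2 * d) (STyped.var 0 (natTy 1))
    (STyped.var 1 (endo (.var 0))) (STyped.var 2 (.var 0)) (es := es)
    fun i hi => by have := hes i hi; omega
  have h₁ : STyped ({(1, ⟨2 * d + 1, endo (.var 0)⟩)} +
      (Multiset.replicate es.sum (0, ⟨d - 1, natTy 1⟩) + {(2, ⟨0, .var 0⟩)}))
      (chain (fvar 0) (fvar 1) es (fvar 2)) ⟨0, .var 0⟩ :=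
    STyped.contract 1 es.length (σ := ⟨2 * d, endo (.var 0)⟩) (h.of_eq (by
      simp only [LTy.toTy]; abel))
  have h₂ : STyped ({(0, ⟨d, natTy 1⟩)} +
      ({(1, ⟨2 * d + 1, endo (.var 0)⟩)} + {(2, ⟨0, .var 0⟩)}))
      (chain (fvar 0) (fvar 1) es (fvar 2)) ⟨0, .var 0⟩ := by
    rcases Nat.eq_zero_or_pos d with rfl | hd
    · have hs : es.sum = 0 := List.sum_eq_zero fun i hi => Nat.le_zero.1 (hes i hi)
      rw [hs] at h₁
      exact STyped.weak (by simpa using h₁) 0 (natTy 1)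
    · have := STyped.contract 0 es.sum (σ := ⟨d - 1, natTy 1⟩) (G := {(1,
        ⟨2 * d + 1, endo (.var 0)⟩)} + {(2, ⟨0, .var 0⟩)}) (h₁.of_eq (by abel))
      rwa [Ty.bang, Nat.sub_add_cancel hd] at this
  convert h₂ using 1
  · abel
  · simp [inst]

theorem conv_polyTm (es : List ℕ) (n : ℕ) :
    Conv (app (polyTm es) (num n)) (num (es.map (n ^ ·)).sum) := by
  rw [num_eq (es.map _).sum]
  refine (Conv.beta (by simp) (by simp)).trans ?_
  simp
  refine .abs 0 ?_ (by simp) ?_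
  · have : 0 ∉ (num n).fv := by simp [num_eq]
    simp [this]
  refine .abs 1 ?_ (by simp) ?_
  · have : 1 ∉ (num n).fv := by simp [num_eq]
    simp [this]
  simp [inst]
  exact conv_chain (by simp) (by simp) (by simp) (.refl _) es

theorem exists_exponents (p : Polynomial ℕ) : ∃ es : List ℕ, (∀ i ∈ es, i ≤ p.natDegree) ∧
    ∀ n, (es.map (n ^ ·)).sum = p.eval n := by
  -- Each monomial is repeated as often as its coefficient says.
  refine ⟨(List.range (p.natDegree + 1)).flatMap fun i => List.replicate (p.coeff i) i, ?_, ?_⟩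
  · simp only [List.mem_flatMap, List.mem_range, List.mem_replicate]
    rintro i ⟨j, hj, -, rfl⟩
    omega
  · intro n
    rw [Polynomial.eval_eq_sum_range]
    generalize p.natDegree + 1 = m
    induction m with
    | zero => simp
    | succ m ih =>
      rw [List.range_succ, List.flatMap_append, List.map_append, List.sum_append, ih,
        Finset.sum_range_succ]
      simp

/-! ### Configurations -/

section Config
variable {Q Γ : Type*} [Finite Q] [Finite Γ]

/-- The configuration with state `q`, the cells `L` to the left of the head, the nearest first,
and the cells `R` from the head on: `λf.λk.k (λz.f l₀ (f l₁ ⋯)) (λz.f r₀ (f r₁ ⋯)) q`. -/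
noncomputable def cfgTm (L R : List Γ) (q : Q) : Term :=
  abs (abs (app (app (app (bvar 0) (abs (cells (bvar 2) L (bvar 0))))
    (abs (cells (bvar 2) R (bvar 0)))) (enc q)))

variable (Q Γ) in
/-- The instances of the type of configurations. -/
noncomputable def cfgBody (m : ℕ) (A B : LTy) : LTy :=
  .arr m (.arr 0 (LTy.enc Γ) (endo A))
    (.arr 0 (.arr 0 (endo A) (.arr 0 (endo A) (.arr 0 (LTy.enc Q) B))) B)

variable (Q Γ) in
/-- The type of configurations. -/
noncomputable def cfgTy (m : ℕ) : LTy := .all (.all (cfgBody Q Γ m (.var 1) (.var 0)))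

@[simp] theorem shift_cfgTy (c m : ℕ) : (cfgTy Q Γ m).shift c = cfgTy Q Γ m := by
  simp [cfgTy, cfgBody]

theorem STyped.cfgE {G : Multiset (ℕ × Ty)} {t : Term} {m : ℕ} (h : STyped G t ⟨0, cfgTy Q Γ m⟩)
    (A B : LTy) : STyped G t ⟨0, cfgBody Q Γ m A B⟩ := by
  have := STyped.allE A h
  simp only [LTy.inst, LTy.subst] at this
  have := STyped.allE B this
  simpa [LTy.inst, LTy.toTy, cfgBody] using this

theorem STyped.cfgI {G : Multiset (ℕ × Ty)} {t : Term} {m : ℕ} (hG : ClosedTys G)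
    (h : STyped G t ⟨0, cfgBody Q Γ m (.var 1) (.var 0)⟩) : STyped G t ⟨0, cfgTy Q Γ m⟩ :=
  .allI_of_closed hG (.allI_of_closed hG h)

@[simp] theorem lcAt_cfgTm (k : ℕ) (L R : List Γ) (q : Q) : LCAt k (cfgTm L R q) := by
  simp [cfgTm]

@[simp] theorem instAt_cfgTm (k : ℕ) (N : Term) (L R : List Γ) (q : Q) :
    instAt k N (cfgTm L R q) = cfgTm L R q := LC.instAt_eq (lcAt_cfgTm 0 L R q) _ _

theorem conv_cfgTm_app (L R : List Γ) (q : Q) {f k : Term} (hf : LC f) (hk : LC k) :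
    Conv (app (app (cfgTm L R q) f) k)
      (app (app (app k (abs (cells f L (bvar 0)))) (abs (cells f R (bvar 0)))) (enc q)) := by
  refine (Conv.beta₂ (by simp) hf hk).trans (.of_eq ?_)
  simp [hf.instAt_eq]

/-! ### The kind of a configuration -/

@[simp] theorem lcAt_code (k : ℕ) (κ : Kind) : LCAt k κ.code := by
  cases κ <;> simp [Kind.code, pair]

@[simp] theorem instAt_code (k : ℕ) (N : Term) (κ : Kind) : instAt k N κ.code = κ.code :=
  LC.instAt_eq (lcAt_code 0 κ) _ _

@[simp] theorem fv_code (κ : Kind) : κ.code.fv = ∅ := by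
  cases κ <;> simp [Kind.code, pair]

theorem styped_pair {G H : Multiset (ℕ × Ty)} {M N : Term} {x : ℕ}
    (hx : ∀ a ∈ G + H, a.1 ≠ x) (hxM : x ∉ M.fv) (hxN : x ∉ N.fv) (hGH : ClosedTys (G + H))
    (hM : STyped G M ⟨0, .bool⟩) (hN : STyped H N ⟨0, .bool⟩) :
    STyped (G + H) (pair M N) ⟨0, bool2Ty⟩ := by
  refine .allI_of_closed hGH (.abs_arr x hx (by simp [hxM, hxN]) ?_)
  have := ((STyped.var x (.arr 0 .bool (.arr 0 .bool (.var 0)))).app_arr hM).app_arr hN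
  convert this using 1
  · simp only [LTy.toTy]; abel
  · simp [inst, hM.lc.instAt_eq, hN.lc.instAt_eq]

theorem styped_code (κ : Kind) : STyped 0 κ.code ⟨0, bool2Ty⟩ := by
  cases κ <;> exact styped_pair (x := 0) (G := 0) (H := 0) (by simp) (by simp) (by simp)
    (by simp [ClosedTys]) (.bool _) (.bool _)

/-- The kind of the state of a configuration. -/
noncomputable def kindTm (M : ATM Q Γ) : Term :=
  abs (app (app (bvar 0) (abs (abs (bvar 0))))
    (abs (abs (abs (caseTm (bvar 0) fun q => (M.kind q).code)))))

/-- The tape is not needed, so its type variable is instantiated by booleans and the constructor by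
the map that ignores its cell. -/
theorem styped_kindTm (M : ATM Q Γ) (m : ℕ) :
    STyped 0 (kindTm M) ⟨0, .arr 0 (cfgTy Q Γ m) bool2Ty⟩ := by
  refine .abs_arr 0 (by simp) (by simp [fv_caseTm]) ?_
  have h₁ : STyped 0 (abs (abs (bvar 0))) ⟨0, .arr 0 (LTy.enc Γ) (endo .bool)⟩ := by
    refine .abs_arr 1 (by simp) (by simp) (.abs_arr 2 (by simp) (by simp) ?_)
    convert (STyped.var 2 .bool).weak 1 (LTy.enc Γ) using 1
    · simp only [LTy.toTy]; abel
    · simp [inst]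
    · rfl
  have h₂ : STyped 0 (abs (abs (abs (caseTm (bvar 0) fun q => (M.kind q).code))))
      ⟨0, .arr 0 (endo .bool) (.arr 0 (endo .bool) (.arr 0 (LTy.enc Q) bool2Ty))⟩ := by
    refine .abs_arr 1 (by simp) (by simp [fv_caseTm]) (.abs_arr 2 (by simp) (by simp [fv_caseTm])
      (.abs_arr 3 (by simp) (by simp [fv_caseTm]) ?_))
    have := ((STyped.caseTm (STyped.var 3 (LTy.enc Q)) fun q => styped_code (M.kind q)).weak 1
      (endo .bool)).weak 2 (endo .bool)
    convert this using 1
    · simp only [LTy.toTy]; abel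
    · simp [inst]
  have := (((STyped.var 0 (cfgTy Q Γ m)).cfgE .bool bool2Ty).app_arr
    (by simpa [Ty.bangN] using h₁.sp_nil m)).app_arr h₂
  convert this using 1
  · simp only [LTy.toTy]; abel
  · simp [inst]

theorem conv_kindTm (M : ATM Q Γ) (L R : List Γ) (q : Q) :
    Conv (app (kindTm M) (cfgTm L R q)) (M.kind q).code := by
  refine (Conv.beta (by simp) (by simp)).trans ?_
  simp
  refine (conv_cfgTm_app L R q (by simp) (by simp)).trans ?_
  refine (Conv.beta₃ (by simp) (by simp) (by simp) (by simp)).trans ?_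
  simpa using conv_caseTm q fun q => lcAt_code 0 (M.kind q)

end Config
end STAB

namespace STAB
open Term
open LTy (curried curried_succ endo)

section Transition
variable {Q Γ : Type*} [Finite Q] [Finite Γ]

/-! ### Transitions -/

/-- The function of the two decomposed half tapes and of a continuation `k` which passes to `k` the
configuration obtained by writing `g`, moving the head and entering the state `q`. -/
noncomputable def actTm (q : Q) (g : Γ) : Turing.Dir → Term
  | .right => abs (abs (abs (abs (abs (abs (app (app (app (bvar 0)
      (abs (app (app (bvar 2) (enc g)) (app (app (bvar 5) (bvar 4)) (app (bvar 6) (bvar 0))))))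
      (bvar 2)) (enc q)))))))
  | .left => abs (abs (abs (abs (abs (abs (app (app (app (bvar 0) (bvar 5))
      (abs (app (app (bvar 5) (bvar 4)) (app (app (bvar 2) (enc g)) (app (bvar 3) (bvar 0))))))
      (enc q)))))))

@[simp] theorem lcAt_actTm (k : ℕ) (q : Q) (g : Γ) (D : Turing.Dir) : LCAt k (actTm q g D) := by
  cases D <;> simp [actTm]

@[simp] theorem instAt_actTm (k : ℕ) (N : Term) (q : Q) (g : Γ) (D : Turing.Dir) :
    instAt k N (actTm q g D) = actTm q g D := LC.instAt_eq (lcAt_actTm 0 q g D) _ _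

@[simp] theorem fv_actTm (q : Q) (g : Γ) (D : Turing.Dir) : (actTm q g D).fv = ∅ := by
  cases D <;> simp [actTm]

variable (Γ) in
/-- `Sym ⊸ A ⊸ A`. -/
noncomputable abbrev consTy (A : LTy) : LTy := .arr 0 (LTy.enc Γ) (endo A)

variable (Q) in
/-- `(A ⊸ A) ⊸ (A ⊸ A) ⊸ St ⊸ B`. -/
noncomputable abbrev contTy (A B : LTy) : LTy :=
  .arr 0 (endo A) (.arr 0 (endo A) (.arr 0 (LTy.enc Q) B))

theorem styped_actTm (q : Q) (g : Γ) (D : Turing.Dir) (A B : LTy) :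
    STyped 0 (actTm q g D) ⟨0, .arr 0 (endo A) (.arr 0 (consTy Γ A) (.arr 0 (LTy.enc Γ)
      (.arr 0 (endo A) (.arr 0 (consTy Γ A) (.arr 0 (contTy Q A B) B)))))⟩ := by
  cases D
  · refine .abs_arr 0 (by simp) (by simp) (.abs_arr 1 (by simp) (by simp) (.abs_arr 2 (by simp)
      (by simp) (.abs_arr 3 (by simp) (by simp) (.abs_arr 4 (by simp) (by simp) (.abs_arr 5
      (by simp) (by simp) ?_)))))
    have h : STyped ({(1, ⟨0, consTy Γ A⟩)} + {(2, ⟨0, LTy.enc Γ⟩)} + {(3, ⟨0, endo A⟩)} +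
        {(4, ⟨0, consTy Γ A⟩)}) (abs (app (app (fvar 1) (fvar 2))
          (app (app (fvar 4) (enc g)) (app (fvar 3) (bvar 0))))) ⟨0, endo A⟩ := by
      refine .abs_arr 6 (by simp) (by simp) ?_
      have := ((STyped.var 1 (consTy Γ A)).app_arr (STyped.var 2 (LTy.enc Γ))).app_arr
        (((STyped.var 4 (consTy Γ A)).app_arr (styped_enc g)).app_arr
          ((STyped.var 3 (endo A)).app_arr (STyped.var 6 A)))
      convert this using 1
      · simp only [LTy.toTy]; abel
      · simp [inst]
    have := (((STyped.var 5 (contTy Q A B)).app_arr (STyped.var 0 (endo A))).app_arr h).app_arr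
      (styped_enc q)
    convert this using 1
    · simp only [LTy.toTy]; abel
    · simp [inst]
  · refine .abs_arr 0 (by simp) (by simp) (.abs_arr 1 (by simp) (by simp) (.abs_arr 2 (by simp)
      (by simp) (.abs_arr 3 (by simp) (by simp) (.abs_arr 4 (by simp) (by simp) (.abs_arr 5
      (by simp) (by simp) ?_)))))
    have h : STyped ({(1, ⟨0, consTy Γ A⟩)} + {(2, ⟨0, LTy.enc Γ⟩)} + {(0, ⟨0, endo A⟩)} +
        {(4, ⟨0, consTy Γ A⟩)}) (abs (app (app (fvar 4) (enc g))
          (app (app (fvar 1) (fvar 2)) (app (fvar 0) (bvar 0))))) ⟨0, endo A⟩ := by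
      refine .abs_arr 6 (by simp) (by simp) ?_
      have := ((STyped.var 4 (consTy Γ A)).app_arr (styped_enc g)).app_arr
        (((STyped.var 1 (consTy Γ A)).app_arr (STyped.var 2 (LTy.enc Γ))).app_arr
          ((STyped.var 0 (endo A)).app_arr (STyped.var 6 A)))
      convert this using 1
      · simp only [LTy.toTy]; abel
      · simp [inst]
    have := (((STyped.var 5 (contTy Q A B)).app_arr h).app_arr (STyped.var 3 (endo A))).app_arr
      (styped_enc q)
    convert this using 1
    · simp only [LTy.toTy]; abel
    · simp [inst]

/-! ### Typing of split lists. -/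

variable (Γ) in
/-- The type `∀γ.((α ⊸ α) ⊸ (Sym ⊸ α ⊸ α) ⊸ Sym ⊸ γ) ⊸ γ` of decomposed lists, where `α` is the
type variable `i`. -/
noncomputable def popTy (i : ℕ) : LTy :=
  .all (.arr 0 (.arr 0 (endo (.var (i + 1))) (.arr 0 (consTy Γ (.var (i + 1)))
    (.arr 0 (LTy.enc Γ) (.var 0)))) (.var 0))

@[simp] theorem shift_popTy (i : ℕ) : (popTy Γ i).shift 0 = popTy Γ (i + 1) := by
  simp [popTy]

theorem STyped.popE {G : Multiset (ℕ × Ty)} {t : Term} {i : ℕ} (h : STyped G t ⟨0, popTy Γ i⟩)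
    (B : LTy) : STyped G t ⟨0, .arr 0 (.arr 0 (endo (.var i)) (.arr 0 (consTy Γ (.var i))
      (.arr 0 (LTy.enc Γ) B))) B⟩ := by
  simpa [LTy.inst, LTy.toTy] using STyped.allE B h

theorem styped_popNil (d : Γ) (i : ℕ) : STyped 0 (popNil (enc d)) ⟨0, popTy Γ i⟩ := by
  refine .allI_of_closed (by simp [ClosedTys]) (.abs_arr 0 (by simp) (by simp) ?_)
  have h₁ : ∀ A, STyped 0 (abs (bvar 0)) ⟨0, endo A⟩ := fun A =>
    .abs_arr 0 (by simp) (by simp) (by simpa [inst, LTy.toTy] using STyped.var 0 A)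
  have h₂ : STyped 0 (abs (abs (bvar 0))) ⟨0, consTy Γ (.var (i + 1))⟩ :=
    .abs_arr 1 (by simp) (by simp) ((h₁ _).weak 1 _)
  have := (((STyped.var 0 (.arr 0 (endo (.var (i + 1))) (.arr 0 (consTy Γ (.var (i + 1)))
    (.arr 0 (LTy.enc Γ) (.var 0))))).app_arr (h₁ _)).app_arr h₂).app_arr (styped_enc d)
  convert this using 1
  · simp [LTy.toTy]
  · simp [inst]

/-- The constructor occurs once, at level zero, so `popStep f` can be promoted as often as desired
with `f` receiving just as many bangs. This is why a transition keeps the type of configurations. -/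
theorem styped_popStep (f i : ℕ) (hf : 6 < f) : STyped {(f, ⟨0, consTy Γ (.var i)⟩)}
    (popStep (fvar f)) ⟨0, .arr 0 (LTy.enc Γ) (endo (popTy Γ i))⟩ := by
  refine .abs_arr 0 ?_ ?_ (.abs_arr 1 ?_ ?_ (.allI (.abs_arr 2 ?_ ?_ ?_)))
  any_goals first | (simp; done) | (simp; omega)
  have h₁ : STyped ({(4, ⟨0, consTy Γ (.var (i + 1))⟩)} + {(5, ⟨0, LTy.enc Γ⟩)} +
      {(3, ⟨0, endo (.var (i + 1))⟩)})
      (abs (app (app (fvar 4) (fvar 5)) (app (fvar 3) (bvar 0)))) ⟨0, endo (.var (i + 1))⟩ := by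
    refine .abs_arr 6 (by simp) (by simp) ?_
    have := ((STyped.var 4 (consTy Γ (.var (i + 1)))).app_arr (STyped.var 5 (LTy.enc Γ))).app_arr
      ((STyped.var 3 (endo (.var (i + 1)))).app_arr (STyped.var 6 (.var (i + 1))))
    convert this using 1
    · simp only [LTy.toTy]; abel
    · simp [inst]
  have h₂ := (((STyped.var 2 (.arr 0 (endo (.var (i + 1))) (.arr 0 (consTy Γ (.var (i + 1)))
    (.arr 0 (LTy.enc Γ) (.var 0))))).app_arr h₁).app_arr
      (STyped.var f (consTy Γ (.var (i + 1))))).app_arr (STyped.var 0 (LTy.enc Γ))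
  have h₃ : STyped ({(0, ⟨0, LTy.enc Γ⟩)} + {(f, ⟨0, consTy Γ (.var (i + 1))⟩)} +
      {(2, ⟨0, .arr 0 (endo (.var (i + 1))) (.arr 0 (consTy Γ (.var (i + 1)))
        (.arr 0 (LTy.enc Γ) (.var 0)))⟩)})
      (abs (abs (abs (app (app (app (fvar 2) (abs (app (app (bvar 2) (bvar 1))
        (app (bvar 3) (bvar 0))))) (fvar f)) (fvar 0)))))
      ⟨0, .arr 0 (endo (.var (i + 1))) (.arr 0 (consTy Γ (.var (i + 1)))
        (.arr 0 (LTy.enc Γ) (.var 0)))⟩ := by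
    refine .abs_arr 3 ?_ ?_ (.abs_arr 4 ?_ ?_ (.abs_arr 5 ?_ ?_ ?_))
    any_goals first | (simp; done) | (simp; omega)
    convert h₂ using 1
    · simp only [LTy.toTy]; abel
    · simp [inst]
  have h₄ := ((STyped.var 1 (popTy Γ (i + 1))).popE (.var 0)).app_arr h₃
  convert h₄ using 1
  · simp [LTy.toTy, Ty.shift, -Multiset.singleton_add]; abel
  · simp [inst]

/-! ### Assembling and verifying a transition. -/

/-- Case distinction over the state `q` and the scanned symbol `b`. -/
noncomputable def actionTm (δ : Q → Γ → Q × Γ × Turing.Dir) (q b : Term) : Term :=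
  -- The symbol is applied after the choice of the state, so that the branches are closed and `b` is
  -- used once.
  app (caseTm q fun q => abs (caseTm (bvar 0) fun g : Γ =>
    actTm (δ q g).1 (δ q g).2.1 (δ q g).2.2)) b

/-- `λL.λR.λq.⋯`, with `k` for the continuation. -/
noncomputable def moveTm [Inhabited Γ] (δ : Q → Γ → Q × Γ × Turing.Dir) (k : Term) : Term :=
  abs (abs (abs (app (app (bvar 2) (popNil (enc (default : Γ))))
    (abs (abs (abs (app (app (bvar 4) (popNil (enc (default : Γ))))
      (abs (abs (abs (app (app (app (app (app (app
        (actionTm δ (bvar 6) (bvar 0)) (bvar 5)) (bvar 4)) (bvar 3)) (bvar 2)) (bvar 1))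
        k)))))))))))

/-- The transition function `δ`: `λt.λf.λk.t (popStep f) (λL.λR.λq.⋯)`. -/
noncomputable def trTm [Inhabited Γ] (δ : Q → Γ → Q × Γ × Turing.Dir) : Term :=
  -- Parameters are inserted without shifting: `f` has index 1 and sits under six binders of
  -- `popStep`, `k` has index 0 and sits under nine of `moveTm`.
  abs (abs (abs (app (app (bvar 2) (popStep (bvar 7))) (moveTm δ (bvar 9)))))

@[simp] theorem instAt_actionTm (δ : Q → Γ → Q × Γ × Turing.Dir) (k : ℕ) (N q b : Term) :
    instAt k N (actionTm δ q b) = actionTm δ (instAt k N q) (instAt k N b) := by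
  simp [actionTm]

@[simp] theorem lcAt_actionTm (δ : Q → Γ → Q × Γ × Turing.Dir) (k : ℕ) (q b : Term) :
    LCAt k (actionTm δ q b) ↔ LCAt k q ∧ LCAt k b := by
  simp [actionTm]

@[simp] theorem fv_actionTm (δ : Q → Γ → Q × Γ × Turing.Dir) (q b : Term) :
    (actionTm δ q b).fv = q.fv ∪ b.fv := by
  simp [actionTm, fv_caseTm]

theorem conv_actionTm (δ : Q → Γ → Q × Γ × Turing.Dir) (q : Q) (g : Γ) :
    Conv (actionTm δ (enc q) (enc g)) (actTm (δ q g).1 (δ q g).2.1 (δ q g).2.2) := by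
  refine (Conv.appL (conv_caseTm q fun q => by simp)).trans ?_
  refine (Conv.beta (by simp) (by simp)).trans ?_
  simpa using conv_caseTm g fun g => lcAt_actTm 0 _ _ _

@[simp] theorem fv_popNil (b : Term) : (popNil b).fv = b.fv := by
  simp [popNil, popVal]

@[simp] theorem fv_popStep (f : Term) : (popStep f).fv = f.fv := by
  simp [popStep]

@[simp] theorem lcAt_popNil (k : ℕ) (d : Γ) : LCAt k (popNil (enc d)) := by
  simp [popNil, popVal]

@[simp] theorem instAt_popNil (k : ℕ) (N : Term) (d : Γ) :
    instAt k N (popNil (enc d)) = popNil (enc d) := LC.instAt_eq (lcAt_popNil 0 d) _ _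

@[simp] theorem instAt_popStep (k : ℕ) (N f : Term) :
    instAt k N (popStep f) = popStep (instAt (k + 6) N f) := by
  simp [popStep]

theorem styped_actionTm (δ : Q → Γ → Q × Γ × Turing.Dir) (q b : ℕ) (A B : LTy) :
    STyped ({(q, ⟨0, LTy.enc Q⟩)} + {(b, ⟨0, LTy.enc Γ⟩)}) (actionTm δ (fvar q) (fvar b))
      ⟨0, .arr 0 (endo A) (.arr 0 (consTy Γ A) (.arr 0 (LTy.enc Γ)
        (.arr 0 (endo A) (.arr 0 (consTy Γ A) (.arr 0 (contTy Q A B) B)))))⟩ := by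
  refine (STyped.caseTm (STyped.var q (LTy.enc Q)) fun q => ?_).app_arr
    (STyped.var b (LTy.enc Γ))
  refine .abs_arr 0 (by simp) (by simp [fv_caseTm]) ?_
  have := STyped.caseTm (STyped.var 0 (LTy.enc Γ))
    fun g => styped_actTm (δ q g).1 (δ q g).2.1 (δ q g).2.2 A B
  convert this using 1
  · simp [LTy.toTy]
  · simp [inst]

theorem styped_moveTm [Inhabited Γ] (δ : Q → Γ → Q × Γ × Turing.Dir) (B : LTy) (i k : ℕ)
    (hk : 11 < k) : STyped {(k, ⟨0, contTy Q (.var i) B⟩)} (moveTm δ (fvar k))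
      ⟨0, contTy Q (popTy Γ i) B⟩ := by
  refine .abs_arr 3 ?_ ?_ (.abs_arr 4 ?_ ?_ (.abs_arr 5 ?_ ?_ ?_))
  any_goals first | (simp; done) | (simp; omega)
  have hL := ((STyped.var 3 (endo (popTy Γ i))).app_arr (styped_popNil default i)).popE B
  have hR := ((STyped.var 4 (endo (popTy Γ i))).app_arr (styped_popNil default i)).popE B
  have h := ((((((styped_actionTm δ 5 11 (.var i) B).app_arr
    (STyped.var 6 (endo (.var i)))).app_arr
    (STyped.var 7 (consTy Γ (.var i)))).app_arr (STyped.var 8 (LTy.enc Γ))).app_arr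
    (STyped.var 9 (endo (.var i)))).app_arr (STyped.var 10 (consTy Γ (.var i)))).app_arr
    (STyped.var k (contTy Q (.var i) B))
  have h₁ : STyped ({(5, ⟨0, LTy.enc Q⟩)} + {(6, ⟨0, endo (.var i)⟩)} +
      {(7, ⟨0, consTy Γ (.var i)⟩)} + {(8, ⟨0, LTy.enc Γ⟩)} + {(k, ⟨0, contTy Q (.var i) B⟩)})
      (abs (abs (abs (app (app (app (app (app (app
        (actionTm δ (fvar 5) (bvar 0)) (fvar 6)) (fvar 7)) (fvar 8)) (bvar 2)) (bvar 1))
        (fvar k))))) ⟨0, .arr 0 (endo (.var i)) (.arr 0 (consTy Γ (.var i))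
          (.arr 0 (LTy.enc Γ) B))⟩ := by
    refine .abs_arr 9 ?_ ?_ (.abs_arr 10 ?_ ?_ (.abs_arr 11 ?_ ?_ ?_))
    any_goals first | (simp; done) | (simp; omega)
    convert h using 1
    · simp only [LTy.toTy]; abel
    · simp [inst]
  have h₂ : STyped ({(5, ⟨0, LTy.enc Q⟩)} + {(4, ⟨0, endo (popTy Γ i)⟩)} +
      {(k, ⟨0, contTy Q (.var i) B⟩)})
      (abs (abs (abs (app (app (fvar 4) (popNil (enc (default : Γ))))
        (abs (abs (abs (app (app (app (app (app (app
        (actionTm δ (fvar 5) (bvar 0)) (bvar 5)) (bvar 4)) (bvar 3)) (bvar 2)) (bvar 1))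
        (fvar k))))))))) ⟨0, .arr 0 (endo (.var i)) (.arr 0 (consTy Γ (.var i))
          (.arr 0 (LTy.enc Γ) B))⟩ := by
    refine .abs_arr 6 ?_ ?_ (.abs_arr 7 ?_ ?_ (.abs_arr 8 ?_ ?_ ?_))
    any_goals first | (simp; done) | (simp; omega)
    convert hR.app_arr h₁ using 1
    · simp only [LTy.toTy]; abel
    · simp [inst]
  convert hL.app_arr h₂ using 1
  · simp only [LTy.toTy]; abel
  · simp [inst]

theorem styped_trTm [Inhabited Γ] (δ : Q → Γ → Q × Γ × Turing.Dir) (m : ℕ) :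
    STyped 0 (trTm δ) ⟨0, .arr 0 (cfgTy Q Γ m) (cfgTy Q Γ m)⟩ := by
  refine .abs_arr 0 (by simp) (by simp [moveTm]) (.cfgI ?_ (.abs_arr 12 ?_ ?_
    (.abs_arr 13 ?_ ?_ ?_)))
  · simp [ClosedTys, Ty.shift]
  any_goals (simp [moveTm]; done)
  have h₁ := (styped_popStep (Γ := Γ) 12 1 (by omega)).sp m
  -- The tape type of the old configuration becomes the type of split lists over the tape type of
  -- the new one.
  have h := (((STyped.var 0 (cfgTy Q Γ m)).cfgE (popTy Γ 1) (.var 0)).app_arr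
    (N := popStep (fvar 12)) (by simpa [Ty.bangN] using h₁)).app_arr
    (styped_moveTm δ (.var 0) 1 13 (by omega))
  convert h using 1
  · simp only [LTy.toTy]; abel
  · simp [inst, moveTm]

/-- The configuration `(q, L, R)` with the head moved after writing `g`. -/
noncomputable def movedTm (q : Q) (g l : Γ) (L R : List Γ) : Turing.Dir → Term
  | .right => cfgTm (g :: l :: L) R q
  | .left => cfgTm L (l :: g :: R) q

theorem conv_actTm (q : Q) (g l : Γ) (L R : List Γ) (D : Turing.Dir) :
    Conv (abs (abs (app (app (app (app (app (app (actTm q g D) (abs (cells (bvar 2) L (bvar 0))))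
      (bvar 1)) (enc l)) (abs (cells (bvar 2) R (bvar 0)))) (bvar 1)) (bvar 0))))
      (movedTm q g l L R D) := by
  cases D
  all_goals
    refine .abs 0 (by simp) (by simp) ?_
    refine .abs 1 (by simp) (by simp) ?_
    simp [inst]
    refine (Conv.beta₆ (by simp) (by simp) (by simp) (by simp) (by simp) (by simp)
      (by simp)).trans ?_
    simp
  · refine Conv.appL (Conv.appR ?_)
    refine .abs 2 (by simp) (by simp [cells_cons]) ?_
    simp [inst, cells_cons]
    refine Conv.appR (Conv.appR ?_)
    exact (Conv.beta (by simp) (by simp)).trans (.of_eq (by simp))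
  · refine Conv.appL (Conv.appL (Conv.appR ?_))
    refine .abs 2 (by simp) (by simp [cells_cons]) ?_
    simp [inst, cells_cons]
    refine Conv.appR (Conv.appR ?_)
    exact (Conv.beta (by simp) (by simp)).trans (.of_eq (by simp))

theorem conv_trTm [Inhabited Γ] (δ : Q → Γ → Q × Γ × Turing.Dir) (q : Q) (l r : Γ)
    (L R : List Γ) : Conv (app (trTm δ) (cfgTm (l :: L) (r :: R) q))
      (movedTm (δ q r).1 (δ q r).2.1 l L R (δ q r).2.2) := by
  -- It suffices to reach, under `λf.λk`, the chosen action applied to the two split half tapes; the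
  -- scanned symbol `r` has been consumed by the choice.
  refine .trans ?_ (conv_actTm _ _ l L R _)
  refine (Conv.beta (by simp [moveTm, popStep]) (by simp)).trans ?_
  simp
  refine .abs 0 (by simp [cfgTm, moveTm]) (by simp) ?_
  refine .abs 1 (by simp [cfgTm, moveTm]) (by simp) ?_
  simp [inst]
  refine (conv_cfgTm_app _ _ q (by simp [popStep]) (by simp [moveTm])).trans ?_
  simp only [moveTm, instAt]
  simp
  refine (Conv.beta₃ (by simp) (by simp [popStep]) (by simp [popStep]) (by simp)).trans ?_
  simp
  refine (Conv.appL (conv_pop (by simp) default l L)).trans ?_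
  refine (Conv.beta (by simp) (by simp [popStep])).trans ?_
  simp
  refine (Conv.beta₃ (by simp [popStep]) (by simp) (by simp) (by simp)).trans ?_
  simp
  refine (Conv.appL (conv_pop (by simp) default r R)).trans ?_
  refine (Conv.beta (by simp) (by simp)).trans ?_
  simp
  refine (Conv.beta₃ (by simp) (by simp) (by simp) (by simp)).trans ?_
  simp
  exact (conv_actionTm δ q r).appL.appL.appL.appL.appL.appL

end Transition
end STAB

namespace STAB
open Term
open LTy (curried curried_succ endo)

section Init
variable {Q Γ : Type*} [Finite Q] [Finite Γ] [Inhabited Γ]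

/-! ### Initial configurations -/

/-- `λb.f (if b then letter 0 else letter 1)`. -/
noncomputable def letterTm (M : ATM Q Γ) (f : Term) : Term :=
  abs (app f (cond (bvar 0) (enc (M.letter true)) (enc (M.letter false))))

/-- Blank cells in front of `z`, their number being the value at the length of the string `s` of the
polynomial with exponents `es`. -/
noncomputable def blanksTm (Γ : Type*) [Finite Γ] [Inhabited Γ] (es : List ℕ) (s f z : Term) :
    Term := chain (app len s) (app f (enc (default : Γ))) es z

/-- The map from strings to initial configurations: blank cells to the left of the head, the input
followed by blank cells to the right. -/
noncomputable def initTm (M : ATM Q Γ) (es : List ℕ) : Term :=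
  abs (abs (abs (app (app (app (bvar 0)
    (abs (blanksTm Γ es (bvar 3) (bvar 2) (bvar 0))))
    -- The first index 3 is the string; the second is the constructor `f`, of index 2, raised by the
    -- binder of `letterTm`.
    (abs (app (app (bvar 3) (letterTm M (bvar 3)))
      (blanksTm Γ es (bvar 3) (bvar 2) (bvar 0))))) (enc M.start))))

theorem styped_letterTm (M : ATM Q Γ) (f : ℕ) (hf : 4 ≠ f) (A : LTy) :
    STyped {(f, ⟨0, consTy Γ A⟩)} (letterTm M (fvar f)) ⟨0, .arr 0 .bool (endo A)⟩ := by
  refine .abs_arr 4 (by simp [hf.symm]) (by simp [hf]) ?_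
  have h := STyped.cond (by simp) (STyped.var 4 .bool)
    ((styped_enc (M.letter true)).weak 4 .bool) ((styped_enc (M.letter false)).weak 4 .bool)
  convert (STyped.var f (consTy Γ A)).app_arr h using 1
  · simp only [LTy.toTy]; abel
  · simp [inst]

theorem styped_blanksTm {es : List ℕ} {d : ℕ} (hes : ∀ i ∈ es, i ≤ d) {s f z : ℕ} {A : LTy} :
    STyped (Multiset.replicate es.sum (s, ⟨max d 1 - 1, strTy 1⟩) +
        Multiset.replicate es.length (f, ⟨d + 1, consTy Γ A⟩) + {(z, ⟨0, A⟩)})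
      (blanksTm Γ es (fvar s) (fvar f) (fvar z)) ⟨0, A⟩ := by
  have hν : STyped {(s, ⟨0, strTy 1⟩)} (app len (fvar s)) ⟨0, natTy 1⟩ := by
    simpa [LTy.toTy] using styped_len.app_arr (STyped.var s (strTy 1))
  have hu : STyped {(f, ⟨0, consTy Γ A⟩)} (app (fvar f) (enc (default : Γ))) ⟨0, endo A⟩ := by
    simpa [LTy.toTy] using (STyped.var f (consTy Γ A)).app_arr (styped_enc (default : Γ))
  exact styped_chain hν hu (STyped.var z A) fun i hi => by have := hes i hi; omega

/-- The string serves as clock for the blanks of both half tapes and once as the input itself; the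
latter use makes one bang necessary even in degree zero, whence `max d 1`. The constructor lies
under at most `d` bangs in the blanks and under one in the letter map. Level `d + 1` covers both,
and contraction yields `d + 2`. -/
theorem styped_initTm (M : ATM Q Γ) {es : List ℕ} {d : ℕ} (hes : ∀ i ∈ es, i ≤ d) :
    STyped 0 (initTm M es) ⟨0, .arr (max d 1) (strTy 1) (cfgTy Q Γ (d + 2))⟩ := by
  refine .abs_arr 0 (by simp) (by simp [blanksTm, letterTm]) (.cfgI ?_
    (.abs_arr 1 ?_ ?_ (.abs_arr 2 ?_ ?_ ?_)))
  · simp [ClosedTys, Ty.shift, strTy]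
  any_goals (simp [blanksTm, letterTm]; done)
  have hb := styped_blanksTm (Γ := Γ) hes (s := 0) (f := 1) (z := 3) (A := .var 1)
  have h₁ : STyped (Multiset.replicate es.sum (0, ⟨max d 1 - 1, strTy 1⟩) +
      Multiset.replicate es.length (1, ⟨d + 1, consTy Γ (.var 1)⟩))
      (abs (blanksTm Γ es (fvar 0) (fvar 1) (bvar 0))) ⟨0, endo (.var 1)⟩ := by
    refine .abs_arr 3 ?_ (by simp [blanksTm]) ?_
    · intro a ha
      rcases Multiset.mem_add.1 ha with ha | ha <;> rw [Multiset.eq_of_mem_replicate ha] <;> simp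
    convert hb using 1
    · abel
    · simp [inst, blanksTm]
  have hs : STyped {(0, ⟨max d 1 - 1, strTy 1⟩)} (fvar 0) ⟨0, strTy 1⟩ := .var_bang _ _ _
  have hl : STyped {(1, ⟨d + 1, consTy Γ (.var 1)⟩)} (letterTm M (fvar 1))
      ⟨1, .arr 0 .bool (endo (.var 1))⟩ := by
    have := STyped.derelict (G := 0) (by
      simpa using (styped_letterTm M 1 (by simp) (.var 1)).sp 1) d
    simpa [Ty.bangN, add_comm] using this
  have h₂ : STyped (Multiset.replicate (es.sum + 1) (0, ⟨max d 1 - 1, strTy 1⟩) +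
      Multiset.replicate (es.length + 1) (1, ⟨d + 1, consTy Γ (.var 1)⟩))
      (abs (app (app (fvar 0) (letterTm M (fvar 1))) (blanksTm Γ es (fvar 0) (fvar 1) (bvar 0))))
      ⟨0, endo (.var 1)⟩ := by
    refine .abs_arr 3 ?_ (by simp [blanksTm, letterTm]) ?_
    · intro a ha
      rcases Multiset.mem_add.1 ha with ha | ha <;> rw [Multiset.eq_of_mem_replicate ha] <;> simp
    convert ((hs.strE (.var 1)).app_arr hl).app_arr hb using 1
    · simp only [Multiset.replicate_succ, ← Multiset.singleton_add]; abel
    · simp [inst, blanksTm, letterTm]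
  have h := (((STyped.var 2 (contTy Q (.var 1) (.var 0))).app_arr h₁).app_arr h₂).app_arr
    (styped_enc M.start)
  have h' := STyped.contract 0 (es.sum + (es.sum + 1)) (σ := ⟨max d 1 - 1, strTy 1⟩)
    (G := Multiset.replicate (es.length + (es.length + 1)) (1, ⟨d + 1, consTy Γ (.var 1)⟩) +
      {(2, ⟨0, contTy Q (.var 1) (.var 0)⟩)}) (h.of_eq (by
        simp only [LTy.toTy, Multiset.replicate_add]; abel))
  have h'' := STyped.contract 1 (es.length + (es.length + 1)) (σ := ⟨d + 1, consTy Γ (.var 1)⟩)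
    (h'.of_eq (add_left_comm _ _ _))
  convert h'' using 1
  · have : max d 1 - 1 + 1 = max d 1 := by omega
    simp only [Ty.bang, this]; abel
  · simp [inst, blanksTm, letterTm]

theorem conv_blanksTm (es : List ℕ) (w : List Bool) {f z : Term} (hf : LC f) (hz : LC z) :
    Conv (blanksTm Γ es (str w) f z)
      (cells f (List.replicate (es.map (w.length ^ ·)).sum (default : Γ)) z) := by
  rw [cells_replicate]
  have hf : LCAt 0 f := hf
  exact conv_chain (by simp) (by simp [hf]) hz (conv_len_str w) es

theorem fv_str (w : List Bool) : (str w).fv = ∅ := by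
  ext x
  simp [str_eq]

theorem conv_initTm (M : ATM Q Γ) (es : List ℕ) (w : List Bool) :
    Conv (app (initTm M es) (str w))
      (cfgTm (List.replicate (es.map (w.length ^ ·)).sum default)
        (w.map M.letter ++ List.replicate (es.map (w.length ^ ·)).sum default) M.start) := by
  refine (Conv.beta (by simp [blanksTm, letterTm]) (by simp)).trans ?_
  simp [blanksTm, letterTm]
  refine .abs 0 (by simp [fv_str]) (by simp) (.abs 1 (by simp [fv_str]) (by simp) ?_)
  simp [inst]
  refine Conv.appL (Conv.app (Conv.appR ?_) ?_)
  · refine .abs 2 (by simp [fv_str]) (by simp) ?_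
    simp [inst]
    exact conv_blanksTm es w (by simp) (by simp)
  · refine .abs 2 (by simp [fv_str]) (by simp) ?_
    simp [inst]
    refine (conv_str_app w (by simp) (by simp)).trans ?_
    rw [cells_append]
    refine (conv_strBody (c' := fvar 0) (g := M.letter) fun b t => ?_).trans
      (.cells _ (conv_blanksTm es w (by simp) (by simp)))
    refine (Conv.beta (by simp) (by simp)).appL.trans ?_
    simp
    cases b
    · exact Conv.condFalse.appR.appL
    · exact Conv.condTrue.appR.appL

/-! ### The implementation of an alternating Turing machine -/

/-- The term `t` encodes the configuration `c` with at least `k` cells to the left of the head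
and at least `k` cells from the head on. -/
def Encodes (C : LTy) (k : ℕ) (c : ATM.Config Q Γ) (t : Term) : Prop :=
  Typed [] t C.toTy ∧ ∃ L R : List Γ, k ≤ L.length ∧ k ≤ R.length ∧
    c.tape = Turing.Tape.mk' (Turing.ListBlank.mk L) (Turing.ListBlank.mk R) ∧
    Conv t (cfgTm L R c.state)

/-- The blank cells supplied as working space do not change the tape they represent. -/
theorem listBlank_mk_append_replicate {X : Type*} [Inhabited X] (L : List X) (n : ℕ) :
    Turing.ListBlank.mk (L ++ List.replicate n default) = Turing.ListBlank.mk L :=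
  Quotient.sound' (Or.inr ⟨n, rfl⟩)

/-- With `k + 1` cells on each side both half tapes are nonempty, so the transition pops real cells.
A move shortens one side by one cell and lengthens the other. -/
theorem Encodes.next {M : ATM Q Γ} {C : LTy} {k : ℕ} {c : ATM.Config Q Γ} {t : Term}
    (h : Encodes C (k + 1) c t) (j : Fin 2)
    (hC : Typed [] (trTm (M.δ j)) (lolli C.toTy C).toTy) :
    Encodes C k (M.next j c) (app (trTm (M.δ j)) t) := by
  obtain ⟨ht, L, R, hL, hR, htape, hconv⟩ := h
  refine ⟨Typed.lolliE (Γ := []) (Δ := []) (by simp [Ctx.dom, List.Disjoint]) hC ht, ?_⟩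
  cases L with
  | nil => simp at hL
  | cons l L =>
  cases R with
  | nil => simp at hR
  | cons r R =>
  have hcv := (Conv.appR hconv).trans (conv_trTm (M.δ j) c.state l r L R)
  have hhead : c.tape.head = r := by rw [htape]; rfl
  simp only [List.length_cons] at hL hR
  -- The direction is made a variable so that case analysis unfolds `movedTm` and the tape move
  -- together.
  obtain ⟨D, hD⟩ : ∃ D, D = (M.δ j c.state r).2.2 := ⟨_, rfl⟩
  have hw : c.tape.write (M.δ j c.state r).2.1 = Turing.Tape.mk' (Turing.ListBlank.mk (l :: L))
      (Turing.ListBlank.mk ((M.δ j c.state r).2.1 :: R)) := by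
    rw [htape, Turing.Tape.write_mk']
    simp
  rw [← hD] at hcv
  simp only [ATM.next, hhead, hw, ← hD]
  cases D with
  | left =>
    refine ⟨L, l :: (M.δ j c.state r).2.1 :: R, by omega, by simp; omega, ?_, hcv⟩
    rw [Turing.Tape.move_left_mk']
    simp
  | right =>
    refine ⟨(M.δ j c.state r).2.1 :: l :: L, R, by simp; omega, by omega, ?_, hcv⟩
    rw [Turing.Tape.move_right_mk']
    simp

theorem implements_atm (M : ATM Q Γ) (p : Polynomial ℕ) {es : List ℕ}
    (hes : ∀ i ∈ es, i ≤ p.natDegree) (hp : ∀ n, (es.map (n ^ ·)).sum = p.eval n) :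
    Implements M (fun n => p.eval n) (max p.natDegree 1) (cfgTy Q Γ (p.natDegree + 2)) (kindTm M)
      (fun j => trTm (M.δ j)) (initTm M es) := by
  have hinit : Typed [] (initTm M es) (lolli (Ty.bangN (max p.natDegree 1) (strTy 1).toTy)
      (cfgTy Q Γ (p.natDegree + 2))).toTy := by
    simpa [lolli, Ty.bangN, LTy.toTy] using (styped_initTm M hes).typed_nil
  refine ⟨(styped_kindTm M _).typed_nil, fun j => (styped_trTm (M.δ j) _).typed_nil, hinit,
    Encodes (cfgTy Q Γ (p.natDegree + 2)), ?_, fun k c t h => h.1, ?_, ?_⟩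
  · intro w
    refine ⟨Typed.lolliE (Γ := []) (Δ := []) (by simp [Ctx.dom, List.Disjoint]) hinit
      ((styped_str w).sp_nil _).typed_nil, _, _, ?_, ?_, ?_, conv_initTm M es w⟩
    -- The blanks alone number `p(|w|)` on each side, one cell for every step to come.
    · simp [hp]
    · simp [hp]
    · have := listBlank_mk_append_replicate ([] : List Γ) (es.map (w.length ^ ·)).sum
      rw [List.nil_append] at this
      rw [this, listBlank_mk_append_replicate]
      rfl
  · rintro k c t ⟨-, L, R, -, -, -, h⟩
    exact (Conv.appR h).trans (conv_kindTm M L R c.state)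
  · exact fun k c t j h => h.next j ((styped_trTm (M.δ j) _).typed_nil)

end Init
end STAB

/-! ### The evaluation term: correctness. -/

namespace STAB
open Term
open LTy (curried curried_succ endo)

/-! ### Pairs and boolean connectives -/

theorem Conv.pair {M M' N N' : Term} (hM : LC M) (hM' : LC M') (hN : LC N) (hN' : LC N')
    (h : Conv M M') (h' : Conv N N') : Conv (pair M N) (pair M' N') := by
  obtain ⟨x, hx⟩ := (M.fv ∪ M'.fv ∪ N.fv ∪ N'.fv).exists_notMem
  simp only [Finset.mem_union, not_or] at hx
  refine .abs x (by simp [hx]) (by simp [hx]) ?_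
  simp [inst, hM.instAt_eq, hM'.instAt_eq, hN.instAt_eq, hN'.instAt_eq]
  exact (Conv.appR h).app h'

theorem conv_fst {M : Term} {a b : Bool} (h : Conv M (pair (.bool a) (.bool b))) :
    Conv (fst M) (.bool a) := by
  refine (Conv.appL h).trans ((Conv.beta (by simp) (by simp [lam, closeAt])).trans ?_)
  simp [lam, closeAt]
  exact Conv.beta₂ (by simp) (by simp) (by simp)

theorem conv_snd {M : Term} {a b : Bool} (h : Conv M (pair (.bool a) (.bool b))) :
    Conv (snd M) (.bool b) := by
  refine (Conv.appL h).trans ((Conv.beta (by simp) (by simp [lam, closeAt])).trans ?_)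
  simp [lam, closeAt]
  exact Conv.beta₂ (by simp) (by simp) (by simp)

theorem conv_orTm {M N : Term} {a b : Bool} (hM : Conv M (.bool a)) (hN : Conv N (.bool b)) :
    Conv (orTm M N) (.bool (a || b)) := by
  refine (hM.cond (.refl _) (hN.cond (.refl _) (.refl _))).trans ?_
  cases a
  · refine Conv.condFalse.trans ?_
    cases b
    · exact .condFalse
    · exact .condTrue
  · exact .condTrue

theorem conv_andTm {M N : Term} {a b : Bool} (hM : Conv M (.bool a)) (hN : Conv N (.bool b)) :
    Conv (andTm M N) (.bool (a && b)) := by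
  refine (hM.cond (hN.cond (.refl _) (.refl _)) (.refl _)).trans ?_
  cases a
  · exact .condFalse
  · refine Conv.condTrue.trans ?_
    cases b
    · exact .condFalse
    · exact .condTrue

/-- At a final state the answer is copied from the kind, so nothing is asked of `M₁` and `M₂`; the
successors need not have a value. -/
theorem conv_alphaTm_final {M₀ M₁ M₂ : Term} {b : Bool} (hlc : LC M₀)
    (h : Conv M₀ (pair (.bool false) (.bool b))) :
    Conv (alphaTm M₀ M₁ M₂) (pair (.bool false) (.bool b)) := by
  refine ((conv_fst h).cond (.refl _) (.refl _)).trans (Conv.condFalse.trans ?_)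
  have hlc : LCAt 0 M₀ := hlc
  exact .pair (by simp) (by simp) (by simp [snd, lam, closeAt, hlc]) (by simp) (.refl _)
    (conv_snd h)

theorem conv_alphaTm_or {M₀ M₁ M₂ : Term} {a₁ a₂ b₁ b₂ : Bool} (hlc₁ : LC M₁) (hlc₂ : LC M₂)
    (h : Conv M₀ (pair (.bool true) (.bool true))) (h₁ : Conv M₁ (pair (.bool a₁) (.bool b₁)))
    (h₂ : Conv M₂ (pair (.bool a₂) (.bool b₂))) :
    Conv (alphaTm M₀ M₁ M₂) (pair (.bool true) (.bool (b₁ || b₂))) := by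
  refine ((conv_fst h).cond (.refl _) (.refl _)).trans (Conv.condTrue.trans ?_)
  refine ((conv_snd h).cond (.refl _) (.refl _)).trans (Conv.condTrue.trans ?_)
  have hlc₁ : LCAt 0 M₁ := hlc₁
  have hlc₂ : LCAt 0 M₂ := hlc₂
  exact .pair (by simp) (by simp) (by simp [orTm, snd, lam, closeAt, hlc₁, hlc₂]) (by simp)
    (.refl _) (conv_orTm (conv_snd h₁) (conv_snd h₂))

theorem conv_alphaTm_and {M₀ M₁ M₂ : Term} {a₁ a₂ b₁ b₂ : Bool} (hlc₁ : LC M₁) (hlc₂ : LC M₂)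
    (h : Conv M₀ (pair (.bool true) (.bool false))) (h₁ : Conv M₁ (pair (.bool a₁) (.bool b₁)))
    (h₂ : Conv M₂ (pair (.bool a₂) (.bool b₂))) :
    Conv (alphaTm M₀ M₁ M₂) (pair (.bool true) (.bool (b₁ && b₂))) := by
  refine ((conv_fst h).cond (.refl _) (.refl _)).trans (Conv.condTrue.trans ?_)
  refine ((conv_snd h).cond (.refl _) (.refl _)).trans (Conv.condFalse.trans ?_)
  have hlc₁ : LCAt 0 M₁ := hlc₁
  have hlc₂ : LCAt 0 M₂ := hlc₂
  exact .pair (by simp) (by simp) (by simp [andTm, snd, lam, closeAt, hlc₁, hlc₂]) (by simp)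
    (.refl _) (conv_andTm (conv_snd h₁) (conv_snd h₂))

/-! ### Closed terms -/

theorem Typed.fv_eq_empty {M : Term} {σ : Ty} (h : Typed [] M σ) : M.fv = ∅ :=
  Finset.eq_empty_of_forall_notMem fun x hx => by simpa [Ctx.dom] using h.fv_subset x hx

/-- No free variables and no dangling bound variables. -/
structure ClosedTm (M : Term) : Prop where
  lc : LC M
  fv : M.fv = ∅

theorem Typed.closedTm {M : Term} {σ : Ty} (h : Typed [] M σ) : ClosedTm M :=
  ⟨h.lc, h.fv_eq_empty⟩

namespace ClosedTm

theorem lcAt {M : Term} (h : ClosedTm M) (k : ℕ) : LCAt k M := h.lc.lcAt k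

theorem instAt_eq {M : Term} (h : ClosedTm M) (k : ℕ) (N : Term) : instAt k N M = M :=
  h.lc.instAt_eq k N

theorem closeAt_eq {M : Term} (h : ClosedTm M) (k x : ℕ) : closeAt k x M = M :=
  closeAt_of_notMem (by simp [h.fv])

end ClosedTm

section Eval
variable {kind : Term} {tr : Fin 2 → Term}

/-! ### The step function -/

theorem closedTm_stepTm (hk : ClosedTm kind) (ht : ∀ j, ClosedTm (tr j)) :
    ClosedTm (stepTm kind tr) := by
  have hlc : ∀ j k, LCAt k (tr j) := fun j => (ht j).lcAt
  refine ⟨?_, ?_⟩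
  · simp [stepTm, alphaTm, lam, closeAt, fst, snd, pair, orTm, andTm, hk.closeAt_eq,
      (ht _).closeAt_eq, hk.lcAt, hlc]
  · simp [stepTm, alphaTm, lam, closeAt, fst, snd, pair, orTm, andTm, hk.closeAt_eq,
      (ht _).closeAt_eq, hk.fv, (ht _).fv]

theorem closedTm_baseTm (hk : ClosedTm kind) : ClosedTm (baseTm kind) := by
  refine ⟨?_, ?_⟩
  · simp [baseTm, lam, closeAt, hk.closeAt_eq, hk.lcAt]
  · simp [baseTm, lam, closeAt, hk.closeAt_eq, hk.fv]

theorem conv_baseTm (hk : ClosedTm kind) {t : Term} (ht : LC t) :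
    Conv (app (baseTm kind) t) (app kind t) := by
  simp only [baseTm, lam, closeAt, hk.closeAt_eq, if_true]
  refine (Conv.beta (by simp [hk.lcAt]) ht).trans (.of_eq ?_)
  simp [hk.instAt_eq]

theorem conv_stepTm (hk : ClosedTm kind) (htr : ∀ j, ClosedTm (tr j)) {h t : Term} (hh : LC h)
    (ht : LC t) : Conv (app (app (stepTm kind tr) h) t)
      (alphaTm (app kind t) (app h (app (tr 0) t)) (app h (app (tr 1) t))) := by
  have hlc : ∀ j k, LCAt k (tr j) := fun j => (htr j).lcAt
  refine (Conv.beta₂ ?_ hh ht).trans (.of_eq ?_)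
  · simp [alphaTm, lam, closeAt, fst, snd, pair, orTm, andTm, hk.closeAt_eq,
      (htr _).closeAt_eq, hk.lcAt, hlc]
  · simp [alphaTm, lam, closeAt, fst, snd, pair, orTm, andTm, hk.closeAt_eq,
      (htr _).closeAt_eq, hk.instAt_eq, (htr _).instAt_eq, hh.instAt_eq]

variable {Q Γ : Type*} [Inhabited Γ]

theorem ATM.accepts_iff_of_existential {M : ATM Q Γ} {c : ATM.Config Q Γ}
    (h : M.kind c.state = .existential) :
    M.Accepts c ↔ M.Accepts (M.next 0 c) ∨ M.Accepts (M.next 1 c) := by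
  constructor
  · rintro (h' | ⟨j, h', ha⟩ | ⟨h', ha⟩)
    · simp [h] at h'
    · fin_cases j
      · exact .inl ha
      · exact .inr ha
    · simp [h] at h'
  · rintro (ha | ha)
    · exact .existential 0 h ha
    · exact .existential 1 h ha

theorem ATM.accepts_iff_of_universal {M : ATM Q Γ} {c : ATM.Config Q Γ}
    (h : M.kind c.state = .universal) :
    M.Accepts c ↔ M.Accepts (M.next 0 c) ∧ M.Accepts (M.next 1 c) := by
  constructor
  · rintro (h' | ⟨j, h', ha⟩ | ⟨h', ha⟩)
    · simp [h] at h'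
    · simp [h] at h'
    · exact ⟨ha 0, ha 1⟩
  · rintro ⟨h₀, h₁⟩
    exact .universal h (Fin.forall_fin_two.2 ⟨h₀, h₁⟩)

theorem ATM.not_accepts_of_rejecting {M : ATM Q Γ} {c : ATM.Config Q Γ}
    (h : M.kind c.state = .rejecting) : ¬ M.Accepts c := by
  rintro (h' | ⟨j, h', ha⟩ | ⟨h', ha⟩) <;> simp [h] at h'

/-- The iterated step function computes the value of an encoded configuration. -/
theorem conv_iterate_stepTm {M : ATM Q Γ} {C : LTy} {R : ℕ → ATM.Config Q Γ → Term → Prop}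
    (hk : ClosedTm kind) (htr : ∀ j, ClosedTm (tr j))
    (hR₁ : ∀ k c t, R k c t → Typed [] t C.toTy)
    (hR₂ : ∀ k c t, R k c t → Conv (app kind t) (M.kind c.state).code)
    (hR₃ : ∀ k c t j, R (k + 1) c t → R k (M.next j c) (app (tr j) t)) (k : ℕ) :
    ∀ {c t}, M.HaltsIn k c → R k c t → ∃ a b, (b = true ↔ M.Accepts c) ∧
      Conv (app ((app (stepTm kind tr))^[k] (baseTm kind)) t) (pair (.bool a) (.bool b)) := by
  induction k with
  | zero =>
    intro c t hh hR
    have hlc := (hR₁ _ _ _ hR).lc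
    have hcv := (conv_baseTm hk hlc).trans (hR₂ _ _ _ hR)
    cases hh with
    | final hf =>
      rcases hf with hf | hf <;> rw [hf] at hcv
      · exact ⟨false, true, by simpa using ATM.Accepts.accepting hf, hcv⟩
      · exact ⟨false, false, by simpa using ATM.not_accepts_of_rejecting hf, hcv⟩
  | succ k ih =>
    intro c t hh hR
    have hlc := (hR₁ _ _ _ hR).lc
    have hlk : LC ((app (stepTm kind tr))^[k] (baseTm kind)) :=
      lcAt_iterate_app (closedTm_stepTm hk htr).lc (closedTm_baseTm hk).lc
    have hcode := hR₂ _ _ _ hR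
    have hs := conv_stepTm hk htr hlk hlc
    rw [Function.iterate_succ_apply']
    -- Only a nonfinal state forces halting to have come from its successors; a final one may do so
    -- with steps to spare.
    have hstep : M.kind c.state = .existential ∨ M.kind c.state = .universal →
        ∀ j, M.HaltsIn k (M.next j c) := by
      intro hc
      cases hh with
      | final hf => rcases hc with hc | hc <;> simp [hc] at hf
      | step h => exact h
    have hlcj : ∀ j, LC (app ((app (stepTm kind tr))^[k] (baseTm kind)) (app (tr j) t)) :=
      fun j => ⟨hlk, (htr j).lc, hlc⟩
    -- The first components are left arbitrary in the induction: only second components are read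
    -- from the successors.
    cases hκ : M.kind c.state with
    | accepting =>
      rw [hκ] at hcode
      exact ⟨false, true, by simpa using ATM.Accepts.accepting hκ,
        hs.trans (conv_alphaTm_final ⟨hk.lc, hlc⟩ hcode)⟩
    | rejecting =>
      rw [hκ] at hcode
      exact ⟨false, false, by simpa using ATM.not_accepts_of_rejecting hκ,
        hs.trans (conv_alphaTm_final ⟨hk.lc, hlc⟩ hcode)⟩
    | universal =>
      rw [hκ] at hcode
      obtain ⟨a₀, b₀, hb₀, h₀⟩ := ih (hstep (.inr hκ) 0) (hR₃ _ _ _ 0 hR)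
      obtain ⟨a₁, b₁, hb₁, h₁⟩ := ih (hstep (.inr hκ) 1) (hR₃ _ _ _ 1 hR)
      exact ⟨true, b₀ && b₁, by
        rw [ATM.accepts_iff_of_universal hκ, ← hb₀, ← hb₁, Bool.and_eq_true],
        hs.trans (conv_alphaTm_and (hlcj 0) (hlcj 1) hcode h₀ h₁)⟩
    | existential =>
      rw [hκ] at hcode
      obtain ⟨a₀, b₀, hb₀, h₀⟩ := ih (hstep (.inl hκ) 0) (hR₃ _ _ _ 0 hR)
      obtain ⟨a₁, b₁, hb₁, h₁⟩ := ih (hstep (.inl hκ) 1) (hR₃ _ _ _ 1 hR)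
      exact ⟨true, b₀ || b₁, by
        rw [ATM.accepts_iff_of_existential hκ, ← hb₀, ← hb₁, Bool.or_eq_true],
        hs.trans (conv_alphaTm_or (hlcj 0) (hlcj 1) hcode h₀ h₁)⟩

/-! ### The evaluation term -/

theorem evalTm_eq {P init : Term} (hk : ClosedTm kind) (htr : ∀ j, ClosedTm (tr j))
    (hP : ClosedTm P) (hi : ClosedTm init) : evalTm P kind tr init =
      abs (app extTm (app (app (app (app P (app len (bvar 0))) (stepTm kind tr)) (baseTm kind))
        (app init (bvar 0)))) := by
  have hl : closeAt 0 0 len = len := closeAt_of_notMem (by simp)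
  have he : closeAt 0 0 extTm = extTm := closeAt_of_notMem (by simp [extTm, lam, closeAt])
  simp [evalTm, lam, closeAt, hl, he, (closedTm_stepTm hk htr).closeAt_eq,
    (closedTm_baseTm hk).closeAt_eq, hP.closeAt_eq, hi.closeAt_eq]

theorem conv_evalTm_app {P init : Term} (hk : ClosedTm kind) (htr : ∀ j, ClosedTm (tr j))
    (hP : ClosedTm P) (hi : ClosedTm init) {w : List Bool} {n : ℕ} {a b : Bool}
    (hn : Conv (app P (num w.length)) (num n))
    (h : Conv (app ((app (stepTm kind tr))^[n] (baseTm kind)) (app init (str w)))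
      (pair (.bool a) (.bool b))) :
    Conv (app (evalTm P kind tr init) (str w)) (.bool b) := by
  have hs := closedTm_stepTm hk htr
  have hb := closedTm_baseTm hk
  have he : ∀ k, LCAt k extTm := fun k => LC.lcAt (by simp [extTm, lam, closeAt]) k
  have he' : ∀ k N, instAt k N extTm = extTm := fun k N => LC.instAt_eq (he 0) k N
  rw [evalTm_eq hk htr hP hi]
  refine (Conv.beta (by simp [he, hs.lcAt, hb.lcAt, hP.lcAt, hi.lcAt]) (lc_str w)).trans ?_
  simp [he', hs.instAt_eq, hb.instAt_eq, hP.instAt_eq, hi.instAt_eq]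
  have h₁ : Conv (app P (app len (str w))) (num n) := (Conv.appR (conv_len_str w)).trans hn
  refine (Conv.appR ((h₁.appL.appL.appL.trans (conv_num_app n hs.lc hb.lc).appL).trans h)).trans ?_
  refine (Conv.beta (by simp [lam, closeAt]) (by simp [pair])).trans ?_
  simp [lam, closeAt]
  exact conv_snd (M := pair (.bool a) (.bool b)) (.refl _)

/-! ### The evaluation term: typing. -/

theorem styped_fst {G : Multiset (ℕ × Ty)} {M : Term} (h : STyped G M ⟨0, bool2Ty⟩) :
    STyped G (fst M) ⟨0, .bool⟩ := by
  have hK : STyped 0 (abs (abs (bvar 1))) ⟨0, .arr 0 .bool (endo .bool)⟩ := by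
    refine .abs_arr 0 (by simp) (by simp) (.abs_arr 1 (by simp) (by simp) ?_)
    exact (STyped.var 0 .bool).weak 1 .bool
  simpa [fst, lam, closeAt] using (h.bool2E .bool).app_arr hK

theorem styped_snd {G : Multiset (ℕ × Ty)} {M : Term} (h : STyped G M ⟨0, bool2Ty⟩) :
    STyped G (snd M) ⟨0, .bool⟩ := by
  have hK : STyped 0 (abs (abs (bvar 0))) ⟨0, .arr 0 .bool (endo .bool)⟩ := by
    refine .abs_arr 0 (by simp) (by simp) (.abs_arr 1 (by simp) (by simp) ?_)
    exact ((STyped.var 1 .bool).weak 0 .bool).of_eq (by simp only [LTy.toTy]; abel)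
  simpa [snd, lam, closeAt] using (h.bool2E .bool).app_arr hK

theorem STyped.weaken {G : Multiset (ℕ × Ty)} {M : Term} {σ : Ty} (h : STyped 0 M σ)
    (hG : ∀ a ∈ G, a.2.bangs = 0) : STyped G M σ := by
  induction G using Multiset.induction_on with
  | empty => exact h
  | cons a G ih =>
    have := (ih fun b hb => hG b (by simp [hb])).weak a.1 a.2.body
    have ha : a.2.body.toTy = a.2 := by
      have := hG a (by simp)
      rcases a with ⟨x, k, A⟩
      simp only at this
      subst this
      rfl
    rw [ha] at this
    simpa using this

/-- The additive rule for `if` is decisive: `h` and `c` are used in guards and branches alike, yet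
every subterm is typed in the one linear context `G`, and no contraction occurs. Writing the
connectives as nested conditionals allows both recursive calls this way. -/
theorem styped_stepTm {C : LTy} (hC : C.shift 0 = C)
    (hk : Typed [] kind (lolli C.toTy bool2Ty).toTy)
    (htr : ∀ j, Typed [] (tr j) (lolli C.toTy C).toTy) :
    STyped 0 (stepTm kind tr) ⟨0, endo (.arr 0 C bool2Ty)⟩ := by
  set G : Multiset (ℕ × Ty) := {(1, ⟨0, C⟩)} + {(0, ⟨0, .arr 0 C bool2Ty⟩)} with hG
  have hnd : (G.map Prod.fst).Nodup := by simp [hG]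
  have h0 : STyped 0 kind ⟨0, .arr 0 C bool2Ty⟩ := hk.styped_nil
  have hj : ∀ j, STyped 0 (tr j) ⟨0, .arr 0 C C⟩ := fun j => (htr j).styped_nil
  have hM₀ : STyped G (app kind (fvar 1)) ⟨0, bool2Ty⟩ :=
    ((h0.app_arr (STyped.var 1 C)).weak 0 (.arr 0 C bool2Ty)).of_eq (by
      simp only [hG, LTy.toTy]; abel)
  have hM : ∀ j, STyped G (app (fvar 0) (app (tr j) (fvar 1))) ⟨0, bool2Ty⟩ := fun j =>
    ((STyped.var 0 (.arr 0 C bool2Ty)).app_arr ((hj j).app_arr (STyped.var 1 C))).of_eq (by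
      simp only [hG, LTy.toTy]; abel)
  have hcl : ClosedTys (0 + G) := by
    simp [ClosedTys, hG, Ty.shift, hC, bool2Ty]
  have hlin : ∀ a ∈ G, a.2.bangs = 0 := by simp [hG]
  have hbool : ∀ b, STyped G (.bool b) ⟨0, .bool⟩ := fun b => (STyped.bool b).weaken hlin
  have hx : ∀ a ∈ 0 + G, a.1 ≠ 2 := by simp [hG]
  have hkf := hk.fv_eq_empty
  have htf := fun j => (htr j).fv_eq_empty
  have h : STyped G (alphaTm (app kind (fvar 1)) (app (fvar 0) (app (tr 0) (fvar 1)))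
      (app (fvar 0) (app (tr 1) (fvar 1)))) ⟨0, bool2Ty⟩ := by
    refine .cond hnd (styped_fst hM₀) (.cond hnd (styped_snd hM₀) ?_ ?_) ?_
    · rw [← zero_add G]
      refine styped_pair (x := 2) hx (by simp) ?_ hcl (.bool _)
        (.cond hnd (styped_snd (hM 0)) (hbool _)
          (.cond hnd (styped_snd (hM 1)) (hbool _) (hbool _)))
      simp [orTm, snd, lam, closeAt, htf]
    · rw [← zero_add G]
      refine styped_pair (x := 2) hx (by simp) ?_ hcl (.bool _)
        (.cond hnd (styped_snd (hM 0))
          (.cond hnd (styped_snd (hM 1)) (hbool _) (hbool _)) (hbool _))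
      simp [andTm, snd, lam, closeAt, htf]
    · rw [← zero_add G]
      refine styped_pair (x := 2) hx (by simp) ?_ hcl (.bool _) (styped_snd hM₀)
      simp [snd, lam, closeAt, hkf]
  have h' : Typed [(1, ⟨0, C⟩), (0, ⟨0, .arr 0 C bool2Ty⟩)] _ _ := h.typed rfl (by simp [Ctx.dom])
  exact (Typed.lolliI (σ := ⟨0, .arr 0 C bool2Ty⟩) (A := .arr 0 C bool2Ty)
    (Typed.lolliI (σ := ⟨0, C⟩) h')).styped_nil

theorem styped_baseTm {C : LTy} (hk : Typed [] kind (lolli C.toTy bool2Ty).toTy) :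
    STyped 0 (baseTm kind) ⟨0, .arr 0 C bool2Ty⟩ := by
  have h : Typed [(0, ⟨0, C⟩)] (app kind (fvar 0)) bool2Ty.toTy :=
    Typed.lolliE (Γ := []) (by simp [Ctx.dom, List.Disjoint]) hk (.ax 0 C)
  exact (Typed.lolliI (σ := ⟨0, C⟩) h).styped_nil

theorem styped_extTm : STyped 0 extTm ⟨0, .arr 0 bool2Ty .bool⟩ := by
  have : extTm = abs (snd (bvar 0)) := by simp [extTm, snd, lam, closeAt]
  rw [this]
  refine .abs_arr 0 (by simp) (by simp [snd, lam, closeAt]) ?_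
  exact styped_snd (by simpa [LTy.toTy, inst] using STyped.var 0 bool2Ty)

/-- The two uses of the string lie under `d` and `e` bangs. As `d ≤ e`, both are brought to level
`e` and contracted, giving `e + 1`. `Step` goes under `2 * d + 1` bangs at no cost because it is
closed. -/
theorem typed_evalTm {C : LTy} {P init : Term} {d e : ℕ} (hde : d ≤ e) (hC : C.shift 0 = C)
    (hP : STyped 0 P ⟨0, .arr d (natTy 1) (natTy (2 * d + 1))⟩)
    (hk : Typed [] kind (lolli C.toTy bool2Ty).toTy)
    (htr : ∀ j, Typed [] (tr j) (lolli C.toTy C).toTy)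
    (hi : STyped 0 init ⟨0, .arr e (strTy 1) C⟩) :
    Typed [] (evalTm P kind tr init) ⟨0, .arr (e + 1) (strTy 1) .bool⟩ := by
  have hlen : STyped {(0, ⟨e, strTy 1⟩)} (app len (fvar 0)) ⟨d, natTy 1⟩ := by
    have := STyped.derelict (G := 0) (by
      simpa using (styped_len.app_arr (STyped.var 0 (strTy 1))).sp d) (e - d)
    simpa [Ty.bangN, LTy.toTy, Nat.add_sub_cancel' hde] using this
  have hs : STyped {(0, ⟨e, strTy 1⟩)} (fvar 0) ⟨e, strTy 1⟩ := by
    simpa [Ty.bangN, LTy.toTy] using (STyped.var 0 (strTy 1)).sp e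
  have hstep : STyped 0 (stepTm kind tr) ⟨2 * d + 1, endo (.arr 0 C bool2Ty)⟩ := by
    simpa [Ty.bangN] using (styped_stepTm hC hk htr).sp_nil (2 * d + 1)
  have h := styped_extTm.app_arr
    (((((hP.app_arr hlen).natE (.arr 0 C bool2Ty)).app_arr hstep).app_arr
      (styped_baseTm hk)).app_arr (hi.app_arr hs))
  have h' := STyped.contract 0 2 (σ := ⟨e, strTy 1⟩) (G := 0) (h.of_eq (by
    simp only [Multiset.replicate_succ, Multiset.replicate_zero, ← Multiset.singleton_add]; abel))
  have h'' : Typed [(0, ⟨e + 1, strTy 1⟩)] _ _ := h'.typed rfl (by simp [Ctx.dom])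
  exact .lolliI (σ := ⟨e + 1, strTy 1⟩) h''

end Eval
end STAB

/-! ### Assembly of the main result. -/

theorem mainTheorem3 {Q Γ : Type*} [Finite Q] [Finite Γ] [Inhabited Γ] (M : STAB.ATM Q Γ)
    (D : List Bool → Bool) (p : Polynomial ℕ)
    (hM : M.DecidesInTime D (fun n => p.eval n)) :
    STAB.BProgrammable STAB.str D ∧
    ∃ (C : STAB.LTy) (P kind : STAB.Term) (tr : Fin 2 → STAB.Term) (init : STAB.Term),
      STAB.DefinesPoly P p ∧
      STAB.Implements M (fun n => p.eval n) (max p.natDegree 1) C kind tr init ∧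
      STAB.Typed [] (STAB.evalTm P kind tr init)
        (STAB.lolli (STAB.Ty.bangN (max p.natDegree 1 + 1) (STAB.strTy 1).toTy)
          STAB.LTy.bool).toTy ∧
      STAB.Programs STAB.str (STAB.evalTm P kind tr init) D := by
  obtain ⟨es, hes, hp⟩ := STAB.exists_exponents p
  have himp := STAB.implements_atm M p hes hp
  have hP := STAB.styped_polyTm hes
  have hinit := STAB.styped_initTm M hes
  obtain ⟨hkind, htr, -, R, hR₀, hR₁, hR₂, hR₃⟩ := id himp
  have heval := STAB.typed_evalTm (le_max_left p.natDegree 1) (STAB.shift_cfgTy 0 _) hP hkind htr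
    hinit
  have hprog : STAB.Programs STAB.str (STAB.evalTm (STAB.polyTm es) (STAB.kindTm M)
      (fun j => STAB.trTm (M.δ j)) (STAB.initTm M es)) D := by
    intro w
    have hty : STAB.IsProgram (STAB.Term.app (STAB.evalTm (STAB.polyTm es) (STAB.kindTm M)
        (fun j => STAB.trTm (M.δ j)) (STAB.initTm M es)) (STAB.str w)) := by
      refine ((STAB.STyped.app_arr heval.styped_nil (H := 0) ?_).of_eq (zero_add 0)).typed_nil
      simpa [STAB.Ty.bangN] using (STAB.styped_str w).sp_nil (max p.natDegree 1 + 1)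
    refine ⟨hty, fun b => ?_⟩
    obtain ⟨hhalt, hacc⟩ := hM w
    obtain ⟨a, b', hb', hconv⟩ := STAB.conv_iterate_stepTm hkind.closedTm
      (fun j => (htr j).closedTm) hR₁ hR₂ hR₃ _ hhalt (hR₀ w)
    have hn : STAB.Conv (.app (STAB.polyTm es) (STAB.num w.length))
        (STAB.num (p.eval w.length)) := hp w.length ▸ STAB.conv_polyTm es w.length
    have hcv := STAB.conv_evalTm_app hkind.closedTm (fun j => (htr j).closedTm)
      hP.typed_nil.closedTm hinit.typed_nil.closedTm hn hconv
    -- Both booleans are true exactly when the initial configuration leads to acceptance.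
    obtain rfl : D w = b' := by
      rw [Bool.eq_iff_iff, hacc, hb']
    exact (STAB.evaluatesTo_iff_of_conv hty.lc hty.fv_eq_empty hcv).symm
  refine ⟨⟨_, hprog⟩, _, _, _, _, _, ⟨?_, fun n => hp n ▸ STAB.conv_polyTm es n⟩, himp, ?_, hprog⟩
  · simpa [STAB.lolli, STAB.Ty.bangN, STAB.LTy.toTy] using hP.typed_nil
  · simpa [STAB.lolli, STAB.Ty.bangN, STAB.LTy.toTy] using heval
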